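/- Let $\mathcal H_A,\mathcal H_B$ be complex separable (possibly infinite-dimensional) Hilbert spaces and let $\rho$ be a density operator on $\mathcal H_A\otimes\mathcal H_B$ with finite local entropy on at least one side, $\min\{S(\rho_A),S(\rho_B)\}<\infty$, where $\rho_A,\rho_B$ are the reduced states and $S(\sigma)=-\operatorname{Tr}[\sigma\log_2\sigma]\in[0,\infty]$ is the quantum entropy. The entanglement of formation is $$E_f(\rho)=\inf\Big\{\sum_x p(x)\,S(\psi_x^A)\;:\;\rho=\sum_x p(x)\,|\psi_x\rangle\langle\psi_x|\Big\},$$ the infimum running over all countable convex decompositions of $\rho$ into pure states. For $n\ge 1$, regard $\rho^{\otimes n}$ as a bipartite state of $A^n:B^n$. Then the limit defining the regularized entanglement of formation exists and $$E_f^\infty(\rho)=\lim_{n\to\infty}\frac1n E_f(\rho^{\otimes n})=\inf_{n\ge 1}\frac1n E_f(\rho^{\otimes n}).$$ Moreover, for every class of operations $$\mathcal O\in\{\mathrm{LOCC}_\to,\ \mathrm{LOCC}_\leftarrow,\ \mathrm{LOCC}_{\mathbb N},\ \mathrm{LOCC},\ \overline{\mathrm{LOCC}},\ \mathrm{SEP}_{\mathbb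 N},\ \mathrm{SEP}\}$$ (one-way LOCC from Alice to Bob, one-way LOCC from Bob to Alice, finite-round LOCC, LOCC with possibly infinitely many rounds, the strong closure of $\mathrm{LOCC}_{\mathbb N}$, countably separable channels, and the strong closure of $\mathrm{SEP}_{\mathbb N}$, respectively), the entanglement cost $$E_{c,\mathcal O}(\rho)=\inf\Big\{r>0\;:\;\lim_{n\to\infty}\ \inf_{\mathcal E\in\mathcal O}\ \tfrac12\big\|\mathcal E\big(\Phi^{\otimes\lfloor rn\rfloor}\big)-\rho^{\otimes n}\big\|_1=0\Big\}$$ (with $\inf\emptyset=+\infty$), where $\Phi=|\Phi\rangle\langle\Phi|$ with $|\Phi\rangle=(|00\rangle+|11\rangle)/\sqrt2$ is the ebit and $\mathcal E$ maps states of $\lfloor rn\rfloor+\lfloor rn\rfloor$ qubits to states of $A^n:B^n$, satisfies $$E_{c,\mathcal O}(\rho)\le E_f^\infty(\rho).$$ Here the instruments have countable outcome sets. An instrument is in $\mathrm{LOCC}_\to$ (resp. $\mathrm{LOCC}_\leftarrow$) if it is a coarse-graining of one of the form $(\mathcal F_i\otimes\mathcal G_i)_i$ in which Alice's (resp. Bob's)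 maps are completely positive and the other party's maps are channels. $\mathrm{LOCC}_{\mathbb N}$ consists of the coarse-grainings of finitely many adaptively composed instruments of these two forms. A channel is in $\mathrm{LOCC}$ if it is the strong limit of the channels obtained by summing over the outcomes of instruments $\mathcal I_1,\mathcal I_2,\dots\in\mathrm{LOCC}_{\mathbb N}$, each $\mathcal I_{\nu+1}$ obtained from $\mathcal I_\nu$ by appending one more such round and coarse-graining. $\mathrm{SEP}_{\mathbb N}$ consists of the channels with a countable Kraus decomposition into operators $K_\alpha\otimes L_\alpha$. Strong convergence means trace-norm convergence on every trace-class operator. -/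

import Mathlib

open scoped ENNReal NNReal InnerProductSpace TensorProduct ComplexOrder Topology
open Filter TopologicalSpace

universe u

noncomputable section
namespace EntanglementCost

section TraceClass

variable {H : Type*} [NormedAddCommGroup H] [InnerProductSpace ℂ H] [CompleteSpace H]

variable (H) in
/-- An index set for an orthonormal basis of `H`. -/
def basisIndex : Set H := (exists_hilbertBasis ℂ H).choose

variable (H) in
/-- An orthonormal basis of `H`, chosen once and for all. -/
def basis : HilbertBasis (basisIndex H) ℂ H := (exists_hilbertBasis ℂ H).choose_spec.choose

/-- The trace `∑ₙ ⟨n|T|n⟩ ∈ [0, ∞]` of a positive semidefinite operator `T`. -/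
def posTrace (T : H →L[ℂ] H) : ℝ≥0∞ :=
  ∑' i, ENNReal.ofReal (⟪basis H i, T (basis H i)⟫_ℂ).re

/-- The trace norm `‖T‖₁ = Tr |T| ∈ [0, ∞]`, where `|T| = √(T† T)`. -/
def traceNorm (T : H →L[ℂ] H) : ℝ≥0∞ := posTrace (CFC.abs T)

theorem norm_abs_apply (T : H →L[ℂ] H) (v : H) : ‖CFC.abs T v‖ = ‖T v‖ := by
  have h1 : (CFC.abs T).adjoint ∘L (CFC.abs T) = T.adjoint ∘L T := by
    have h := CFC.abs_mul_abs T
    have h2 : star (CFC.abs T) = CFC.abs T := (CFC.abs_nonneg T).isSelfAdjoint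
    rw [← ContinuousLinearMap.star_eq_adjoint, ← ContinuousLinearMap.star_eq_adjoint, h2]
    exact h
  have h2 : ⟪CFC.abs T v, CFC.abs T v⟫_ℂ = ⟪T v, T v⟫_ℂ := by
    have := congrArg (fun X : H →L[ℂ] H => ⟪v, X v⟫_ℂ) h1
    simpa [ContinuousLinearMap.adjoint_inner_right] using this
  rw [inner_self_eq_norm_sq_to_K, inner_self_eq_norm_sq_to_K] at h2
  have h3 : ‖CFC.abs T v‖ ^ 2 = ‖T v‖ ^ 2 := by exact_mod_cast h2
  exact (sq_eq_sq₀ (norm_nonneg _) (norm_nonneg _)).1 h3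

theorem exists_contraction {S P : H →L[ℂ] H} (h : ∀ v, ‖S v‖ ≤ ‖P v‖) :
    ∃ C : H →L[ℂ] H, ‖C‖ ≤ 1 ∧ S = C ∘L P := by
  let K : Submodule ℂ H := (LinearMap.range P.toLinearMap).topologicalClosure
  have hmem : ∀ v, P v ∈ K := fun v => Submodule.le_topologicalClosure _ ⟨v, rfl⟩
  let e : H →ₗ[ℂ] K := P.toLinearMap.codRestrict K hmem
  have hd : DenseRange e := by
    intro x
    have hx : (x : H) ∈ closure (Set.range P) := by
      have h1 := x.2
      rw [← SetLike.mem_coe, Submodule.topologicalClosure_coe] at h1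
      have h2 : ((LinearMap.range P.toLinearMap : Submodule ℂ H) : Set H) = Set.range P := by
        ext y; simp
      rwa [h2] at h1
    rw [Topology.IsEmbedding.subtypeVal.closure_eq_preimage_closure_image, Set.mem_preimage]
    convert hx using 2
    ext y
    simp [e]
  have : CompleteSpace K := (Submodule.isClosed_topologicalClosure _).completeSpace_coe
  have hn : ∀ x, ‖S.toLinearMap x‖ ≤ 1 * ‖e x‖ := by
    intro x
    simpa [e] using h x
  refine ⟨(S.toLinearMap.extendOfNorm e) ∘L K.orthogonalProjectionOnto, ?_, ?_⟩
  · refine (ContinuousLinearMap.opNorm_comp_le _ _).trans ?_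
    have h1 := LinearMap.opNorm_extendOfNorm_le hd zero_le_one hn
    have h2 := K.orthogonalProjectionOnto_norm_le
    nlinarith [norm_nonneg (K.orthogonalProjectionOnto), norm_nonneg (S.toLinearMap.extendOfNorm e)]
  · ext v
    have h3 : K.orthogonalProjectionOnto (P v) = e v :=
      Submodule.orthogonalProjectionOnto_mem_subspace_eq_self (e v)
    have h4 := LinearMap.extendOfNorm_eq hd ⟨1, hn⟩ v
    simp only [ContinuousLinearMap.comp_apply, h3]
    exact h4.symm

theorem tsum_enorm_inner_sq {ι : Type*} (b : HilbertBasis ι ℂ H) (v : H) :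
    ∑' i, ‖⟪b i, v⟫_ℂ‖ₑ ^ 2 = ‖v‖ₑ ^ 2 := by
  have h := b.hasSum_inner_mul_inner v v
  have h1 : HasSum (fun i => ‖⟪b i, v⟫_ℂ‖ ^ 2) (‖v‖ ^ 2) := by
    have h2 := Complex.hasSum_re h
    rw [inner_self_eq_norm_sq_to_K] at h2
    convert h2 using 1
    · ext i
      rw [← inner_conj_symm v (b i), ← Complex.normSq_eq_conj_mul_self, Complex.ofReal_re,
        Complex.normSq_eq_norm_sq]
    · norm_cast
  have h3 := ENNReal.ofReal_tsum_of_nonneg (fun i => sq_nonneg ‖⟪b i, v⟫_ℂ‖) h1.summable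
  rw [h1.tsum_eq] at h3
  have h4 : ∀ {E : Type _} [NormedAddCommGroup E] (x : E), ENNReal.ofReal (‖x‖ ^ 2) = ‖x‖ₑ ^ 2 := by
    intro E _ x
    rw [ENNReal.ofReal_pow (norm_nonneg _), ofReal_norm]
  rw [← h4, h3]
  exact tsum_congr fun i => (by rw [ENNReal.ofReal_pow (norm_nonneg _), ofReal_norm])

theorem tsum_enorm_adjoint_sq {ι κ : Type*} (b : HilbertBasis ι ℂ H) (c : HilbertBasis κ ℂ H)
    (X : H →L[ℂ] H) : ∑' i, ‖X.adjoint (b i)‖ₑ ^ 2 = ∑' j, ‖X (c j)‖ₑ ^ 2 := by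
  simp_rw [← tsum_enorm_inner_sq b (X _), ← tsum_enorm_inner_sq c (X.adjoint _)]
  rw [ENNReal.tsum_comm]
  refine tsum_congr fun i => tsum_congr fun j => ?_
  rw [ContinuousLinearMap.adjoint_inner_right, ← inner_conj_symm]
  rw [← ofReal_norm, ← ofReal_norm, RCLike.norm_conj]

theorem ofReal_inner_eq_sqrt {P : H →L[ℂ] H} (hP : 0 ≤ P) (v : H) :
    ENNReal.ofReal (⟪v, P v⟫_ℂ).re = ‖CFC.sqrt P v‖ₑ ^ 2 := by
  have h1 : CFC.sqrt P * CFC.sqrt P = P := CFC.sqrt_mul_sqrt_self P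
  have h2 : (CFC.sqrt P).adjoint = CFC.sqrt P := by
    rw [← ContinuousLinearMap.star_eq_adjoint]; exact (CFC.sqrt_nonneg P).isSelfAdjoint
  conv_lhs => rw [← h1]
  rw [mul_apply_eq_comp, ← ContinuousLinearMap.adjoint_inner_left, h2,
    inner_self_eq_norm_sq_to_K]
  rw [← ofReal_norm, ← ENNReal.ofReal_pow (norm_nonneg _)]
  norm_cast

theorem posTrace_eq_sqrt {P : H →L[ℂ] H} (hP : 0 ≤ P) :
    posTrace P = ∑' i, ‖CFC.sqrt P (basis H i)‖ₑ ^ 2 :=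
  tsum_congr fun i => ofReal_inner_eq_sqrt hP (basis H i)

/-- The trace of a positive operator does not depend on the choice of the orthonormal basis. -/
theorem posTrace_eq_tsum {ι : Type*} (b : HilbertBasis ι ℂ H) {P : H →L[ℂ] H} (hP : 0 ≤ P) :
    posTrace P = ∑' i, ENNReal.ofReal (⟪b i, P (b i)⟫_ℂ).re := by
  have h2 : (CFC.sqrt P).adjoint = CFC.sqrt P := by
    rw [← ContinuousLinearMap.star_eq_adjoint]; exact (CFC.sqrt_nonneg P).isSelfAdjoint
  have h := tsum_enorm_adjoint_sq b (basis H) (CFC.sqrt P)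
  rw [h2] at h
  rw [posTrace_eq_sqrt hP, ← h]
  exact tsum_congr fun i => (ofReal_inner_eq_sqrt hP (b i)).symm

theorem tsum_enorm_inner_le {C P : H →L[ℂ] H} (hC : ‖C‖ ≤ 1) (hP : 0 ≤ P) :
    ∑' i, ‖⟪basis H i, (C ∘L P) (basis H i)⟫_ℂ‖ₑ ≤ posTrace P := by
  set Q := CFC.sqrt P with hQ
  have h1 : Q * Q = P := CFC.sqrt_mul_sqrt_self P
  have h2 : Q.adjoint = Q := by
    rw [← ContinuousLinearMap.star_eq_adjoint]; exact (CFC.sqrt_nonneg P).isSelfAdjoint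
  have hsum : ∑' i, ‖(C ∘L Q).adjoint (basis H i)‖ₑ ^ 2 ≤ posTrace P := by
    rw [tsum_enorm_adjoint_sq (basis H) (basis H), posTrace_eq_sqrt hP]
    refine ENNReal.tsum_le_tsum fun i => ?_
    gcongr
    rw [← ofReal_norm, ← ofReal_norm]
    refine ENNReal.ofReal_le_ofReal ?_
    refine (C.le_opNorm _).trans ?_
    exact mul_le_of_le_one_left (norm_nonneg _) hC
  have hterm : ∀ i, ‖⟪basis H i, (C ∘L P) (basis H i)⟫_ℂ‖ₑ ≤
      2⁻¹ * ‖(C ∘L Q).adjoint (basis H i)‖ₑ ^ 2 + 2⁻¹ * ‖Q (basis H i)‖ₑ ^ 2 := by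
    intro i
    have e1 : ⟪basis H i, (C ∘L P) (basis H i)⟫_ℂ =
        ⟪(C ∘L Q).adjoint (basis H i), Q (basis H i)⟫_ℂ := by
      rw [ContinuousLinearMap.adjoint_inner_left, ← h1]; rfl
    rw [e1]
    have e2 := norm_inner_le_norm (𝕜 := ℂ) ((C ∘L Q).adjoint (basis H i)) (Q (basis H i))
    have e3 : ‖⟪(C ∘L Q).adjoint (basis H i), Q (basis H i)⟫_ℂ‖ ≤
        2⁻¹ * ‖(C ∘L Q).adjoint (basis H i)‖ ^ 2 + 2⁻¹ * ‖Q (basis H i)‖ ^ 2 := by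
      nlinarith [sq_nonneg (‖(C ∘L Q).adjoint (basis H i)‖ - ‖Q (basis H i)‖)]
    have e4 := ENNReal.ofReal_le_ofReal e3
    rw [ENNReal.ofReal_add (by positivity) (by positivity),
      ENNReal.ofReal_mul (by positivity), ENNReal.ofReal_mul (by positivity),
      ENNReal.ofReal_pow (norm_nonneg _), ENNReal.ofReal_pow (norm_nonneg _)] at e4
    simpa only [ofReal_norm, ENNReal.ofReal_inv_of_pos two_pos, ENNReal.ofReal_ofNat]
      using e4
  refine (ENNReal.tsum_le_tsum hterm).trans ?_
  rw [ENNReal.tsum_add, ENNReal.tsum_mul_left, ENNReal.tsum_mul_left, ← posTrace_eq_sqrt hP]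
  refine (add_le_add_left (mul_le_mul_right hsum _) _).trans ?_
  rw [← add_mul, ENNReal.inv_two_add_inv_two, one_mul]

theorem traceNorm_add_le (S T : H →L[ℂ] H) :
    traceNorm (S + T) ≤ traceNorm S + traceNorm T := by
  obtain ⟨W, hW, hWe⟩ := exists_contraction (fun v => (norm_abs_apply (S + T) v).le)
  obtain ⟨V, hV, hVe⟩ := exists_contraction (fun v => (norm_abs_apply S v).ge)
  obtain ⟨U, hU, hUe⟩ := exists_contraction (fun v => (norm_abs_apply T v).ge)
  have hWV : ‖W ∘L V‖ ≤ 1 := (ContinuousLinearMap.opNorm_comp_le _ _).trans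
    (mul_le_one₀ hW (norm_nonneg _) hV)
  have hWU : ‖W ∘L U‖ ≤ 1 := (ContinuousLinearMap.opNorm_comp_le _ _).trans
    (mul_le_one₀ hW (norm_nonneg _) hU)
  have e : CFC.abs (S + T) = (W ∘L V) ∘L CFC.abs S + (W ∘L U) ∘L CFC.abs T := by
    rw [hWe, ContinuousLinearMap.comp_assoc, ContinuousLinearMap.comp_assoc, ← hVe, ← hUe,
      ContinuousLinearMap.comp_add]
  refine le_trans ?_ (add_le_add (tsum_enorm_inner_le hWV (CFC.abs_nonneg S))
    (tsum_enorm_inner_le hWU (CFC.abs_nonneg T)))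
  rw [← ENNReal.tsum_add]
  refine ENNReal.tsum_le_tsum fun i => ?_
  rw [e, add_apply, inner_add_right]
  refine le_trans ?_ (enorm_add_le _ _)
  rw [← ofReal_norm]
  exact ENNReal.ofReal_le_ofReal (Complex.re_le_norm _)

theorem traceNorm_smul (c : ℂ) (T : H →L[ℂ] H) :
    traceNorm (c • T) = ENNReal.ofReal ‖c‖ * traceNorm T := by
  unfold traceNorm posTrace
  rw [← ENNReal.tsum_mul_left]
  refine tsum_congr fun i => ?_
  rw [CFC.abs_smul, smul_apply, inner_smul_right_eq_smul, Complex.smul_re,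
    smul_eq_mul, ENNReal.ofReal_mul (norm_nonneg _)]

theorem traceNorm_zero : traceNorm (0 : H →L[ℂ] H) = 0 := by
  simp [traceNorm, posTrace]

variable (H) in
/-- The space `𝒯(H)` of trace-class operators on `H`. -/
def TraceClass : Submodule ℂ (H →L[ℂ] H) where
  carrier := {T | traceNorm T < ∞}
  add_mem' := fun hS hT => (traceNorm_add_le _ _).trans_lt (ENNReal.add_lt_top.2 ⟨hS, hT⟩)
  zero_mem' := by simp [traceNorm_zero]
  smul_mem' := fun c T hT => by
    change traceNorm (c • T) < ∞
    rw [traceNorm_smul]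
    exact ENNReal.mul_lt_top ENNReal.ofReal_lt_top hT

theorem mem_traceClass {T : H →L[ℂ] H} : T ∈ TraceClass H ↔ traceNorm T < ∞ := Iff.rfl

/-- The trace `Tr T = ∑ₙ ⟨n|T|n⟩ ∈ ℂ` of a trace-class operator. -/
def trace (T : TraceClass H) : ℂ := ∑' i, ⟪basis H i, T.1 (basis H i)⟫_ℂ

/-- The rank-one operator `|ψ⟩⟨ψ|`. -/
def ketbra (ψ : H) : H →L[ℂ] H := InnerProductSpace.rankOne ℂ ψ ψ

theorem ketbra_nonneg (ψ : H) : 0 ≤ ketbra ψ :=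
  (ContinuousLinearMap.nonneg_iff_isPositive _).2 (InnerProductSpace.isPositive_rankOne_self ψ)

theorem posTrace_ketbra (ψ : H) : posTrace (ketbra ψ) = ‖ψ‖ₑ ^ 2 := by
  rw [← tsum_enorm_inner_sq (basis H) ψ]
  refine tsum_congr fun i => ?_
  rw [← ofReal_norm, ← ENNReal.ofReal_pow (norm_nonneg _)]
  congr 1
  rw [ketbra, InnerProductSpace.rankOne_apply, inner_smul_right, ← inner_conj_symm ψ (basis H i),
    ← Complex.normSq_eq_conj_mul_self, Complex.ofReal_re, Complex.normSq_eq_norm_sq]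

theorem traceNorm_ketbra (ψ : H) : traceNorm (ketbra ψ) = ‖ψ‖ₑ ^ 2 := by
  rw [traceNorm, CFC.abs_of_nonneg _ (ketbra_nonneg ψ), posTrace_ketbra]

/-- The rank-one operator `|ψ⟩⟨ψ|` as an element of `𝒯(H)`. -/
def ketbraTC (ψ : H) : TraceClass H :=
  ⟨ketbra ψ, mem_traceClass.2 (by
    rw [traceNorm_ketbra]
    exact ENNReal.pow_lt_top enorm_lt_top)⟩

end TraceClass


section HilbertTensor

/-- The Hilbert space tensor product: the completion of the algebraic tensor product for the inner
product determined by `⟨a ⊗ b, a' ⊗ b'⟩ = ⟨a, a'⟩ ⟨b, b'⟩`. -/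
def HTensor (A B : Type*) [NormedAddCommGroup A] [InnerProductSpace ℂ A]
    [NormedAddCommGroup B] [InnerProductSpace ℂ B] : Type _ :=
  UniformSpace.Completion (A ⊗[ℂ] B)

section Instances

variable (A B : Type*) [NormedAddCommGroup A] [InnerProductSpace ℂ A]
  [NormedAddCommGroup B] [InnerProductSpace ℂ B]

instance : NormedAddCommGroup (HTensor A B) :=
  inferInstanceAs (NormedAddCommGroup (UniformSpace.Completion (A ⊗[ℂ] B)))

instance : InnerProductSpace ℂ (HTensor A B) :=
  inferInstanceAs (InnerProductSpace ℂ (UniformSpace.Completion (A ⊗[ℂ] B)))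

instance : CompleteSpace (HTensor A B) :=
  inferInstanceAs (CompleteSpace (UniformSpace.Completion (A ⊗[ℂ] B)))

/-- The isometric inclusion of the algebraic tensor product. -/
def toHTensor : A ⊗[ℂ] B →ₗᵢ[ℂ] HTensor A B :=
  (UniformSpace.Completion.toComplₗᵢ : A ⊗[ℂ] B →ₗᵢ[ℂ] UniformSpace.Completion (A ⊗[ℂ] B))

theorem denseRange_toHTensor : DenseRange (toHTensor A B) :=
  UniformSpace.Completion.denseRange_coe (α := A ⊗[ℂ] B)

instance [SeparableSpace A] [SeparableSpace B] : SeparableSpace (HTensor A B) := by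
  have h1 : IsSeparable (Set.range fun x : A × B => x.1 ⊗ₜ[ℂ] x.2) :=
    isSeparable_range TensorProduct.continuous_tmul
  have h2 : IsSeparable ((Submodule.span ℂ (Set.range fun x : A × B => x.1 ⊗ₜ[ℂ] x.2) :
      Submodule ℂ (A ⊗[ℂ] B)) : Set (A ⊗[ℂ] B)) := h1.span
  have h3 : Submodule.span ℂ (Set.range fun x : A × B => x.1 ⊗ₜ[ℂ] x.2) = ⊤ := by
    rw [← TensorProduct.span_tmul_eq_top ℂ A B]
    congr 1
    ext z
    simp
  rw [h3, Submodule.top_coe, isSeparable_univ_iff] at h2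
  exact (denseRange_toHTensor A B).separableSpace (toHTensor A B).continuous

end Instances

variable {A B C D : Type*}
  [NormedAddCommGroup A] [InnerProductSpace ℂ A] [NormedAddCommGroup B] [InnerProductSpace ℂ B]
  [NormedAddCommGroup C] [InnerProductSpace ℂ C] [NormedAddCommGroup D] [InnerProductSpace ℂ D]

/-- The product vector `a ⊗ b`. -/
def tmul (a : A) (b : B) : HTensor A B := toHTensor A B (a ⊗ₜ[ℂ] b)

theorem inner_tmul_tmul (a a' : A) (b b' : B) :
    ⟪tmul a b, tmul a' b'⟫_ℂ = ⟪a, a'⟫_ℂ * ⟪b, b'⟫_ℂ := by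
  rw [tmul, tmul, LinearIsometry.inner_map_map, TensorProduct.inner_tmul]

/-- The operator `S ⊗ T`, with `(S ⊗ T)(a ⊗ b) = S a ⊗ T b`. -/
def opTensor (S : A →L[ℂ] C) (T : B →L[ℂ] D) : HTensor A B →L[ℂ] HTensor C D :=
  (TensorProduct.mapL S T).completion

theorem opTensor_tmul (S : A →L[ℂ] C) (T : B →L[ℂ] D) (a : A) (b : B) :
    opTensor S T (tmul a b) = tmul (S a) (T b) :=
  ContinuousLinearMap.completion_apply_coe (TensorProduct.mapL S T) (a ⊗ₜ[ℂ] b)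

/-- The operator `a ↦ a ⊗ b`. -/
def tmulRight (b : B) : A →L[ℂ] HTensor A B :=
  (toHTensor A B).toContinuousLinearMap ∘L (TensorProduct.mkL ℂ A B).flip b

/-- The operator `b ↦ a ⊗ b`. -/
def tmulLeft (a : A) : B →L[ℂ] HTensor A B :=
  (toHTensor A B).toContinuousLinearMap ∘L TensorProduct.mkL ℂ A B a

theorem tmulRight_apply (a : A) (b : B) : tmulRight b a = tmul a b := rfl

theorem tmulLeft_apply (a : A) (b : B) : tmulLeft a b = tmul a b := rfl

theorem HTensor.ext {E : Type*} [NormedAddCommGroup E] [InnerProductSpace ℂ E]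
    {f g : HTensor A B →L[ℂ] E} (h : ∀ a b, f (tmul a b) = g (tmul a b)) : f = g := by
  have h1 : f.toLinearMap ∘ₗ (toHTensor A B).toLinearMap =
      g.toLinearMap ∘ₗ (toHTensor A B).toLinearMap := TensorProduct.ext' h
  refine ContinuousLinearMap.coeFn_injective ?_
  refine (denseRange_toHTensor A B).equalizer f.continuous g.continuous ?_
  ext z
  exact LinearMap.congr_fun h1 z

theorem HTensor.ext_inner {x y : HTensor A B}
    (h : ∀ a b, ⟪x, tmul a b⟫_ℂ = ⟪y, tmul a b⟫_ℂ) : x = y := by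
  have h1 : innerSL ℂ x = innerSL ℂ y := HTensor.ext fun a b => by simpa using h a b
  refine ext_inner_right ℂ fun v => ?_
  have h2 := congrArg (fun f : HTensor A B →L[ℂ] ℂ => f v) h1
  simpa using h2

theorem opTensor_comp_opTensor {A' B' : Type*} [NormedAddCommGroup A'] [InnerProductSpace ℂ A']
    [NormedAddCommGroup B'] [InnerProductSpace ℂ B'] (S' : C →L[ℂ] A') (T' : D →L[ℂ] B')
    (S : A →L[ℂ] C) (T : B →L[ℂ] D) :
    opTensor S' T' ∘L opTensor S T = opTensor (S' ∘L S) (T' ∘L T) :=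
  HTensor.ext fun a b => by simp [opTensor_tmul]

theorem adjoint_opTensor [CompleteSpace A] [CompleteSpace B] [CompleteSpace C] [CompleteSpace D]
    (S : A →L[ℂ] C) (T : B →L[ℂ] D) :
    (opTensor S T).adjoint = opTensor S.adjoint T.adjoint :=
  HTensor.ext fun c d => HTensor.ext_inner fun a b => by
    rw [ContinuousLinearMap.adjoint_inner_left, opTensor_tmul, opTensor_tmul, inner_tmul_tmul,
      inner_tmul_tmul, ContinuousLinearMap.adjoint_inner_left,
      ContinuousLinearMap.adjoint_inner_left]

section Product

variable [CompleteSpace A] [CompleteSpace B]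

theorem opTensor_nonneg {S : A →L[ℂ] A} {T : B →L[ℂ] B} (hS : 0 ≤ S) (hT : 0 ≤ T) :
    0 ≤ opTensor S T := by
  have e : opTensor S T =
      star (opTensor (CFC.sqrt S) (CFC.sqrt T)) * opTensor (CFC.sqrt S) (CFC.sqrt T) := by
    have h1 : (CFC.sqrt S).adjoint = CFC.sqrt S := by
      rw [← ContinuousLinearMap.star_eq_adjoint]; exact (CFC.sqrt_nonneg S).isSelfAdjoint
    have h2 : (CFC.sqrt T).adjoint = CFC.sqrt T := by
      rw [← ContinuousLinearMap.star_eq_adjoint]; exact (CFC.sqrt_nonneg T).isSelfAdjoint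
    have h3 : CFC.sqrt S ∘L CFC.sqrt S = S := CFC.sqrt_mul_sqrt_self S
    have h4 : CFC.sqrt T ∘L CFC.sqrt T = T := CFC.sqrt_mul_sqrt_self T
    rw [ContinuousLinearMap.star_eq_adjoint, adjoint_opTensor, h1, h2]
    change _ = opTensor (CFC.sqrt S) (CFC.sqrt T) ∘L opTensor (CFC.sqrt S) (CFC.sqrt T)
    rw [opTensor_comp_opTensor, h3, h4]
  rw [e]
  exact star_mul_self_nonneg _

theorem abs_opTensor (S : A →L[ℂ] A) (T : B →L[ℂ] B) :
    CFC.abs (opTensor S T) = opTensor (CFC.abs S) (CFC.abs T) := by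
  rw [CFC.abs]
  refine CFC.sqrt_unique ?_ (opTensor_nonneg (CFC.abs_nonneg S) (CFC.abs_nonneg T))
  have h1 : CFC.abs S ∘L CFC.abs S = S.adjoint ∘L S := CFC.abs_mul_abs S
  have h2 : CFC.abs T ∘L CFC.abs T = T.adjoint ∘L T := CFC.abs_mul_abs T
  change opTensor (CFC.abs S) (CFC.abs T) ∘L opTensor (CFC.abs S) (CFC.abs T) =
    (opTensor S T).adjoint ∘L opTensor S T
  rw [opTensor_comp_opTensor, adjoint_opTensor, opTensor_comp_opTensor, h1, h2]

/-- The product of two orthonormal bases. -/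
def productBasis {ι κ : Type*} (b : HilbertBasis ι ℂ A) (c : HilbertBasis κ ℂ B) :
    HilbertBasis (ι × κ) ℂ (HTensor A B) :=
  HilbertBasis.mkOfOrthogonalEqBot (v := fun x : ι × κ => tmul (b x.1) (c x.2))
    (by
      classical
      rw [orthonormal_iff_ite]
      rintro ⟨i, j⟩ ⟨i', j'⟩
      rw [inner_tmul_tmul, orthonormal_iff_ite.1 b.orthonormal, orthonormal_iff_ite.1 c.orthonormal]
      by_cases h1 : i = i' <;> by_cases h2 : j = j' <;> simp [h1, h2])
    (by
      rw [Submodule.eq_bot_iff]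
      intro x hx
      have hx1 : ∀ i j, ⟪x, tmul (b i) (c j)⟫_ℂ = 0 := fun i j =>
        (Submodule.mem_orthogonal' _ x).1 hx _ (Submodule.subset_span ⟨(i, j), rfl⟩)
      refine HTensor.ext_inner fun u v => ?_
      rw [inner_zero_left]
      have hb : ∀ j, innerSL ℂ x ∘L tmulRight (A := A) (c j) = 0 := by
        intro j
        refine ContinuousLinearMap.ext_on (s := Set.range b) ?_ ?_
        · have := b.dense_span
          rw [← SetLike.coe_set_eq, Submodule.topologicalClosure_coe, Submodule.top_coe] at this
          exact dense_iff_closure_eq.2 this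
        · rintro _ ⟨i, rfl⟩
          exact hx1 i j
      have hc : innerSL ℂ x ∘L tmulLeft (B := B) u = 0 := by
        refine ContinuousLinearMap.ext_on (s := Set.range c) ?_ ?_
        · have := c.dense_span
          rw [← SetLike.coe_set_eq, Submodule.topologicalClosure_coe, Submodule.top_coe] at this
          exact dense_iff_closure_eq.2 this
        · rintro _ ⟨j, rfl⟩
          exact congrArg (fun f : A →L[ℂ] ℂ => f u) (hb j)
      exact congrArg (fun f : B →L[ℂ] ℂ => f v) hc)

theorem productBasis_apply {ι κ : Type*} (b : HilbertBasis ι ℂ A) (c : HilbertBasis κ ℂ B)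
    (x : ι × κ) : productBasis b c x = tmul (b x.1) (c x.2) := by
  rw [productBasis, HilbertBasis.coe_mkOfOrthogonalEqBot]

theorem posTrace_opTensor {S : A →L[ℂ] A} {T : B →L[ℂ] B} (hS : 0 ≤ S) (hT : 0 ≤ T) :
    posTrace (opTensor S T) = posTrace S * posTrace T := by
  rw [posTrace_eq_tsum (productBasis (basis A) (basis B)) (opTensor_nonneg hS hT),
    ENNReal.tsum_prod', posTrace, posTrace, ← ENNReal.tsum_mul_right]
  refine tsum_congr fun i => ?_
  rw [← ENNReal.tsum_mul_left]
  refine tsum_congr fun j => ?_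
  have h1 := ((ContinuousLinearMap.nonneg_iff_isPositive S).1 hS).inner_nonneg_right (basis A i)
  have h2 := ((ContinuousLinearMap.nonneg_iff_isPositive T).1 hT).inner_nonneg_right (basis B j)
  rw [Complex.nonneg_iff] at h1 h2
  rw [productBasis_apply, opTensor_tmul, inner_tmul_tmul, ← ENNReal.ofReal_mul h1.1,
    Complex.mul_re, ← h1.2, zero_mul, sub_zero]

theorem traceNorm_opTensor (S : A →L[ℂ] A) (T : B →L[ℂ] B) :
    traceNorm (opTensor S T) = traceNorm S * traceNorm T :=
  (congrArg posTrace (abs_opTensor S T)).trans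
    (posTrace_opTensor (CFC.abs_nonneg S) (CFC.abs_nonneg T))

/-- The tensor product `S ⊗ T` of trace-class operators. -/
def tensorTC (S : TraceClass A) (T : TraceClass B) : TraceClass (HTensor A B) :=
  ⟨opTensor S.1 T.1, mem_traceClass.2 ((traceNorm_opTensor S.1 T.1).trans_lt
    (ENNReal.mul_lt_top (mem_traceClass.1 S.2) (mem_traceClass.1 T.2)))⟩

end Product

variable (A B C D) in
/-- The inclusion of the algebraic tensor product `(A ⊗ B) ⊗ (C ⊗ D)` in the Hilbert space tensor
product; it is isometric with dense range. -/
def inclusion₄ :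
    (A ⊗[ℂ] B) ⊗[ℂ] (C ⊗[ℂ] D) →ₗᵢ[ℂ] HTensor (HTensor A B) (HTensor C D) :=
  (toHTensor (HTensor A B) (HTensor C D)).comp
    (TensorProduct.mapIsometry (toHTensor A B) (toHTensor C D))

variable (A B C D) in
/-- The exchange of the two middle factors on algebraic tensor products,
`(a ⊗ b) ⊗ (c ⊗ d) ↦ (a ⊗ c) ⊗ (b ⊗ d)`. -/
def algShuffle : (A ⊗[ℂ] B) ⊗[ℂ] (C ⊗[ℂ] D) ≃ₗᵢ[ℂ] (A ⊗[ℂ] C) ⊗[ℂ] (B ⊗[ℂ] D) :=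
  (TensorProduct.assocIsometry ℂ A B (C ⊗[ℂ] D)).trans
    (((((TensorProduct.assocIsometry ℂ B C D).symm.trans
      ((TensorProduct.commIsometry ℂ B C).rTensor D)).trans
        (TensorProduct.assocIsometry ℂ C B D)).lTensor A).trans
          (TensorProduct.assocIsometry ℂ A C (B ⊗[ℂ] D)).symm)

variable (A B C D) in
/-- The unitary `(A ⊗ B) ⊗ (C ⊗ D) → (A ⊗ C) ⊗ (B ⊗ D)` that exchanges the two middle factors,
as the continuous extension of `algShuffle`. -/
def shuffle :
    HTensor (HTensor A B) (HTensor C D) →L[ℂ] HTensor (HTensor A C) (HTensor B D) :=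
  ((inclusion₄ A C B D).toLinearMap ∘ₗ
    (algShuffle A B C D).toLinearEquiv.toLinearMap).extendOfNorm (inclusion₄ A B C D).toLinearMap

theorem denseRange_mapIsometry {f : A →ₗᵢ[ℂ] C} {g : B →ₗᵢ[ℂ] D} (hf : DenseRange f)
    (hg : DenseRange g) : DenseRange (TensorProduct.mapIsometry f g) := by
  set h := TensorProduct.mapIsometry f g with hh
  have key : ∀ (x : C) (y : D),
      x ⊗ₜ[ℂ] y ∈ (LinearMap.range h.toLinearMap).topologicalClosure := by
    intro x y
    rw [← SetLike.mem_coe, Submodule.topologicalClosure_coe]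
    have hc : Continuous fun p : C × D => p.1 ⊗ₜ[ℂ] p.2 := TensorProduct.continuous_tmul
    refine (hf.prodMap hg).induction_on
      (p := fun p : C × D => p.1 ⊗ₜ[ℂ] p.2 ∈ closure (LinearMap.range h.toLinearMap : Set (C ⊗[ℂ] D)))
      (x, y) (isClosed_closure.preimage hc) ?_
    rintro ⟨a, b⟩
    exact subset_closure ⟨a ⊗ₜ[ℂ] b, by simp [hh]⟩
  intro z
  have hz : z ∈ (LinearMap.range h.toLinearMap).topologicalClosure := by
    induction z using TensorProduct.induction_on with
    | zero => exact Submodule.zero_mem _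
    | tmul x y => exact key x y
    | add x y hx hy => exact Submodule.add_mem _ hx hy
  rw [← SetLike.mem_coe, Submodule.topologicalClosure_coe] at hz
  have h2 : ((LinearMap.range h.toLinearMap : Submodule ℂ (C ⊗[ℂ] D)) : Set _) = Set.range h := by
    ext y; simp
  rwa [h2] at hz

theorem denseRange_inclusion₄ : DenseRange (inclusion₄ A B C D) :=
  (denseRange_toHTensor _ _).comp
    (denseRange_mapIsometry (denseRange_toHTensor A B) (denseRange_toHTensor C D))
    (toHTensor _ _).continuous

theorem shuffle_inclusion₄ (z : (A ⊗[ℂ] B) ⊗[ℂ] (C ⊗[ℂ] D)) :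
    shuffle A B C D (inclusion₄ A B C D z) = inclusion₄ A C B D (algShuffle A B C D z) := by
  refine LinearMap.extendOfNorm_eq denseRange_inclusion₄ ⟨1, fun x => ?_⟩ z
  rw [one_mul]
  change ‖inclusion₄ A C B D (algShuffle A B C D x)‖ ≤ ‖inclusion₄ A B C D x‖
  rw [LinearIsometry.norm_map, LinearIsometry.norm_map, LinearIsometryEquiv.norm_map]

theorem shuffle_tmul (a : A) (b : B) (c : C) (d : D) :
    shuffle A B C D (tmul (tmul a b) (tmul c d)) = tmul (tmul a c) (tmul b d) :=
  shuffle_inclusion₄ ((a ⊗ₜ[ℂ] b) ⊗ₜ[ℂ] (c ⊗ₜ[ℂ] d))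

variable [CompleteSpace A] [CompleteSpace B]

/-- The reduced operator `ρ_A = Tr_B ρ = ∑ⱼ (1 ⊗ ⟨j|) ρ (1 ⊗ |j⟩)`. The series converges in
operator norm for trace-class `ρ`. -/
def reducedLeft (ρ : HTensor A B →L[ℂ] HTensor A B) : A →L[ℂ] A :=
  ∑' j, (tmulRight (A := A) (basis B j)).adjoint ∘L ρ ∘L tmulRight (basis B j)

/-- The reduced operator `ρ_B = Tr_A ρ = ∑ᵢ (⟨i| ⊗ 1) ρ (|i⟩ ⊗ 1)`. The series converges in
operator norm for trace-class `ρ`. -/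
def reducedRight (ρ : HTensor A B →L[ℂ] HTensor A B) : B →L[ℂ] B :=
  ∑' i, (tmulLeft (B := B) (basis A i)).adjoint ∘L ρ ∘L tmulLeft (basis A i)

end HilbertTensor

section States

/-- Density operators: positive semidefinite operators of trace `1`. -/
structure IsState {H : Type*} [NormedAddCommGroup H] [InnerProductSpace ℂ H] [CompleteSpace H]
    (ρ : H →L[ℂ] H) : Prop where
  nonneg : 0 ≤ ρ
  posTrace_eq_one : posTrace ρ = 1

/-- The quantum entropy `S(ρ) = -Tr[ρ log₂ ρ] ∈ [0, ∞]`, with `0 log₂ 0 = 0`; the positive operator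
`-ρ log₂ ρ` is given by the continuous functional calculus. -/
def entropy {H : Type*} [NormedAddCommGroup H] [InnerProductSpace ℂ H] [CompleteSpace H]
    (ρ : H →L[ℂ] H) : ℝ≥0∞ :=
  posTrace (cfc (fun x : ℝ => -(x * Real.logb 2 x)) ρ)

variable {A B : Type*} [NormedAddCommGroup A] [InnerProductSpace ℂ A] [CompleteSpace A]
  [NormedAddCommGroup B] [InnerProductSpace ℂ B] [CompleteSpace B]

/-- `ρ = ∑ₓ p(x) |ψₓ⟩⟨ψₓ|` is a countable convex combination of pure states. -/
structure IsPureDecomposition (ρ : HTensor A B →L[ℂ] HTensor A B) (p : ℕ → ℝ≥0)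
    (ψ : ℕ → HTensor A B) : Prop where
  norm_eq_one : ∀ x, ‖ψ x‖ = 1
  hasSum_one : HasSum p 1
  hasSum : HasSum (fun x => ((p x : ℝ) : ℂ) • ketbra (ψ x)) ρ

/-- The entanglement of formation: the infimum of `∑ₓ p(x) S(ψₓ^A)` over all countable pure-state
decompositions `ρ = ∑ₓ p(x) ψₓ`. -/
def entanglementOfFormation (ρ : HTensor A B →L[ℂ] HTensor A B) : ℝ≥0∞ :=
  ⨅ (p : ℕ → ℝ≥0) (ψ : ℕ → HTensor A B) (_ : IsPureDecomposition ρ p ψ),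
    ∑' x, (p x : ℝ≥0∞) * entropy (reducedLeft (ketbra (ψ x)))

end States

section Systems

/-- Quantum systems: complex separable Hilbert spaces. -/
structure HilbertSpace where
  carrier : Type u
  [normedAddCommGroup : NormedAddCommGroup carrier]
  [innerProductSpace : InnerProductSpace ℂ carrier]
  [completeSpace : CompleteSpace carrier]
  [separableSpace : SeparableSpace carrier]

instance : CoeSort HilbertSpace.{u} (Type u) := ⟨HilbertSpace.carrier⟩

attribute [instance] HilbertSpace.normedAddCommGroup HilbertSpace.innerProductSpace
  HilbertSpace.completeSpace HilbertSpace.separableSpace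

/-- The `n`-fold tensor power of a system; the empty tensor power is one-dimensional. -/
def HilbertSpace.pow (A : HilbertSpace.{u}) : ℕ → HilbertSpace.{u}
  | 0 => ⟨EuclideanSpace ℂ PUnit.{u + 1}⟩
  | n + 1 => ⟨HTensor A (HilbertSpace.pow A n)⟩

/-- The vector `ψ^{⊗n}`, with tensor factors regrouped as a vector of `A^n ⊗ B^n`. -/
def vecPow {A B : HilbertSpace.{u}} (ψ : HTensor A B) : (n : ℕ) → HTensor (A.pow n) (B.pow n)
  | 0 => tmul (EuclideanSpace.single PUnit.unit 1 : EuclideanSpace ℂ PUnit.{u + 1})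
      (EuclideanSpace.single PUnit.unit 1 : EuclideanSpace ℂ PUnit.{u + 1})
  | n + 1 => shuffle A B (A.pow n) (B.pow n) (tmul ψ (vecPow ψ n))

/-- The operator `ρ^{⊗n}`, with tensor factors regrouped as an operator on `A^n ⊗ B^n`. -/
def opPow {A B : HilbertSpace.{u}} (ρ : HTensor A B →L[ℂ] HTensor A B) :
    (n : ℕ) → (HTensor (A.pow n) (B.pow n) →L[ℂ] HTensor (A.pow n) (B.pow n))
  | 0 => 1
  | n + 1 => shuffle A B (A.pow n) (B.pow n) ∘L opTensor ρ (opPow ρ n) ∘L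
      (shuffle A B (A.pow n) (B.pow n)).adjoint

/-- The regularized entanglement of formation `inf_{n ≥ 1} E_f(ρ^{⊗n}) / n`, with respect to the
bipartition `A^n : B^n`. -/
def regularizedEoF {A B : HilbertSpace.{u}} (ρ : HTensor A B →L[ℂ] HTensor A B) : ℝ≥0∞ :=
  ⨅ (n : ℕ) (_ : 1 ≤ n), entanglementOfFormation (opPow ρ n) / n

/-- A qubit. -/
def qubit : HilbertSpace.{u} := ⟨EuclideanSpace ℂ (ULift.{u} (Fin 2))⟩

/-- The computational basis vector `|i⟩`. -/
def ket (i : Fin 2) : qubit.{u} :=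
  (EuclideanSpace.single (ULift.up i) 1 : EuclideanSpace ℂ (ULift.{u} (Fin 2)))

/-- The ebit vector `(|0⟩ ⊗ |0⟩ + |1⟩ ⊗ |1⟩) / √2`. -/
def ebit : HTensor qubit.{u} qubit.{u} :=
  ((√2 : ℝ) : ℂ)⁻¹ • (tmul (ket 0) (ket 0) + tmul (ket 1) (ket 1))

end Systems

section Operations

/-- Linear maps `𝒯(H) → 𝒯(K)`. -/
abbrev SuperOp (H K : Type*) [NormedAddCommGroup H] [InnerProductSpace ℂ H] [CompleteSpace H]
    [NormedAddCommGroup K] [InnerProductSpace ℂ K] [CompleteSpace K] : Type _ :=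
  TraceClass H →ₗ[ℂ] TraceClass K

section General

variable {H K : Type*} [NormedAddCommGroup H] [InnerProductSpace ℂ H] [CompleteSpace H]
  [NormedAddCommGroup K] [InnerProductSpace ℂ K] [CompleteSpace K]

/-- Positive semidefiniteness of a `k × k` block matrix of operators on `H`, as an operator
on `ℂᵏ ⊗ H = H ⊕ ⋯ ⊕ H`. -/
def IsPositiveBlock {k : ℕ} (T : Fin k → Fin k → TraceClass H) : Prop :=
  ∀ v : Fin k → H, 0 ≤ ∑ i, ∑ j, ⟪v i, (T i j).1 (v j)⟫_ℂ

/-- Complete positivity: `I_k ⊗ E` is positive for all `k`. -/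
def IsCP (E : SuperOp H K) : Prop :=
  ∀ (k : ℕ) (T : Fin k → Fin k → TraceClass H),
    IsPositiveBlock T → IsPositiveBlock fun i j => E (T i j)

/-- Quantum channels: completely positive trace-preserving maps. -/
structure IsChannel (E : SuperOp H K) : Prop where
  cp : IsCP E
  tp : ∀ T, trace (E T) = trace T

/-- Strong convergence `Eₙ → E`: `‖Eₙ(T) - E(T)‖₁ → 0` for all trace-class `T`. -/
def StrongTendsto (Es : ℕ → SuperOp H K) (E : SuperOp H K) : Prop :=
  ∀ T, Tendsto (fun n => traceNorm ((Es n T).1 - (E T).1)) atTop (𝓝 0)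

/-- `E = ∑ᵢ Eᵢ`, in the sense of strong convergence. -/
def IsStrongSum {I : Type} (F : I → SuperOp H K) (E : SuperOp H K) : Prop :=
  ∀ T, Tendsto (fun s : Finset I => traceNorm (∑ i ∈ s, (F i T).1 - (E T).1)) atTop (𝓝 0)

/-- Instruments: countable families of completely positive maps that sum up to a channel. -/
structure IsInstrument {I : Type} (F : I → SuperOp H K) : Prop where
  countable : Countable I
  cp : ∀ i, IsCP (F i)
  exists_channel : ∃ E, IsChannel E ∧ IsStrongSum F E

/-- The instrument `F'` is obtained from `F` by binning the outcomes according to the partition of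
`I` into the fibres of a function `f : I → J`. -/
def IsCoarseGraining {I J : Type} (F : I → SuperOp H K) (F' : J → SuperOp H K) : Prop :=
  ∃ f : I → J, ∀ j, IsStrongSum (fun i : {i : I // f i = j} => F i) (F' j)

/-- The closure of a class of maps with respect to strong convergence. -/
def strongClosure (O : Set (SuperOp H K)) : Set (SuperOp H K) :=
  {E | ∃ Es : ℕ → SuperOp H K, (∀ n, Es n ∈ O) ∧ StrongTendsto Es E}

end General

/-- The two parties. -/
inductive Party
  | alice
  | bob

variable {A B M N A' B' : HilbertSpace.{u}}

/-- `E = F ⊗ G`. -/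
def IsTensorMap (F : SuperOp A A') (G : SuperOp B B') (E : SuperOp (HTensor A B) (HTensor A' B')) :
    Prop :=
  ∀ S T, E (tensorTC S T) = tensorTC (F S) (G T)

/-- One-way local instruments with respect to a party: that party applies an instrument and
communicates the outcome `i`, and the other party applies a channel depending on `i`. -/
def IsOneWayLocal {I : Type} (P : Party) (E : I → SuperOp (HTensor A B) (HTensor A' B')) : Prop :=
  IsInstrument E ∧ ∀ i, ∃ (F : SuperOp A A') (G : SuperOp B B'), IsTensorMap F G (E i) ∧
    match P with
    | .alice => IsCP F ∧ IsChannel G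
    | .bob => IsChannel F ∧ IsCP G

/-- Coarse-grainings of one-way local instruments with respect to a party. -/
def IsOneWayLOCC {J : Type} (P : Party) (E' : J → SuperOp (HTensor A B) (HTensor A' B')) : Prop :=
  Countable J ∧ ∃ (I : Type) (E : I → SuperOp (HTensor A B) (HTensor A' B')),
    IsOneWayLocal P E ∧ IsCoarseGraining E E'

/-- `E'` is LOCC-linked to `E`: after the outcome `i` of `E`, some party `nᵢ` applies a one-way local
instrument `F i`, and `E'` is a coarse-graining of the result. -/
def IsLinked {I J : Type} (E : I → SuperOp (HTensor A B) (HTensor M N))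
    (E' : J → SuperOp (HTensor A B) (HTensor A' B')) : Prop :=
  Countable J ∧ ∃ (K : I → Type) (F : ∀ i, K i → SuperOp (HTensor M N) (HTensor A' B')),
    (∀ i, ∃ P, IsOneWayLocal P (F i)) ∧
      IsCoarseGraining (fun x : Σ i, K i => F x.1 x.2 ∘ₗ E x.1) E'

/-- The instruments in `LOCC_{r+1}`. -/
def IsLOCCRounds : (r : ℕ) → {A B A' B' : HilbertSpace.{u}} → {J : Type} →
    (J → SuperOp (HTensor A B) (HTensor A' B')) → Prop
  | 0, _, _, _, _, _, E' => ∃ P, IsOneWayLOCC P E'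
  | r + 1, A, B, _, _, _, E' => ∃ (M N : HilbertSpace.{u}) (I : Type)
      (E : I → SuperOp (HTensor A B) (HTensor M N)), IsLOCCRounds r E ∧ IsLinked E E'

/-- The instruments in `LOCC_ℕ`: finitely many rounds. -/
def IsFiniteLOCC {J : Type} (E : J → SuperOp (HTensor A B) (HTensor A' B')) : Prop :=
  ∃ r, IsLOCCRounds r E

/-- LOCC channels: there are instruments `I₁, I₂, …` in `LOCC_ℕ`, each LOCC-linked to the previous
one, whose coarse-grainings to a single outcome converge strongly to the channel. -/
def IsLOCC (E : SuperOp (HTensor A B) (HTensor A' B')) : Prop :=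
  ∃ (I : ℕ → Type) (Is : ∀ ν, I ν → SuperOp (HTensor A B) (HTensor A' B'))
    (Es : ℕ → SuperOp (HTensor A B) (HTensor A' B')),
    (∀ ν, IsFiniteLOCC (Is ν)) ∧ (∀ ν, IsLinked (Is ν) (Is (ν + 1))) ∧
      (∀ ν, IsCoarseGraining (Is ν) fun _ : Unit => Es ν) ∧ StrongTendsto Es E

/-- Countably separable channels: channels with a Kraus representation
`E(T) = ∑_α (K_α ⊗ L_α) T (K_α ⊗ L_α)†`. -/
def IsCountablySeparable (E : SuperOp (HTensor A B) (HTensor A' B')) : Prop :=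
  IsChannel E ∧ ∃ (K : ℕ → A →L[ℂ] A') (L : ℕ → B →L[ℂ] B'),
    ∀ T : TraceClass (HTensor A B), Tendsto (fun s : Finset ℕ =>
      traceNorm (∑ α ∈ s, opTensor (K α) (L α) ∘L T.1 ∘L (opTensor (K α) (L α)).adjoint - (E T).1))
      atTop (𝓝 0)

/-- The classes of free operations. -/
inductive OperationClass
  | oneWayAliceToBob
  | oneWayBobToAlice
  | finiteLOCC
  | LOCC
  | closureLOCC
  | countablySeparable
  | separable

variable (A B A' B') in
/-- The channels from `A : B` to `A' : B'` in a given class; a channel belongs to a class of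
instruments if it does so as an instrument with a single outcome. -/
def OperationClass.channels :
    OperationClass → Set (SuperOp (HTensor A B) (HTensor A' B'))
  | .oneWayAliceToBob => {E | IsOneWayLOCC .alice fun _ : Unit => E}
  | .oneWayBobToAlice => {E | IsOneWayLOCC .bob fun _ : Unit => E}
  | .finiteLOCC => {E | IsFiniteLOCC fun _ : Unit => E}
  | .LOCC => {E | IsLOCC E}
  | .closureLOCC => strongClosure {E | IsFiniteLOCC fun _ : Unit => E}
  | .countablySeparable => {E | IsCountablySeparable E}
  | .separable => strongClosure {E | IsCountablySeparable E}

/-- `r` is an achievable rate for entanglement dilution to `ρ`: as `n → ∞`, operations in the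
class transform `⌊rn⌋` ebits into `ρ^{⊗n}` up to an error, in trace distance, that tends to `0`. -/
def IsAchievableRate (O : OperationClass) (ρ : HTensor A B →L[ℂ] HTensor A B) (r : ℝ) : Prop :=
  Tendsto (fun n : ℕ =>
    ⨅ E ∈ O.channels (qubit.{u}.pow ⌊r * n⌋₊) (qubit.{u}.pow ⌊r * n⌋₊) (A.pow n) (B.pow n),
      2⁻¹ * traceNorm ((E (ketbraTC (vecPow ebit ⌊r * n⌋₊))).1 - opPow ρ n)) atTop (𝓝 0)

/-- The entanglement cost of `ρ`: the infimum of the achievable rates `r > 0`, and `∞` if there are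
none. -/
def entanglementCost (O : OperationClass) (ρ : HTensor A B →L[ℂ] HTensor A B) : ℝ≥0∞ :=
  ⨅ (r : ℝ) (_ : 0 < r) (_ : IsAchievableRate O ρ r), ENNReal.ofReal r

end Operations

end EntanglementCost

end

open EntanglementCost

/-!
The limit exists because the entanglement of formation is subadditive: tensor products of
pure-state decompositions are decompositions of the tensor product, and entropies of product
vectors add up. The powers `ρ^{⊗(a + b)}` and `ρ^{⊗a} ⊗ ρ^{⊗b}` agree up to local unitaries
(`opPow_add`), so Fekete's lemma applies (`tendsto_regularizedEoF`) as soon as `E_f(ρ)`, and hence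
all the values, are finite. This is the case, since by concavity of the entropy every
decomposition of `ρ` has average entropy at most `S(ρ_A)` and at most `S(ρ_B)`
(`entanglementOfFormation_le_min`), where for `S(ρ_B)` one uses that the two reduced states of a
pure state have the same entropy.

The bookkeeping device is a *Schmidt ensemble* (`SchmidtEnsemble`): a decomposition `(p(x), ψₓ)`
of the state with a Schmidt basis of each `ψₓ`. It carries the joint distribution `p(x) λₓ(j)` of
the label and the Schmidt index, and its mean entropy is the expectation of the information
content `-log₂ λₓ(j)`; the entanglement of formation is the infimum of the mean entropies.

For the cost, let `r` be larger than `E_f(ρ^{⊗m}) / m` for some `m`, and choose an ensemble of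
`ρ^{⊗m}` with mean entropy below `r m`. In the product ensemble of many blocks the information
content is a sum of independent terms, and the weak law of large numbers says that it is at most
`⌊r n⌋` except on a set of small weight (`eventually_exists_typical`). As only the mean, not the
variance, of the information content is known to be finite, the law is proved by splitting off a
nonnegative part of small mean (`HasInfoBound`).

Hence, for most labels `x`, the vector `ψₓ` is close to the normalized truncation `φₓ` of its
Schmidt decomposition to the squared coefficients that are at least `2 ^ (-⌊r n⌋)`, of which there
are at most `2 ^ ⌊r n⌋` (`exists_isSchmidtForm`). A finite mixture of the `ketbra φₓ` then
approximates `ρ^{⊗n}` in trace norm (`traceNorm_mixture_sub_le`), and it can be prepared exactly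
from `⌊r n⌋` ebits (`exists_dilution`). The protocol of Lo and Popescu does this with one message,
in either direction: if `e_m` is a basis of the space of the ebits, indexed by a finite abelian
group, then the operators `M_j |e_m⟩ = c(m + j) |a(m + j)⟩` and `V_j |e_m⟩ = |b(m + j)⟩` map
`∑ₘ e_m ⊗ e_m` to `∑ₖ c(k) a(k) ⊗ b(k)`, and the `M_j` are the Kraus operators of an instrument. The
resulting channel has finitely many product Kraus operators, so that a single construction serves
for all the classes of operations (`krausMap_mem_channels`).
-/

set_option linter.unusedSectionVars false

noncomputable section
namespace EntanglementCost

/-! ### Trace norm and positive trace-class operators -/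

section TraceClassLemmas

variable {H K : Type*} [NormedAddCommGroup H] [InnerProductSpace ℂ H] [CompleteSpace H]
  [NormedAddCommGroup K] [InnerProductSpace ℂ K] [CompleteSpace K]

theorem adjoint_of_nonneg {P : H →L[ℂ] H} (hP : 0 ≤ P) : P.adjoint = P := by
  rw [← ContinuousLinearMap.star_eq_adjoint]; exact hP.isSelfAdjoint

theorem re_inner_nonneg {P : H →L[ℂ] H} (hP : 0 ≤ P) (v : H) : 0 ≤ (⟪v, P v⟫_ℂ).re :=
  (Complex.nonneg_iff.1
    (((ContinuousLinearMap.nonneg_iff_isPositive P).1 hP).inner_nonneg_right v)).1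

theorem posTrace_add {S T : H →L[ℂ] H} (hS : 0 ≤ S) (hT : 0 ≤ T) :
    posTrace (S + T) = posTrace S + posTrace T := by
  unfold posTrace
  rw [← ENNReal.tsum_add]
  refine tsum_congr fun i => ?_
  rw [add_apply, inner_add_right, Complex.add_re,
    ENNReal.ofReal_add (re_inner_nonneg hS _) (re_inner_nonneg hT _)]

theorem posTrace_sum {ι : Type*} (s : Finset ι) (T : ι → H →L[ℂ] H) (hT : ∀ i, 0 ≤ T i) :
    posTrace (∑ i ∈ s, T i) = ∑ i ∈ s, posTrace (T i) := by
  classical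
  induction s using Finset.induction_on with
  | empty => simp [posTrace]
  | insert i s hi ih =>
    rw [Finset.sum_insert hi, Finset.sum_insert hi,
      posTrace_add (hT i) (Finset.sum_nonneg fun j _ => hT j), ih]

theorem posTrace_smul {c : ℝ} (hc : 0 ≤ c) (T : H →L[ℂ] H) :
    posTrace ((c : ℂ) • T) = ENNReal.ofReal c * posTrace T := by
  unfold posTrace
  rw [← ENNReal.tsum_mul_left]
  refine tsum_congr fun i => ?_
  rw [smul_apply, inner_smul_right, Complex.re_ofReal_mul, ENNReal.ofReal_mul hc]

theorem traceNorm_of_nonneg {P : H →L[ℂ] H} (hP : 0 ≤ P) : traceNorm P = posTrace P := by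
  rw [traceNorm, CFC.abs_of_nonneg _ hP]

theorem traceNorm_neg (T : H →L[ℂ] H) : traceNorm (-T) = traceNorm T := by
  have := traceNorm_smul (-1) T
  simpa using this

theorem traceNorm_sum_le {ι : Type*} (s : Finset ι) (T : ι → H →L[ℂ] H) :
    traceNorm (∑ i ∈ s, T i) ≤ ∑ i ∈ s, traceNorm (T i) := by
  classical
  induction s using Finset.induction_on with
  | empty => simp [traceNorm_zero]
  | insert i s hi ih =>
    rw [Finset.sum_insert hi, Finset.sum_insert hi]
    exact (traceNorm_add_le _ _).trans (by gcongr)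

theorem enorm_sq_eq_ofReal {E : Type*} [NormedAddCommGroup E] (x : E) :
    ‖x‖ₑ ^ 2 = ENNReal.ofReal (‖x‖ ^ 2) := by
  rw [ENNReal.ofReal_pow (norm_nonneg _), ofReal_norm]

theorem enorm_inner_comm (x y : H) : ‖⟪x, y⟫_ℂ‖ₑ = ‖⟪y, x⟫_ℂ‖ₑ := by
  rw [← ofReal_norm, ← ofReal_norm, norm_inner_symm]

/-- The Hilbert–Schmidt norm of an operator and of its adjoint agree. -/
theorem tsum_enorm_adjoint_sq' {ι κ : Type*} (b : HilbertBasis ι ℂ K) (c : HilbertBasis κ ℂ H)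
    (X : H →L[ℂ] K) : ∑' i, ‖X.adjoint (b i)‖ₑ ^ 2 = ∑' j, ‖X (c j)‖ₑ ^ 2 := by
  simp_rw [← tsum_enorm_inner_sq b (X _), ← tsum_enorm_inner_sq c (X.adjoint _)]
  rw [ENNReal.tsum_comm]
  refine tsum_congr fun i => tsum_congr fun j => ?_
  rw [ContinuousLinearMap.adjoint_inner_right, enorm_inner_comm]

theorem enorm_apply_le (X : H →L[ℂ] K) (v : H) : ‖X v‖ₑ ≤ ‖X‖ₑ * ‖v‖ₑ := by
  rw [← ofReal_norm, ← ofReal_norm, ← ofReal_norm, ← ENNReal.ofReal_mul (norm_nonneg _)]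
  exact ENNReal.ofReal_le_ofReal (X.le_opNorm v)

theorem enorm_inner_le (x y : H) : ‖⟪x, y⟫_ℂ‖ₑ ≤ ‖x‖ₑ * ‖y‖ₑ := by
  rw [← ofReal_norm, ← ofReal_norm, ← ofReal_norm, ← ENNReal.ofReal_mul (norm_nonneg _)]
  exact ENNReal.ofReal_le_ofReal (norm_inner_le_norm x y)

/-- With `P = √P √P`, the diagonal of `X P Y` is a pairing of the two Hilbert–Schmidt operators
`X √P` and `√P Y`, to which the Cauchy–Schwarz inequality applies. -/
theorem tsum_enorm_inner_comp_le {P : H →L[ℂ] H} (hP : 0 ≤ P) (X : H →L[ℂ] K) (Y : K →L[ℂ] H) :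
    ∑' i, ‖⟪basis K i, X (P (Y (basis K i)))⟫_ℂ‖ₑ ≤
      2⁻¹ * (‖X‖ₑ ^ 2 * posTrace P) + 2⁻¹ * (‖Y‖ₑ ^ 2 * posTrace P) := by
  set Q := CFC.sqrt P with hQ
  have h1 : Q * Q = P := CFC.sqrt_mul_sqrt_self P
  have h2 : Q.adjoint = Q := adjoint_of_nonneg (CFC.sqrt_nonneg P)
  have hsum : ∀ Z : H →L[ℂ] K, ∑' i, ‖(Z ∘L Q).adjoint (basis K i)‖ₑ ^ 2 ≤
      ‖Z‖ₑ ^ 2 * posTrace P := by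
    intro Z
    rw [tsum_enorm_adjoint_sq' (basis K) (basis H), posTrace_eq_sqrt hP, ← ENNReal.tsum_mul_left]
    refine ENNReal.tsum_le_tsum fun i => ?_
    rw [← mul_pow]
    gcongr
    exact enorm_apply_le Z _
  have hY : ‖Y.adjoint‖ₑ = ‖Y‖ₑ := by
    rw [← ofReal_norm, ← ofReal_norm, LinearIsometryEquiv.norm_map]
  have hterm : ∀ i, ‖⟪basis K i, X (P (Y (basis K i)))⟫_ℂ‖ₑ ≤
      2⁻¹ * ‖(X ∘L Q).adjoint (basis K i)‖ₑ ^ 2 +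
        2⁻¹ * ‖(Y.adjoint ∘L Q).adjoint (basis K i)‖ₑ ^ 2 := by
    intro i
    have e1 : ⟪basis K i, X (P (Y (basis K i)))⟫_ℂ =
        ⟪(X ∘L Q).adjoint (basis K i), (Y.adjoint ∘L Q).adjoint (basis K i)⟫_ℂ := by
      rw [ContinuousLinearMap.adjoint_inner_left, ContinuousLinearMap.adjoint_comp, h2,
        ContinuousLinearMap.adjoint_adjoint, ← h1]
      rfl
    rw [e1]
    set x := (X ∘L Q).adjoint (basis K i)
    set y := (Y.adjoint ∘L Q).adjoint (basis K i)
    have e2 := norm_inner_le_norm (𝕜 := ℂ) x y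
    have e3 : ‖⟪x, y⟫_ℂ‖ ≤ 2⁻¹ * ‖x‖ ^ 2 + 2⁻¹ * ‖y‖ ^ 2 := by
      nlinarith [sq_nonneg (‖x‖ - ‖y‖)]
    have e4 := ENNReal.ofReal_le_ofReal e3
    rw [ENNReal.ofReal_add (by positivity) (by positivity),
      ENNReal.ofReal_mul (by positivity), ENNReal.ofReal_mul (by positivity),
      ENNReal.ofReal_pow (norm_nonneg _), ENNReal.ofReal_pow (norm_nonneg _)] at e4
    simpa only [ofReal_norm, ENNReal.ofReal_inv_of_pos two_pos, ENNReal.ofReal_ofNat]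
      using e4
  refine (ENNReal.tsum_le_tsum hterm).trans ?_
  rw [ENNReal.tsum_add, ENNReal.tsum_mul_left, ENNReal.tsum_mul_left]
  have := hsum Y.adjoint
  rw [hY] at this
  gcongr
  exact hsum X

/-- The trace class is stable under conjugation by bounded operators. -/
theorem traceNorm_conj_lt_top (X : H →L[ℂ] K) {T : H →L[ℂ] H} (hT : traceNorm T < ∞) :
    traceNorm (X ∘L T ∘L X.adjoint) < ∞ := by
  obtain ⟨W, -, hWe⟩ := exists_contraction
    (fun v => (norm_abs_apply (X ∘L T ∘L X.adjoint) v).le)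
  obtain ⟨V, -, hVe⟩ := exists_contraction (fun v => (norm_abs_apply T v).ge)
  -- polar decompositions of `X T X†` and of `T`
  have e : CFC.abs (X ∘L T ∘L X.adjoint) = (W ∘L X ∘L V) ∘L CFC.abs T ∘L X.adjoint := by
    rw [hWe]
    conv_lhs => rw [hVe]
    rfl
  have h := tsum_enorm_inner_comp_le (CFC.abs_nonneg T) (W ∘L X ∘L V) X.adjoint
  refine lt_of_le_of_lt (le_trans ?_ h) ?_
  · refine ENNReal.tsum_le_tsum fun i => ?_
    rw [e, ← ofReal_norm]
    exact ENNReal.ofReal_le_ofReal (Complex.re_le_norm _)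
  · have h1 : posTrace (CFC.abs T) < ∞ := hT
    have h2 : ∀ Z : H →L[ℂ] K, ‖Z‖ₑ ^ 2 * posTrace (CFC.abs T) < ∞ := fun Z =>
      ENNReal.mul_lt_top (ENNReal.pow_lt_top enorm_lt_top) h1
    have h3 : ∀ Z : K →L[ℂ] H, ‖Z‖ₑ ^ 2 * posTrace (CFC.abs T) < ∞ := fun Z =>
      ENNReal.mul_lt_top (ENNReal.pow_lt_top enorm_lt_top) h1
    exact ENNReal.add_lt_top.2 ⟨ENNReal.mul_lt_top (by simp) (h2 _),
      ENNReal.mul_lt_top (by simp) (h3 _)⟩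

theorem traceNorm_rankOne_le (x y : H) :
    traceNorm (InnerProductSpace.rankOne ℂ x y) ≤ ENNReal.ofReal (‖x‖ * ‖y‖) := by
  set T : H →L[ℂ] H := InnerProductSpace.rankOne ℂ x y with hT
  obtain ⟨W, hW, hWe⟩ := exists_contraction (fun v => (norm_abs_apply T v).le)
  have h1 : ∀ i, ⟪basis H i, CFC.abs T (basis H i)⟫_ℂ =
      ⟪y, basis H i⟫_ℂ * ⟪basis H i, W x⟫_ℂ := by
    intro i
    rw [hWe, hT]
    simp [InnerProductSpace.rankOne_apply]
  have h2 := Complex.hasSum_re ((basis H).hasSum_inner_mul_inner y (W x))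
  simp_rw [← h1] at h2
  have h3 := ENNReal.ofReal_tsum_of_nonneg
    (fun i => re_inner_nonneg (CFC.abs_nonneg T) (basis H i)) h2.summable
  rw [h2.tsum_eq] at h3
  rw [traceNorm, posTrace, ← h3]
  refine ENNReal.ofReal_le_ofReal ?_
  refine (Complex.re_le_norm _).trans ((norm_inner_le_norm _ _).trans ?_)
  have h4 : ‖W x‖ ≤ ‖x‖ := (W.le_opNorm x).trans (mul_le_of_le_one_left (norm_nonneg _) hW)
  nlinarith [norm_nonneg y]

theorem ketbra_apply (ψ v : H) : ketbra ψ v = ⟪ψ, v⟫_ℂ • ψ := by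
  rw [ketbra, InnerProductSpace.rankOne_apply]

theorem traceNorm_ketbra_sub_le {x y : H} (hx : ‖x‖ ≤ 1) (hy : ‖y‖ ≤ 1) :
    traceNorm (ketbra x - ketbra y) ≤ ENNReal.ofReal (2 * ‖x - y‖) := by
  have e : ketbra x - ketbra y = InnerProductSpace.rankOne ℂ (x - y) x +
      InnerProductSpace.rankOne ℂ y (x - y) := by
    ext v
    simp [ketbra_apply]
  rw [e]
  refine (traceNorm_add_le _ _).trans ((add_le_add (traceNorm_rankOne_le _ _)
    (traceNorm_rankOne_le _ _)).trans ?_)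
  rw [← ENNReal.ofReal_add (by positivity) (by positivity)]
  refine ENNReal.ofReal_le_ofReal ?_
  nlinarith [norm_nonneg (x - y)]

theorem norm_ketbra (ψ : H) : ‖ketbra ψ‖ = ‖ψ‖ ^ 2 := by
  rw [ketbra, InnerProductSpace.norm_rankOne, sq]

theorem inner_ketbra (ψ v : H) : ⟪v, ketbra ψ v⟫_ℂ = ((‖⟪ψ, v⟫_ℂ‖ ^ 2 : ℝ) : ℂ) := by
  rw [ketbra_apply, inner_smul_right, ← inner_conj_symm v ψ, RCLike.mul_conj]
  norm_cast

theorem ketbra_smul (c : ℂ) (ψ : H) : ketbra (c • ψ) = ((‖c‖ ^ 2 : ℝ) : ℂ) • ketbra ψ := by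
  ext v
  rw [smul_apply, ketbra_apply, ketbra_apply, inner_smul_left, smul_smul, smul_smul]
  congr 1
  have : (starRingEnd ℂ) c * c = ((‖c‖ ^ 2 : ℝ) : ℂ) := by
    rw [RCLike.conj_mul]; norm_cast
  rw [← this]
  ring

theorem comp_ketbra_adjoint (X : H →L[ℂ] K) (ψ : H) :
    X ∘L ketbra ψ ∘L X.adjoint = ketbra (X ψ) := by
  ext v
  simp [ketbra_apply, ContinuousLinearMap.adjoint_inner_right]

/-- A positive trace-class operator is the norm-convergent sum of the rank-one operators
`|√P eᵢ⟩⟨√P eᵢ|`. -/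
theorem hasSum_ketbra_sqrt {ι : Type*} (b : HilbertBasis ι ℂ H) {P : H →L[ℂ] H} (hP : 0 ≤ P)
    (hfin : posTrace P < ∞) : HasSum (fun i => ketbra (CFC.sqrt P (b i))) P := by
  set Q := CFC.sqrt P with hQ
  have h1 : Q * Q = P := CFC.sqrt_mul_sqrt_self P
  have h2 : Q.adjoint = Q := adjoint_of_nonneg (CFC.sqrt_nonneg P)
  have hs : Summable fun i => ketbra (Q (b i)) := by
    refine Summable.of_norm ?_
    simp_rw [norm_ketbra]
    rw [posTrace_eq_tsum b hP] at hfin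
    simp_rw [ofReal_inner_eq_sqrt hP, ← hQ, enorm_sq_eq_ofReal] at hfin
    have := ENNReal.summable_toReal hfin.ne
    refine this.congr fun i => ?_
    rw [ENNReal.toReal_ofReal (by positivity)]
  obtain ⟨R, hR⟩ := hs
  have : R = P := by
    ext v
    refine ext_inner_left ℂ fun w => ?_
    have h3 : HasSum (fun i => ⟪w, ketbra (Q (b i)) v⟫_ℂ) ⟪w, R v⟫_ℂ :=
      ((hR.mapL (ContinuousLinearMap.apply ℂ H v)).mapL (innerSL ℂ w))
    have h4 := b.hasSum_inner_mul_inner (Q w) (Q v)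
    refine h3.unique ?_
    have e : ⟪w, P v⟫_ℂ = ⟪Q w, Q v⟫_ℂ := by
      rw [← h1, ← ContinuousLinearMap.adjoint_inner_right, h2]; rfl
    rw [e]
    have e2 : (fun i => ⟪w, ketbra (Q (b i)) v⟫_ℂ) = fun i => ⟪Q w, b i⟫_ℂ * ⟪b i, Q v⟫_ℂ := by
      funext i
      rw [ketbra_apply, inner_smul_right, mul_comm, ← ContinuousLinearMap.adjoint_inner_right Q w,
        ← ContinuousLinearMap.adjoint_inner_left Q v, h2]
    rw [e2]
    exact h4
  rwa [this] at hR

/-- As a norm limit of operators of finite rank, a positive trace-class operator is compact. -/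
theorem isCompactOperator_of_posTrace_lt_top {P : H →L[ℂ] H} (hP : 0 ≤ P)
    (hfin : posTrace P < ∞) : IsCompactOperator P := by
  have h := hasSum_ketbra_sqrt (basis H) hP hfin
  refine isCompactOperator_of_tendsto (l := atTop) h (Eventually.of_forall fun s => ?_)
  refine Submodule.sum_mem (compactOperator (RingHom.id ℂ) H H) fun i _ => ?_
  set ψ := CFC.sqrt P (basis H i)
  have h1 : IsCompactOperator (innerSL ℂ ψ) :=
    isCompactOperator_of_locallyCompactSpace_dom (innerSL ℂ ψ)
  have h2 := h1.clm_comp (ContinuousLinearMap.toSpanSingleton ℂ ψ)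
  have h3 : ⇑(ketbra ψ) = ⇑(ContinuousLinearMap.toSpanSingleton ℂ ψ) ∘ ⇑(innerSL ℂ ψ) := by
    ext v
    simp [ketbra_apply]
  change IsCompactOperator (ketbra ψ)
  rw [h3]
  exact h2

/-- A positive trace-class operator is diagonalizable: it has an orthonormal basis of
eigenvectors. -/
theorem exists_eigenbasis {H : Type u} [NormedAddCommGroup H] [InnerProductSpace ℂ H]
    [CompleteSpace H] {P : H →L[ℂ] H} (hP : 0 ≤ P) (hfin : posTrace P < ∞) :
    ∃ (ι : Type u) (b : HilbertBasis ι ℂ H), ∀ i, ∃ μ : ℂ, P (b i) = μ • b i := by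
  have hsymm : P.IsSymmetric := ((ContinuousLinearMap.nonneg_iff_isPositive P).1 hP).isSymmetric
  have hbot := ContinuousLinearMap.orthogonalComplement_iSup_eigenspaces_eq_bot
    (isCompactOperator_of_posTrace_lt_top hP hfin) hsymm
  have hclosed : ∀ μ : ℂ, IsClosed (Module.End.eigenspace (P : Module.End ℂ H) μ : Set H) := by
    intro μ
    have : (Module.End.eigenspace (P : Module.End ℂ H) μ : Set H) = {v | P v = μ • v} := by
      ext v; simp
    rw [this]
    exact isClosed_eq P.continuous (continuous_const_smul μ)
  have hc : ∀ μ : ℂ, CompleteSpace (Module.End.eigenspace (P : Module.End ℂ H) μ) := fun μ =>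
    (hclosed μ).completeSpace_coe
  choose w b hb using fun μ : ℂ =>
    exists_hilbertBasis ℂ (Module.End.eigenspace (P : Module.End ℂ H) μ)
  have hon : Orthonormal ℂ fun a : Σ μ : ℂ, w μ => ((b a.1 a.2 : Module.End.eigenspace
      (P : Module.End ℂ H) a.1) : H) :=
    hsymm.orthogonalFamily_eigenspaces.orthonormal_sigma_orthonormal fun μ => (b μ).orthonormal
  refine ⟨Σ μ : ℂ, w μ, HilbertBasis.mkOfOrthogonalEqBot hon ?_, fun a => ⟨a.1, ?_⟩⟩
  · rw [Submodule.eq_bot_iff]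
    intro x hx
    have hx0 : x ∈ (⨆ μ, Module.End.eigenspace (P : Module.End ℂ H) μ)ᗮ := by
      rw [← Submodule.iInf_orthogonal, Submodule.mem_iInf]
      intro μ
      rw [Submodule.mem_orthogonal']
      intro v hv
      have h1 : (innerSL ℂ x ∘L (Module.End.eigenspace (P : Module.End ℂ H) μ).subtypeL) = 0 := by
        refine ContinuousLinearMap.ext_on (s := Set.range (b μ)) ?_ ?_
        · have := (b μ).dense_span
          rw [← SetLike.coe_set_eq, Submodule.topologicalClosure_coe, Submodule.top_coe] at this
          exact dense_iff_closure_eq.2 this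
        · rintro _ ⟨i, rfl⟩
          exact (Submodule.mem_orthogonal' _ x).1 hx _ (Submodule.subset_span ⟨⟨μ, i⟩, rfl⟩)
      exact congrArg (fun f : _ →L[ℂ] ℂ => f ⟨v, hv⟩) h1
    rw [hbot] at hx0
    exact (Submodule.mem_bot ℂ).1 hx0
  · rw [HilbertBasis.coe_mkOfOrthogonalEqBot]
    exact Module.End.mem_eigenspace_iff.1 (b a.1 a.2).2

/-- Balls of radius `1 / 2` around the basis vectors are disjoint, as these are `√2` apart. -/
theorem HilbertBasis.countable {ι : Type*} [SeparableSpace H] (b : HilbertBasis ι ℂ H) :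
    Countable ι := by
  have hd : ∀ i j, i ≠ j → 1 < dist (b i) (b j) := by
    intro i j hij
    have h1 : ‖b i - b j‖ ^ 2 = 2 := by
      rw [@norm_sub_sq ℂ, b.orthonormal.2 hij, b.orthonormal.1, b.orthonormal.1]
      norm_num
    rw [dist_eq_norm]
    nlinarith [norm_nonneg (b i - b j)]
  refine Set.countable_univ_iff.1 (Set.PairwiseDisjoint.countable_of_isOpen
    (s := fun i => Metric.ball (b i) (1 / 2)) (a := Set.univ) ?_ (fun _ _ => Metric.isOpen_ball)
      fun i _ => ⟨b i, Metric.mem_ball_self (by norm_num)⟩)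
  intro i _ j _ hij
  exact Metric.ball_disjoint_ball (by linarith [hd i j hij])

end TraceClassLemmas

/-! ### Entropy in an orthonormal basis -/

section Entropy

variable {H K : Type*} [NormedAddCommGroup H] [InnerProductSpace ℂ H] [CompleteSpace H]
  [NormedAddCommGroup K] [InnerProductSpace ℂ K] [CompleteSpace K]

/-- The function `η(x) = -x log₂ x`. -/
def eta (x : ℝ) : ℝ := -(x * Real.logb 2 x)

theorem eta_eq (x : ℝ) : eta x = Real.negMulLog x / Real.log 2 := by
  rw [eta, Real.negMulLog, Real.logb]; ring

theorem continuous_eta : Continuous eta := by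
  have : eta = fun x => Real.negMulLog x / Real.log 2 := funext eta_eq
  rw [this]
  exact Real.continuous_negMulLog.div_const _

theorem eta_nonneg {x : ℝ} (h0 : 0 ≤ x) (h1 : x ≤ 1) : 0 ≤ eta x := by
  rw [eta_eq]
  exact div_nonneg (Real.negMulLog_nonneg h0 h1) (Real.log_nonneg (by norm_num))

theorem eta_zero : eta 0 = 0 := by simp [eta]

/-- The concave function `η` lies below its tangent at `t`. -/
theorem eta_le_tangent {x t : ℝ} (hx : 0 ≤ x) (ht : 0 < t) :
    eta x ≤ x * (-Real.logb 2 t) + (t - x) / Real.log 2 := by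
  have h2 : 0 < Real.log 2 := Real.log_pos (by norm_num)
  rcases hx.eq_or_lt with rfl | hx
  · rw [eta_zero]; simp; positivity
  have h := Real.log_le_sub_one_of_pos (div_pos ht hx)
  rw [Real.log_div ht.ne' hx.ne'] at h
  rw [eta, Real.logb, Real.logb]
  have h3 : x * (Real.log t - Real.log x) ≤ t - x := by
    have := mul_le_mul_of_nonneg_left h hx.le
    have e : x * (t / x - 1) = t - x := by field_simp
    linarith
  have h4 : -(x * (Real.log x / Real.log 2)) - x * -(Real.log t / Real.log 2) =
      x * (Real.log t - Real.log x) / Real.log 2 := by ring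
  have h5 : x * (Real.log t - Real.log x) / Real.log 2 ≤ (t - x) / Real.log 2 := by gcongr
  linarith

theorem entropy_eq (ρ : H →L[ℂ] H) : entropy ρ = posTrace (cfc eta ρ) := rfl

/-- The operator norm of `√P` is at most its Hilbert–Schmidt norm, whose square is the trace
of `P`. -/
theorem enorm_sqrt_apply_sq_le {P : H →L[ℂ] H} (hP : 0 ≤ P) (v : H) :
    ‖CFC.sqrt P v‖ₑ ^ 2 ≤ posTrace P * ‖v‖ₑ ^ 2 := by
  have h2 := adjoint_of_nonneg (CFC.sqrt_nonneg P)
  rw [← tsum_enorm_inner_sq (basis H), posTrace_eq_sqrt hP, ← ENNReal.tsum_mul_right]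
  refine ENNReal.tsum_le_tsum fun i => ?_
  rw [← ContinuousLinearMap.adjoint_inner_left, h2, ← mul_pow]
  gcongr
  exact enorm_inner_le _ _

theorem norm_le_posTrace {P : H →L[ℂ] H} (hP : 0 ≤ P) (hfin : posTrace P < ∞) :
    ‖P‖ ≤ (posTrace P).toReal := by
  have h1 : ∀ v, ‖CFC.sqrt P v‖ ^ 2 ≤ (posTrace P).toReal * ‖v‖ ^ 2 := by
    intro v
    have := enorm_sqrt_apply_sq_le hP v
    rw [enorm_sq_eq_ofReal, enorm_sq_eq_ofReal, ← ENNReal.ofReal_toReal hfin.ne,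
      ← ENNReal.ofReal_mul ENNReal.toReal_nonneg] at this
    exact (ENNReal.ofReal_le_ofReal_iff (by positivity)).1 this
  have h2 : ‖CFC.sqrt P‖ ≤ √(posTrace P).toReal := by
    refine ContinuousLinearMap.opNorm_le_bound _ (Real.sqrt_nonneg _) fun v => ?_
    refine abs_le_of_sq_le_sq' ?_ (by positivity) |>.2
    rw [mul_pow, Real.sq_sqrt ENNReal.toReal_nonneg]
    exact h1 v
  calc ‖P‖ = ‖CFC.sqrt P * CFC.sqrt P‖ := by rw [CFC.sqrt_mul_sqrt_self P]
    _ ≤ ‖CFC.sqrt P‖ * ‖CFC.sqrt P‖ := norm_mul_le _ _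
    _ ≤ √(posTrace P).toReal * √(posTrace P).toReal := by gcongr
    _ = _ := Real.mul_self_sqrt ENNReal.toReal_nonneg

theorem cfc_eta_nonneg {P : H →L[ℂ] H} (hP : 0 ≤ P) (h1 : ‖P‖ ≤ 1) : 0 ≤ cfc eta P := by
  refine cfc_nonneg fun x hx => ?_
  have : ‖x‖ ≤ ‖P‖ * ‖(1 : H →L[ℂ] H)‖ := spectrum.norm_le_norm_mul_of_mem hx
  have h2 : ‖(1 : H →L[ℂ] H)‖ ≤ 1 := ContinuousLinearMap.norm_id_le
  exact eta_nonneg (spectrum_nonneg_of_nonneg hP hx)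
    ((le_abs_self x).trans (this.trans (mul_le_one₀ h1 (norm_nonneg _) h2)))

/-- Jensen's inequality for `η` and the spectral measure of `P` in a unit vector. -/
theorem re_inner_cfc_eta_le {P : H →L[ℂ] H} (hP : 0 ≤ P) {v : H} (hv : ‖v‖ = 1) :
    (⟪v, cfc eta P v⟫_ℂ).re ≤ eta (⟪v, P v⟫_ℂ).re := by
  set q := (⟪v, P v⟫_ℂ).re with hq
  -- `cfc` is monotone, so the tangent line of `η` at `t` bounds the operator `η(P)`
  have key : ∀ t : ℝ, 0 < t →
      (⟪v, cfc eta P v⟫_ℂ).re ≤ q * (-Real.logb 2 t) + (t - q) / Real.log 2 := by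
    intro t ht
    have h1 : cfc eta P ≤ cfc (fun x : ℝ => (-Real.logb 2 t - (Real.log 2)⁻¹) * x +
        t / Real.log 2) P := by
      refine cfc_mono (fun x hx => ?_) continuous_eta.continuousOn (by fun_prop)
      have := eta_le_tangent (spectrum_nonneg_of_nonneg hP hx) ht
      refine this.trans (le_of_eq ?_)
      ring
    have hsa : IsSelfAdjoint P := hP.isSelfAdjoint
    have h2 : cfc (fun x : ℝ => (-Real.logb 2 t - (Real.log 2)⁻¹) * x +
        t / Real.log 2) P = (-Real.logb 2 t - (Real.log 2)⁻¹) • P +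
          algebraMap ℝ (H →L[ℂ] H) (t / Real.log 2) := by
      rw [cfc_add_const _ _ _ (by fun_prop), cfc_const_mul _ _ _ (by fun_prop), cfc_id' ℝ P]
    rw [h2] at h1
    have h3 := re_inner_nonneg (sub_nonneg.2 h1) v
    have hvv : ⟪v, v⟫_ℂ = 1 := by rw [inner_self_eq_norm_sq_to_K, hv]; simp
    rw [Algebra.algebraMap_eq_smul_one] at h3
    simp only [sub_apply, add_apply, smul_apply, one_apply_eq_self, inner_sub_right,
      inner_add_right, inner_smul_right_eq_smul, hvv, Complex.sub_re, Complex.add_re,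
      Complex.smul_re, smul_eq_mul, ← hq, Complex.one_re] at h3
    have e : q * (-Real.logb 2 t) + (t - q) / Real.log 2 =
      (-Real.logb 2 t - (Real.log 2)⁻¹) * q + t / Real.log 2 * 1 := by ring
    linarith
  have hq0 : 0 ≤ q := re_inner_nonneg hP v
  rcases hq0.eq_or_lt with h0 | h0
  -- there is no tangent at `0`: let `t` tend to `0` instead
  · rw [← h0, eta_zero]
    rw [← h0] at key
    have h2 : 0 < Real.log 2 := Real.log_pos (by norm_num)
    refine le_of_forall_pos_le_add fun ε hε => ?_
    have := key (ε * Real.log 2) (by positivity)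
    simpa [h2.ne'] using this
  · have := key q h0
    simpa [eta] using this

/-- The continuous functional calculus acts on eigenvectors through the eigenvalue. -/
theorem cfc_apply_eigenvector {P : H →L[ℂ] H} (hP : IsSelfAdjoint P) {f : ℝ → ℝ}
    (hf : Continuous f) {μ : ℝ} {v : H} (hv : P v = (μ : ℂ) • v) :
    cfc f P v = ((f μ : ℝ) : ℂ) • v := by
  rcases eq_or_ne v 0 with rfl | hv0
  · simp
  have hμ : μ ∈ spectrum ℝ P := by
    rw [spectrum.mem_iff]
    intro hu
    obtain ⟨w, hw⟩ := hu.exists_left_inv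
    refine hv0 ?_
    have h1 := congrArg (fun X : H →L[ℂ] H => X v) hw
    simp only [mul_apply_eq_comp, sub_apply, hv, Algebra.algebraMap_eq_smul_one, smul_apply,
      one_apply_eq_self] at h1
    rw [← h1]
    simp
  rw [cfc_apply f P hP hf.continuousOn]
  have key : ∀ g : C(spectrum ℝ P, ℝ), cfcHom hP g v = ((g ⟨μ, hμ⟩ : ℝ) : ℂ) • v := by
    intro g
    -- Stone–Weierstrass: the claim is closed under algebra operations and uniform limits
    induction g using ContinuousMap.induction_on_of_compact with
    | const r =>
      have : ContinuousMap.const (spectrum ℝ P) r = algebraMap ℝ _ r := rfl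
      rw [this, AlgHomClass.commutes, Algebra.algebraMap_eq_smul_one]
      simp
    | id =>
      rw [cfcHom_id hP, hv]; simp
    | star_id =>
      rw [star_trivial, cfcHom_id hP, hv]; simp
    | add f g hf hg =>
      rw [map_add, add_apply, hf, hg, ← add_smul]; simp
    | mul f g hf hg =>
      rw [map_mul, mul_apply_eq_comp, hg, map_smul, hf, smul_smul, ContinuousMap.mul_apply]
      congr 1
      push_cast
      ring
    | frequently f h =>
      have hc : IsClosed {g : C(spectrum ℝ P, ℝ) | cfcHom hP g v = ((g ⟨μ, hμ⟩ : ℝ) : ℂ) • v} := by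
        refine isClosed_eq ?_ ?_
        · exact (ContinuousLinearMap.apply ℂ H v).continuous.comp (cfcHom_continuous hP)
        · exact (Complex.continuous_ofReal.comp (continuous_eval_const _)).smul
            continuous_const
      have := mem_closure_iff_frequently.2 h
      exact hc.closure_subset this
  rw [key]
  rfl

/-- Eigenvalues of positive operators are real. -/
theorem eigenvalue_eq_inner {P : H →L[ℂ] H} (hP : 0 ≤ P) {v : H} (hv : ‖v‖ = 1) {μ : ℂ}
    (h : P v = μ • v) : μ = ((⟪v, P v⟫_ℂ).re : ℂ) := by
  have hvv : ⟪v, v⟫_ℂ = 1 := by rw [inner_self_eq_norm_sq_to_K, hv]; simp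
  have h1 : ⟪v, P v⟫_ℂ = μ := by rw [h, inner_smul_right, hvv, mul_one]
  have h2 := (Complex.nonneg_iff.1
    (((ContinuousLinearMap.nonneg_iff_isPositive P).1 hP).inner_nonneg_right v)).2
  rw [h1] at h2 ⊢
  exact Complex.ext (by simp) (by simp [← h2])

/-- The entropy is at most the Shannon entropy of the diagonal in any orthonormal basis. -/
theorem entropy_le_tsum {ι : Type*} (b : HilbertBasis ι ℂ H) {P : H →L[ℂ] H} (hP : 0 ≤ P)
    (h1 : ‖P‖ ≤ 1) : entropy P ≤ ∑' i, ENNReal.ofReal (eta (⟪b i, P (b i)⟫_ℂ).re) := by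
  rw [entropy_eq, posTrace_eq_tsum b (cfc_eta_nonneg hP h1)]
  exact ENNReal.tsum_le_tsum fun i =>
    ENNReal.ofReal_le_ofReal (re_inner_cfc_eta_le hP (b.orthonormal.1 i))

/-- In an eigenbasis the entropy is the Shannon entropy of the diagonal. -/
theorem entropy_eq_tsum {ι : Type*} (b : HilbertBasis ι ℂ H) {P : H →L[ℂ] H} (hP : 0 ≤ P)
    (h1 : ‖P‖ ≤ 1) (hb : ∀ i, ∃ μ : ℂ, P (b i) = μ • b i) :
    entropy P = ∑' i, ENNReal.ofReal (eta (⟪b i, P (b i)⟫_ℂ).re) := by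
  rw [entropy_eq, posTrace_eq_tsum b (cfc_eta_nonneg hP h1)]
  refine tsum_congr fun i => ?_
  obtain ⟨μ, hμ⟩ := hb i
  have hμ' := eigenvalue_eq_inner hP (b.orthonormal.1 i) hμ
  have h2 : P (b i) = (((⟪b i, P (b i)⟫_ℂ).re : ℝ) : ℂ) • b i := by rw [← hμ']; exact hμ
  rw [cfc_apply_eigenvector hP.isSelfAdjoint continuous_eta h2, inner_smul_right,
    inner_self_eq_norm_sq_to_K, b.orthonormal.1]
  simp

end Entropy

/-! ### Reduced states and Schmidt decompositions -/

section Reduced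

variable {A B : Type*} [NormedAddCommGroup A] [InnerProductSpace ℂ A] [CompleteSpace A]
  [NormedAddCommGroup B] [InnerProductSpace ℂ B] [CompleteSpace B]

theorem hasSum_of_eq {ι α : Type*} [AddCommMonoid α] [TopologicalSpace α] {f g : ι → α} {a : α}
    (h : HasSum f a) (e : ∀ x, f x = g x) : HasSum g a :=
  (funext e : f = g) ▸ h

/-- The vector `(⟨a| ⊗ 1) ψ` of `B`. -/
def coef (a : A) (ψ : HTensor A B) : B := (tmulLeft (B := B) a).adjoint ψ

theorem inner_coef (a : A) (b : B) (ψ : HTensor A B) : ⟪b, coef a ψ⟫_ℂ = ⟪tmul a b, ψ⟫_ℂ := by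
  rw [coef, ContinuousLinearMap.adjoint_inner_right, tmulLeft_apply]

theorem conj_nonneg {ρ : HTensor A B →L[ℂ] HTensor A B} (hρ : 0 ≤ ρ) (X : A →L[ℂ] HTensor A B) :
    0 ≤ X.adjoint ∘L ρ ∘L X :=
  (ContinuousLinearMap.nonneg_iff_isPositive _).2
    (((ContinuousLinearMap.nonneg_iff_isPositive _).1 hρ).adjoint_conj X)

theorem posTrace_tmulRight (ρ : HTensor A B →L[ℂ] HTensor A B) (b : B) :
    posTrace ((tmulRight (A := A) b).adjoint ∘L ρ ∘L tmulRight b) =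
      ∑' i, ENNReal.ofReal (⟪tmul (basis A i) b, ρ (tmul (basis A i) b)⟫_ℂ).re := by
  refine tsum_congr fun i => ?_
  simp only [ContinuousLinearMap.comp_apply]
  rw [ContinuousLinearMap.adjoint_inner_right, tmulRight_apply]

/-- The series that defines the reduced operator of a positive trace-class operator converges. -/
theorem hasSum_reducedLeft {ρ : HTensor A B →L[ℂ] HTensor A B} (hρ : 0 ≤ ρ)
    (hfin : posTrace ρ < ∞) :
    HasSum (fun j => (tmulRight (A := A) (basis B j)).adjoint ∘L ρ ∘L tmulRight (basis B j))
      (reducedLeft ρ) := by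
  refine Summable.hasSum ?_
  have h1 : ∑' j, posTrace ((tmulRight (A := A) (basis B j)).adjoint ∘L ρ ∘L
      tmulRight (basis B j)) < ∞ := by
    rw [posTrace_eq_tsum (productBasis (basis A) (basis B)) hρ, ENNReal.tsum_prod',
      ENNReal.tsum_comm] at hfin
    convert hfin using 3 with j
    rw [posTrace_tmulRight]
    simp_rw [productBasis_apply]
  refine Summable.of_norm_bounded (ENNReal.summable_toReal h1.ne) fun j => ?_
  exact norm_le_posTrace (conj_nonneg hρ _) (ENNReal.ne_top_of_tsum_ne_top h1.ne j).lt_top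

theorem reducedLeft_nonneg {ρ : HTensor A B →L[ℂ] HTensor A B} (hρ : 0 ≤ ρ)
    (hfin : posTrace ρ < ∞) : 0 ≤ reducedLeft ρ :=
  (hasSum_reducedLeft hρ hfin).nonneg fun _ => conj_nonneg hρ _

theorem hasSum_inner_reducedLeft {ρ : HTensor A B →L[ℂ] HTensor A B} (hρ : 0 ≤ ρ)
    (hfin : posTrace ρ < ∞) (a a' : A) :
    HasSum (fun j => ⟪tmul a (basis B j), ρ (tmul a' (basis B j))⟫_ℂ) ⟪a, reducedLeft ρ a'⟫_ℂ := by
  have h := ((hasSum_reducedLeft hρ hfin).mapL (ContinuousLinearMap.apply ℂ A a')).mapL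
    (innerSL ℂ a)
  refine hasSum_of_eq h fun j => ?_
  change ⟪a, (tmulRight (A := A) (basis B j)).adjoint (ρ (tmulRight (basis B j) a'))⟫_ℂ = _
  rw [ContinuousLinearMap.adjoint_inner_right]
  rfl

theorem ofReal_inner_reducedLeft {ρ : HTensor A B →L[ℂ] HTensor A B} (hρ : 0 ≤ ρ)
    (hfin : posTrace ρ < ∞) (a : A) :
    ENNReal.ofReal (⟪a, reducedLeft ρ a⟫_ℂ).re =
      ∑' j, ENNReal.ofReal (⟪tmul a (basis B j), ρ (tmul a (basis B j))⟫_ℂ).re := by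
  have h := Complex.hasSum_re (hasSum_inner_reducedLeft hρ hfin a a)
  rw [← ENNReal.ofReal_tsum_of_nonneg (fun j => re_inner_nonneg hρ _) h.summable, h.tsum_eq]

theorem posTrace_reducedLeft {ρ : HTensor A B →L[ℂ] HTensor A B} (hρ : 0 ≤ ρ)
    (hfin : posTrace ρ < ∞) : posTrace (reducedLeft ρ) = posTrace ρ := by
  rw [posTrace_eq_tsum (productBasis (basis A) (basis B)) hρ, ENNReal.tsum_prod', posTrace]
  refine tsum_congr fun i => ?_
  rw [ofReal_inner_reducedLeft hρ hfin]
  simp_rw [productBasis_apply]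

theorem isState_reducedLeft {ρ : HTensor A B →L[ℂ] HTensor A B} (hρ : IsState ρ) :
    IsState (reducedLeft ρ) := by
  have hfin : posTrace ρ < ∞ := by rw [hρ.posTrace_eq_one]; simp
  exact ⟨reducedLeft_nonneg hρ.nonneg hfin,
    (posTrace_reducedLeft hρ.nonneg hfin).trans hρ.posTrace_eq_one⟩

theorem IsState.norm_le_one {H : Type*} [NormedAddCommGroup H] [InnerProductSpace ℂ H]
    [CompleteSpace H] {ρ : H →L[ℂ] H} (hρ : IsState ρ) : ‖ρ‖ ≤ 1 := by
  have := norm_le_posTrace hρ.nonneg (by rw [hρ.posTrace_eq_one]; simp)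
  simpa [hρ.posTrace_eq_one] using this

theorem isState_ketbra {H : Type*} [NormedAddCommGroup H] [InnerProductSpace ℂ H]
    [CompleteSpace H] {ψ : H} (h : ‖ψ‖ = 1) : IsState (ketbra ψ) :=
  ⟨ketbra_nonneg ψ, by rw [posTrace_ketbra, enorm_sq_eq_ofReal, h]; simp⟩

/-- The matrix elements of the reduced operator of a pure state. -/
theorem inner_reducedLeft_ketbra (ψ : HTensor A B) (a a' : A) :
    ⟪a, reducedLeft (ketbra ψ) a'⟫_ℂ = ⟪coef a' ψ, coef a ψ⟫_ℂ := by
  have hfin : posTrace (ketbra ψ) < ∞ := by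
    rw [posTrace_ketbra]; exact ENNReal.pow_lt_top enorm_lt_top
  refine (hasSum_inner_reducedLeft (ketbra_nonneg ψ) hfin a a').unique ?_
  have h := (basis B).hasSum_inner_mul_inner (coef a' ψ) (coef a ψ)
  refine (hasSum_of_eq h fun j => ?_)
  rw [ketbra_apply, inner_smul_right, inner_coef, ← inner_conj_symm (coef a' ψ), inner_coef,
    inner_conj_symm]

theorem re_inner_reducedLeft_ketbra (ψ : HTensor A B) (a : A) :
    (⟪a, reducedLeft (ketbra ψ) a⟫_ℂ).re = ‖coef a ψ‖ ^ 2 := by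
  rw [inner_reducedLeft_ketbra, inner_self_eq_norm_sq_to_K]
  norm_cast

/-- The squared norms of the components of `ψ` along a basis of `A` add up to that of `ψ`. -/
theorem tsum_enorm_coef_sq {ι : Type*} (b : HilbertBasis ι ℂ A) (ψ : HTensor A B) :
    ∑' i, ‖coef (b i) ψ‖ₑ ^ 2 = ‖ψ‖ₑ ^ 2 := by
  rw [← tsum_enorm_inner_sq (productBasis b (basis B)) ψ, ENNReal.tsum_prod']
  refine tsum_congr fun i => ?_
  rw [← tsum_enorm_inner_sq (basis B)]
  simp_rw [productBasis_apply, inner_coef]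

/-- In a basis that need not be a Schmidt basis, the Shannon entropy of the squared norms of the
components is an upper bound for the entropy of the reduced state. -/
theorem entropy_ketbra_le_tsum {ι : Type*} (b : HilbertBasis ι ℂ A) {ψ : HTensor A B}
    (hψ : ‖ψ‖ = 1) : entropy (reducedLeft (ketbra ψ)) ≤
      ∑' i, ENNReal.ofReal (eta (‖coef (b i) ψ‖ ^ 2)) := by
  have h := isState_reducedLeft (isState_ketbra hψ)
  refine (entropy_le_tsum b h.nonneg h.norm_le_one).trans_eq ?_
  simp_rw [re_inner_reducedLeft_ketbra]

/-- Schmidt decomposition: there is an orthonormal basis `(aᵢ)` of `A` such that the components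
`(⟨aᵢ| ⊗ 1) ψ` are pairwise orthogonal, and the entropy of the reduced state is the Shannon entropy
of their squared norms. -/
theorem exists_schmidt_basis {A : Type u} [NormedAddCommGroup A] [InnerProductSpace ℂ A]
    [CompleteSpace A] {ψ : HTensor A B} (hψ : ‖ψ‖ = 1) :
    ∃ (ι : Type u) (b : HilbertBasis ι ℂ A),
      (Pairwise fun i j => ⟪coef (b i) ψ, coef (b j) ψ⟫_ℂ = 0) ∧
      entropy (reducedLeft (ketbra ψ)) = ∑' i, ENNReal.ofReal (eta (‖coef (b i) ψ‖ ^ 2)) := by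
  have h := isState_reducedLeft (isState_ketbra hψ)
  obtain ⟨ι, b, hb⟩ := exists_eigenbasis h.nonneg (by rw [h.posTrace_eq_one]; simp)
  refine ⟨ι, b, fun i j hij => ?_, ?_⟩
  · obtain ⟨μ, hμ⟩ := hb i
    rw [← inner_reducedLeft_ketbra, hμ, inner_smul_right, b.orthonormal.2 hij.symm, mul_zero]
  · rw [entropy_eq_tsum b h.nonneg h.norm_le_one hb]
    simp_rw [re_inner_reducedLeft_ketbra]

/-- Concavity of the entropy: the average entropy of the reduced states in a decomposition of `ρ`
into pure states is at most the entropy of the reduced state of `ρ`. -/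
theorem tsum_entropy_le_entropy_reducedLeft {ι : Type*} {ρ : HTensor A B →L[ℂ] HTensor A B}
    (hρ : IsState ρ) {p : ι → ℝ≥0} {ψ : ι → HTensor A B} (hψ : ∀ x, ‖ψ x‖ = 1)
    (hsum : HasSum (fun x => ((p x : ℝ) : ℂ) • ketbra (ψ x)) ρ) :
    ∑' x, (p x : ℝ≥0∞) * entropy (reducedLeft (ketbra (ψ x))) ≤ entropy (reducedLeft ρ) := by
  have hfin : posTrace ρ < ∞ := by rw [hρ.posTrace_eq_one]; simp
  have h := isState_reducedLeft hρ
  obtain ⟨κ, b, hb⟩ := exists_eigenbasis h.nonneg (by rw [h.posTrace_eq_one]; simp)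
  rw [entropy_eq_tsum b h.nonneg h.norm_le_one hb]
  have hdiag : ∀ v, ENNReal.ofReal (⟪v, ρ v⟫_ℂ).re = ∑' x, (p x : ℝ≥0∞) * ‖⟪ψ x, v⟫_ℂ‖ₑ ^ 2 := by
    intro v
    have h1 := Complex.hasSum_re ((hsum.mapL (ContinuousLinearMap.apply ℂ _ v)).mapL (innerSL ℂ v))
    have h2 : ∀ x, (innerSL ℂ v ((ContinuousLinearMap.apply ℂ _ v)
        (((p x : ℝ) : ℂ) • ketbra (ψ x)))).re = (p x : ℝ) * ‖⟪ψ x, v⟫_ℂ‖ ^ 2 := by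
      intro x
      have : innerSL ℂ v ((ContinuousLinearMap.apply ℂ _ v) (((p x : ℝ) : ℂ) • ketbra (ψ x))) =
        ((p x : ℝ) : ℂ) * ⟪v, ketbra (ψ x) v⟫_ℂ := by
        rw [← inner_smul_right]; rfl
      rw [this, inner_ketbra, Complex.re_ofReal_mul, Complex.ofReal_re]
    simp_rw [h2] at h1
    have h3 := ENNReal.ofReal_tsum_of_nonneg (fun x => by positivity) h1.summable
    rw [h1.tsum_eq] at h3
    refine h3.trans (tsum_congr fun x => ?_)
    rw [ENNReal.ofReal_mul (by positivity), ← enorm_sq_eq_ofReal, ENNReal.ofReal_coe_nnreal]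
  have hmix : ∀ a : A, ENNReal.ofReal (⟪a, reducedLeft ρ a⟫_ℂ).re =
      ∑' x, (p x : ℝ≥0∞) * ‖coef a (ψ x)‖ₑ ^ 2 := by
    intro a
    rw [ofReal_inner_reducedLeft hρ.nonneg hfin]
    simp_rw [hdiag]
    rw [ENNReal.tsum_comm]
    refine tsum_congr fun x => ?_
    rw [ENNReal.tsum_mul_left, ← tsum_enorm_inner_sq (basis B)]
    congr 1
    refine tsum_congr fun j => ?_
    rw [inner_coef, enorm_inner_comm]
  calc ∑' x, (p x : ℝ≥0∞) * entropy (reducedLeft (ketbra (ψ x)))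
      ≤ ∑' x, (p x : ℝ≥0∞) * ∑' i, ENNReal.ofReal (eta (‖coef (b i) (ψ x)‖ ^ 2)) :=
        ENNReal.tsum_le_tsum fun x => mul_le_mul_right (entropy_ketbra_le_tsum b (hψ x)) _
    _ = ∑' i, ∑' x, (p x : ℝ≥0∞) * ENNReal.ofReal (eta (‖coef (b i) (ψ x)‖ ^ 2)) := by
        rw [ENNReal.tsum_comm]
        simp_rw [ENNReal.tsum_mul_left]
    _ ≤ _ := ENNReal.tsum_le_tsum fun i => ?_
  set μ := (⟪b i, reducedLeft ρ (b i)⟫_ℂ).re with hμ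
  have hμ0 : 0 ≤ μ := re_inner_nonneg h.nonneg _
  have hμ1 : μ ≤ 1 := by
    refine (Complex.re_le_norm _).trans ((norm_inner_le_norm _ _).trans ?_)
    have := (reducedLeft ρ).le_opNorm (b i)
    rw [b.orthonormal.1] at this ⊢
    linarith [h.norm_le_one]
  have hm := hmix (b i)
  rw [← hμ] at hm
  have hq1 : ∀ x, ‖coef (b i) (ψ x)‖ ^ 2 ≤ 1 := by
    intro x
    have := ENNReal.le_tsum (f := fun i => ‖coef (b i) (ψ x)‖ₑ ^ 2) i
    rw [tsum_enorm_coef_sq, enorm_sq_eq_ofReal, enorm_sq_eq_ofReal, hψ] at this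
    exact (ENNReal.ofReal_le_ofReal_iff (by norm_num)).1 (by simpa using this)
  have hl2 : 0 < Real.log 2 := Real.log_pos (by norm_num)
  rcases hμ0.eq_or_lt with h0 | h0
  · rw [← h0, ENNReal.ofReal_zero, eq_comm, ENNReal.tsum_eq_zero] at hm
    rw [← h0, eta_zero, ENNReal.ofReal_zero, nonpos_iff_eq_zero, ENNReal.tsum_eq_zero]
    intro x
    rcases mul_eq_zero.1 (hm x) with h2 | h2
    · rw [h2, zero_mul]
    · have : coef (b i) (ψ x) = 0 := by simpa using h2
      simp [this, eta_zero]
  set L := -Real.logb 2 μ with hL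
  have hL0 : 0 ≤ L := by
    rw [hL, neg_nonneg]
    exact Real.logb_nonpos (by norm_num) hμ0 hμ1
  -- the tangent of `η` at `μ`, rearranged so that all terms are nonnegative
  have hpt : ∀ x, (p x : ℝ≥0∞) * ENNReal.ofReal (eta (‖coef (b i) (ψ x)‖ ^ 2)) +
      (p x : ℝ≥0∞) * ‖coef (b i) (ψ x)‖ₑ ^ 2 * ENNReal.ofReal (Real.log 2)⁻¹ ≤
      (p x : ℝ≥0∞) * ‖coef (b i) (ψ x)‖ₑ ^ 2 * ENNReal.ofReal L +
        (p x : ℝ≥0∞) * ENNReal.ofReal (μ * (Real.log 2)⁻¹) := by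
    intro x
    rw [mul_assoc, mul_assoc, ← mul_add, ← mul_add, enorm_sq_eq_ofReal]
    refine mul_le_mul_right ?_ _
    have h3 := eta_nonneg (sq_nonneg _) (hq1 x)
    rw [← ENNReal.ofReal_mul (by positivity), ← ENNReal.ofReal_mul (by positivity),
      ← ENNReal.ofReal_add h3 (by positivity), ← ENNReal.ofReal_add (by positivity) (by positivity)]
    refine ENNReal.ofReal_le_ofReal ?_
    have := eta_le_tangent (sq_nonneg ‖coef (b i) (ψ x)‖) h0
    rw [div_eq_mul_inv, sub_mul] at this
    linarith
  have h4 := ENNReal.tsum_le_tsum hpt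
  -- the trace of `reducedLeft ρ` in the basis `b`
  have hp1 : ∑' x, (p x : ℝ≥0∞) = 1 := by
    have := ENNReal.tsum_comm (f := fun (i : κ) x => (p x : ℝ≥0∞) * ‖coef (b i) (ψ x)‖ₑ ^ 2)
    simp_rw [← hmix, ENNReal.tsum_mul_left, tsum_enorm_coef_sq, enorm_sq_eq_ofReal, hψ] at this
    rw [← posTrace_eq_tsum b h.nonneg, h.posTrace_eq_one] at this
    simpa using this.symm
  rw [ENNReal.tsum_add, ENNReal.tsum_add, ENNReal.tsum_mul_right, ENNReal.tsum_mul_right,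
    ENNReal.tsum_mul_right, ← hm, hp1, one_mul, ← ENNReal.ofReal_mul hμ0] at h4
  have h5 := (ENNReal.add_le_add_iff_right ENNReal.ofReal_ne_top).1 h4
  refine h5.trans_eq ?_
  rw [← ENNReal.ofReal_mul hμ0, eta, hL, mul_neg]

end Reduced

/-! ### Conjugation by unitaries -/

section Unitary

variable {H K : Type*} [NormedAddCommGroup H] [InnerProductSpace ℂ H] [CompleteSpace H]
  [NormedAddCommGroup K] [InnerProductSpace ℂ K] [CompleteSpace K]

/-- The image of an orthonormal basis under a unitary. -/
def mapBasis {ι : Type*} (b : HilbertBasis ι ℂ H) (U : H ≃ₗᵢ[ℂ] K) : HilbertBasis ι ℂ K :=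
  HilbertBasis.ofRepr (U.symm.trans b.repr)

theorem mapBasis_apply {ι : Type*} (b : HilbertBasis ι ℂ H) (U : H ≃ₗᵢ[ℂ] K) (i : ι) :
    mapBasis b U i = U (b i) := by
  classical
  rw [← HilbertBasis.repr_symm_single, ← HilbertBasis.repr_symm_single]
  rfl

/-- The operator `U T U†`. -/
def conj (U : H ≃ₗᵢ[ℂ] K) (T : H →L[ℂ] H) : K →L[ℂ] K :=
  (U : H →L[ℂ] K) ∘L T ∘L (U.symm : K →L[ℂ] H)

theorem conj_apply (U : H ≃ₗᵢ[ℂ] K) (T : H →L[ℂ] H) (v : K) : conj U T v = U (T (U.symm v)) := rfl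

theorem adjoint_unitary (U : H ≃ₗᵢ[ℂ] K) :
    (U : H →L[ℂ] K).adjoint = (U.symm : K →L[ℂ] H) := by
  ext v
  refine ext_inner_right ℂ fun w => ?_
  rw [ContinuousLinearMap.adjoint_inner_left]
  change ⟪v, U w⟫_ℂ = ⟪U.symm v, w⟫_ℂ
  rw [← U.inner_map_map (U.symm v) w, U.apply_symm_apply]

theorem conj_eq (U : H ≃ₗᵢ[ℂ] K) (T : H →L[ℂ] H) :
    conj U T = (U : H →L[ℂ] K) ∘L T ∘L (U : H →L[ℂ] K).adjoint := by
  rw [adjoint_unitary]; rfl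

theorem conj_unitary_nonneg (U : H ≃ₗᵢ[ℂ] K) {T : H →L[ℂ] H} (hT : 0 ≤ T) : 0 ≤ conj U T := by
  rw [conj_eq]
  exact (ContinuousLinearMap.nonneg_iff_isPositive _).2
    (((ContinuousLinearMap.nonneg_iff_isPositive _).1 hT).conj_adjoint _)

theorem posTrace_conj (U : H ≃ₗᵢ[ℂ] K) {T : H →L[ℂ] H} (hT : 0 ≤ T) :
    posTrace (conj U T) = posTrace T := by
  rw [posTrace_eq_tsum (mapBasis (basis H) U) (conj_unitary_nonneg U hT), posTrace]
  refine tsum_congr fun i => ?_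
  rw [mapBasis_apply, conj_apply, U.symm_apply_apply, U.inner_map_map]

theorem isState_conj (U : H ≃ₗᵢ[ℂ] K) {ρ : H →L[ℂ] H} (hρ : IsState ρ) : IsState (conj U ρ) :=
  ⟨conj_unitary_nonneg U hρ.nonneg, (posTrace_conj U hρ.nonneg).trans hρ.posTrace_eq_one⟩

theorem conj_ketbra (U : H ≃ₗᵢ[ℂ] K) (ψ : H) : conj U (ketbra ψ) = ketbra (U ψ) := by
  rw [conj_eq, comp_ketbra_adjoint]; rfl

/-- `T ↦ U T U†` as a continuous linear map. -/
theorem hasSum_conj {ι : Type*} (U : H ≃ₗᵢ[ℂ] K) {T : ι → H →L[ℂ] H} {S : H →L[ℂ] H}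
    (h : HasSum T S) : HasSum (fun i => conj U (T i)) (conj U S) := by
  have h1 := (h.mapL ((ContinuousLinearMap.compL ℂ K H H).flip (U.symm : K →L[ℂ] H))).mapL
    (ContinuousLinearMap.compL ℂ K H K (U : H →L[ℂ] K))
  exact h1

theorem conj_smul (U : H ≃ₗᵢ[ℂ] K) (c : ℂ) (T : H →L[ℂ] H) : conj U (c • T) = c • conj U T := by
  ext v
  simp [conj_apply]

theorem conj_conj {L : Type*} [NormedAddCommGroup L] [InnerProductSpace ℂ L] [CompleteSpace L]
    (V : K ≃ₗᵢ[ℂ] L) (U : H ≃ₗᵢ[ℂ] K) (T : H →L[ℂ] H) :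
    conj V (conj U T) = conj (U.trans V) T := rfl

end Unitary

/-! ### Exchange of the two parties -/

section Swap

variable {A B : Type*} [NormedAddCommGroup A] [InnerProductSpace ℂ A] [CompleteSpace A]
  [NormedAddCommGroup B] [InnerProductSpace ℂ B] [CompleteSpace B]

variable (A B) in
/-- The unitary `a ⊗ b ↦ b ⊗ a`. -/
def swap : HTensor A B ≃ₗᵢ[ℂ] HTensor B A :=
  (TensorProduct.commIsometry ℂ A B).toLinearEquiv.extendOfIsometry
    (toHTensor A B).toLinearMap (toHTensor B A).toLinearMap (denseRange_toHTensor A B)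
    (denseRange_toHTensor B A) fun x => by
      change ‖toHTensor B A (TensorProduct.commIsometry ℂ A B x)‖ = ‖toHTensor A B x‖
      rw [LinearIsometry.norm_map, LinearIsometry.norm_map, LinearIsometryEquiv.norm_map]

theorem swap_tmul (a : A) (b : B) : swap A B (tmul a b) = tmul b a :=
  LinearEquiv.extendOfIsometry_eq (TensorProduct.commIsometry ℂ A B).toLinearEquiv
    (toHTensor A B).toLinearMap (toHTensor B A).toLinearMap (denseRange_toHTensor A B)
    (denseRange_toHTensor B A) _ (a ⊗ₜ[ℂ] b)

theorem swap_symm_tmul (a : A) (b : B) : (swap A B).symm (tmul b a) = tmul a b := by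
  rw [LinearIsometryEquiv.symm_apply_eq, swap_tmul]

theorem reducedRight_eq_reducedLeft_swap (ρ : HTensor A B →L[ℂ] HTensor A B) :
    reducedRight ρ = reducedLeft (conj (swap A B) ρ) := by
  refine tsum_congr fun i => ?_
  ext v
  refine ext_inner_left ℂ fun w => ?_
  simp only [ContinuousLinearMap.comp_apply]
  rw [ContinuousLinearMap.adjoint_inner_right, ContinuousLinearMap.adjoint_inner_right, conj_apply,
    tmulRight_apply, tmulRight_apply, tmulLeft_apply, tmulLeft_apply, swap_symm_tmul,
    ← swap_tmul (basis A i) w, LinearIsometryEquiv.inner_map_map]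

/-- One half of the equality of the entropies of the two reduced states of a pure state; the other
half is the same statement for the exchanged parties. The normalized Schmidt vectors of the second
party are completed to an orthonormal basis, which is a basis for the exchanged state whose
components have the same norms. -/
theorem entropy_reducedLeft_swap_le {A B : Type u} [NormedAddCommGroup A] [InnerProductSpace ℂ A]
    [CompleteSpace A] [NormedAddCommGroup B] [InnerProductSpace ℂ B] [CompleteSpace B]
    {ψ : HTensor A B} (hψ : ‖ψ‖ = 1) :
    entropy (reducedLeft (ketbra (swap A B ψ))) ≤ entropy (reducedLeft (ketbra ψ)) := by
  obtain ⟨ι, b, hb, hS⟩ := exists_schmidt_basis hψ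
  rw [hS]
  set β : ι → B := fun i => coef (b i) ψ with hβ
  let S := {i : ι // β i ≠ 0}
  let e : S → B := fun i => ((‖β i‖⁻¹ : ℝ) : ℂ) • β i
  have he : Orthonormal ℂ e := by
    refine ⟨fun i => ?_, fun i j hij => ?_⟩
    · simp [e, norm_smul, i.2]
    · simp only [e, inner_smul_left, inner_smul_right]
      rw [hb fun h => hij (Subtype.ext h)]
      simp
  -- the extended basis `c` contains the vectors `e i`, at the indices `g i`
  obtain ⟨w, c, hw, hc⟩ := he.toSubtypeRange.exists_hilbertBasis_extension
  have hψ' : ‖swap A B ψ‖ = 1 := by rw [LinearIsometryEquiv.norm_map, hψ]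
  refine (entropy_ketbra_le_tsum c hψ').trans ?_
  have hcoef : ∀ x : B, ENNReal.ofReal (‖coef x (swap A B ψ)‖ ^ 2) =
      ∑' i, ‖⟪x, β i⟫_ℂ‖ₑ ^ 2 := by
    intro x
    rw [← enorm_sq_eq_ofReal, ← tsum_enorm_inner_sq b]
    refine tsum_congr fun i => ?_
    rw [inner_coef, hβ, inner_coef, ← swap_tmul, LinearIsometryEquiv.inner_map_map]
  let g : S → w := fun i => ⟨e i, hw ⟨i, rfl⟩⟩
  have hg : Function.Injective g := by
    intro i j hij
    exact he.linearIndependent.injective (congrArg Subtype.val hij)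
  have hcg : ∀ i : S, c (g i) = e i := fun i => by rw [hc]
  have hval : ∀ i : S, ‖coef (c (g i)) (swap A B ψ)‖ ^ 2 = ‖β i‖ ^ 2 := by
    intro i
    have h1 := hcoef (c (g i))
    rw [tsum_eq_single i.1] at h1
    · rw [hcg, enorm_sq_eq_ofReal,
        ENNReal.ofReal_eq_ofReal_iff (by positivity) (by positivity)] at h1
      rw [hcg, h1]
      simp only [e, inner_smul_left, inner_self_eq_norm_sq_to_K]
      have : ‖β i‖ ≠ 0 := norm_ne_zero_iff.2 i.2
      simp only [norm_mul, RCLike.norm_conj, norm_pow, Complex.norm_real, norm_inv, norm_norm,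
        Complex.coe_algebraMap]
      field_simp
    · intro j hj
      rw [hcg]
      simp only [e, inner_smul_left]
      rw [hb fun h => hj h.symm]
      simp
  have hzero : Function.support (fun x => ENNReal.ofReal (eta (‖coef (c x) (swap A B ψ)‖ ^ 2))) ⊆
      Set.range g := by
    intro x hx
    by_contra hxg
    refine hx ?_
    have h1 : ‖coef (c x) (swap A B ψ)‖ ^ 2 = 0 := by
      have h2 := hcoef (c x)
      have h3 : ∀ i, ‖⟪c x, β i⟫_ℂ‖ₑ ^ 2 = 0 := by
        intro i
        by_cases hi : β i = 0
        · rw [hi]; simp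
        have h4 : c x ≠ c (g ⟨i, hi⟩) := fun h =>
          hxg ⟨⟨i, hi⟩, (c.orthonormal.linearIndependent.injective h).symm⟩
        have h5 : x ≠ g ⟨i, hi⟩ := fun h => h4 (congrArg c h)
        have h6 : ⟪c x, c (g ⟨i, hi⟩)⟫_ℂ = 0 := c.orthonormal.2 h5
        rw [hcg] at h6
        simp only [e, inner_smul_right, mul_eq_zero] at h6
        rcases h6 with h6 | h6
        · simp [hi] at h6
        · rw [h6]; simp
      simp_rw [h3, tsum_zero] at h2
      have := ENNReal.ofReal_eq_zero.1 h2
      exact le_antisymm this (by positivity)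
    simp only [h1, eta_zero, ENNReal.ofReal_zero]
  rw [← hg.tsum_eq hzero]
  simp_rw [hval]
  exact ENNReal.tsum_comp_le_tsum_of_injective Subtype.val_injective
    (fun i => ENNReal.ofReal (eta (‖β i‖ ^ 2)))

end Swap

/-! ### Pure-state decompositions -/

section Decompositions

variable {A B : Type*} [NormedAddCommGroup A] [InnerProductSpace ℂ A] [CompleteSpace A]
  [NormedAddCommGroup B] [InnerProductSpace ℂ B] [CompleteSpace B]

/-- Decompositions over arbitrary countable index types bound the entanglement of formation. -/
theorem entanglementOfFormation_le_tsum {ι : Type*} [Countable ι]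
    {ρ : HTensor A B →L[ℂ] HTensor A B} {p : ι → ℝ≥0} {ψ : ι → HTensor A B}
    (hψ : ∀ x, ‖ψ x‖ = 1) (hp : HasSum p 1)
    (hsum : HasSum (fun x => ((p x : ℝ) : ℂ) • ketbra (ψ x)) ρ) :
    entanglementOfFormation ρ ≤ ∑' x, (p x : ℝ≥0∞) * entropy (reducedLeft (ketbra (ψ x))) := by
  obtain ⟨f, hf⟩ := exists_injective_nat ι
  have hne : Nonempty ι := by
    by_contra h
    rw [not_nonempty_iff] at h
    exact one_ne_zero (hp.unique hasSum_empty)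
  obtain ⟨x₀⟩ := hne
  let p' : ℕ → ℝ≥0 := Function.extend f p 0
  let ψ' : ℕ → HTensor A B := Function.extend f ψ fun _ => ψ x₀
  have hp' : ∀ x, p' (f x) = p x := fun x => hf.extend_apply _ _ _
  have hψ' : ∀ x, ψ' (f x) = ψ x := fun x => hf.extend_apply _ _ _
  have hz : ∀ n, n ∉ Set.range f → p' n = 0 := fun n hn => Function.extend_apply' _ _ _ hn
  have hdec : IsPureDecomposition ρ p' ψ' := by
    refine ⟨fun n => ?_, ?_, ?_⟩
    · by_cases hn : ∃ x, f x = n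
      · obtain ⟨x, rfl⟩ := hn
        rw [hψ', hψ]
      · have : ψ' n = ψ x₀ := Function.extend_apply' _ _ _ hn
        rw [this, hψ]
    · rw [← hf.hasSum_iff (fun n hn => hz n hn)]
      exact hasSum_of_eq hp fun x => (hp' x).symm
    · rw [← hf.hasSum_iff (fun n hn => by rw [hz n hn]; simp)]
      refine hasSum_of_eq hsum fun x => ?_
      simp only [Function.comp_apply]
      rw [hp', hψ']
  rw [entanglementOfFormation]
  refine (iInf_le _ p').trans ((iInf_le _ ψ').trans ((iInf_le _ hdec).trans_eq ?_))
  rw [← hf.tsum_eq]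
  · refine tsum_congr fun x => ?_
    rw [hp', hψ']
  · intro n hn
    by_contra h
    exact hn (by dsimp only; rw [hz n h]; simp)

/-- Every state on a separable space is a countable convex combination of pure states: normalize
the vectors `√ρ eᵢ`. -/
theorem exists_pure_decomposition {H : Type u} [NormedAddCommGroup H] [InnerProductSpace ℂ H]
    [CompleteSpace H] [SeparableSpace H] {ρ : H →L[ℂ] H} (hρ : IsState ρ) :
    ∃ (ι : Type u) (_ : Countable ι) (p : ι → ℝ≥0) (ψ : ι → H), (∀ x, ‖ψ x‖ = 1) ∧ HasSum p 1 ∧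
      HasSum (fun x => ((p x : ℝ) : ℂ) • ketbra (ψ x)) ρ := by
  classical
  set q : basisIndex H → H := fun i => CFC.sqrt ρ (basis H i) with hq
  have hne : Nonempty (basisIndex H) := by
    by_contra h
    rw [not_nonempty_iff] at h
    have := hρ.posTrace_eq_one
    simp [posTrace] at this
  obtain ⟨i₀⟩ := hne
  refine ⟨basisIndex H, HilbertBasis.countable (basis H), fun i => ‖q i‖₊ ^ 2,
    fun i => if q i = 0 then basis H i₀ else ((‖q i‖⁻¹ : ℝ) : ℂ) • q i, fun i => ?_, ?_, ?_⟩
  · dsimp only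
    split_ifs with h
    · exact (basis H).orthonormal.1 i₀
    · simp [norm_smul, h]
  · have h1 := hρ.posTrace_eq_one
    rw [posTrace_eq_sqrt hρ.nonneg] at h1
    rw [← ENNReal.hasSum_coe, ENNReal.coe_one, ← h1]
    have h2 : ∀ i, ((‖q i‖₊ ^ 2 : ℝ≥0) : ℝ≥0∞) = ‖CFC.sqrt ρ (basis H i)‖ₑ ^ 2 := by
      intro i
      rw [ENNReal.coe_pow]; rfl
    simp_rw [h2]
    exact ENNReal.summable.hasSum
  · have h := hasSum_ketbra_sqrt (basis H) hρ.nonneg (by rw [hρ.posTrace_eq_one]; simp)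
    refine hasSum_of_eq h fun i => ?_
    dsimp only
    split_ifs with h0
    · have h0' : CFC.sqrt ρ (basis H i) = 0 := h0
      rw [h0, h0']
      ext v
      simp [ketbra_apply]
    · rw [ketbra_smul, smul_smul]
      have h2 : (((‖q i‖₊ ^ 2 : ℝ≥0) : ℝ) : ℂ) * ((‖((‖q i‖⁻¹ : ℝ) : ℂ)‖ ^ 2 : ℝ) : ℂ) = 1 := by
        have : ‖q i‖ ≠ 0 := norm_ne_zero_iff.2 h0
        rw [← Complex.ofReal_mul, ← Complex.ofReal_one]
        congr 1
        simp only [NNReal.coe_pow, coe_nnnorm, Complex.norm_real, norm_inv, norm_norm]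
        field_simp
      rw [h2, one_smul]

/-- The entanglement of formation is bounded by both local entropies. -/
theorem entanglementOfFormation_le_min {A B : Type u} [NormedAddCommGroup A]
    [InnerProductSpace ℂ A] [CompleteSpace A] [SeparableSpace A] [NormedAddCommGroup B]
    [InnerProductSpace ℂ B] [CompleteSpace B] [SeparableSpace B]
    {ρ : HTensor A B →L[ℂ] HTensor A B} (hρ : IsState ρ) :
    entanglementOfFormation ρ ≤ min (entropy (reducedLeft ρ)) (entropy (reducedRight ρ)) := by
  obtain ⟨ι, _, p, ψ, hψ, hp, hsum⟩ := exists_pure_decomposition hρ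
  have h := entanglementOfFormation_le_tsum hψ hp hsum
  refine le_min (h.trans (tsum_entropy_le_entropy_reducedLeft hρ hψ hsum)) (h.trans ?_)
  have hψ' : ∀ x, ‖swap A B (ψ x)‖ = 1 := fun x => by rw [LinearIsometryEquiv.norm_map, hψ]
  rw [reducedRight_eq_reducedLeft_swap]
  refine le_trans ?_ (tsum_entropy_le_entropy_reducedLeft (isState_conj (swap A B) hρ) hψ'
    (hasSum_of_eq (hasSum_conj (swap A B) hsum) fun x => by rw [conj_smul, conj_ketbra]))
  refine ENNReal.tsum_le_tsum fun x => mul_le_mul_right ?_ _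
  have h1 := entropy_reducedLeft_swap_le (hψ' x)
  have h2 : swap B A (swap A B (ψ x)) = ψ x := by
    have : (swap B A : HTensor B A →L[ℂ] HTensor A B) ∘L
        (swap A B : HTensor A B →L[ℂ] HTensor B A) = ContinuousLinearMap.id ℂ _ := by
      refine HTensor.ext fun a b => ?_
      change swap B A (swap A B (tmul a b)) = tmul a b
      rw [swap_tmul, swap_tmul]
    exact congrArg (fun f : HTensor A B →L[ℂ] HTensor A B => f (ψ x)) this
  rwa [h2] at h1

end Decompositions

/-! ### Unitaries between tensor products -/

section TensorUnitaries

variable {A B C D E F A' B' : Type*}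
  [NormedAddCommGroup A] [InnerProductSpace ℂ A] [CompleteSpace A]
  [NormedAddCommGroup B] [InnerProductSpace ℂ B] [CompleteSpace B]
  [NormedAddCommGroup C] [InnerProductSpace ℂ C] [CompleteSpace C]
  [NormedAddCommGroup D] [InnerProductSpace ℂ D] [CompleteSpace D]
  [NormedAddCommGroup E] [InnerProductSpace ℂ E] [CompleteSpace E]
  [NormedAddCommGroup F] [InnerProductSpace ℂ F] [CompleteSpace F]
  [NormedAddCommGroup A'] [InnerProductSpace ℂ A'] [CompleteSpace A']
  [NormedAddCommGroup B'] [InnerProductSpace ℂ B'] [CompleteSpace B']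

theorem norm_tmul (a : A) (b : B) : ‖tmul a b‖ = ‖a‖ * ‖b‖ := by
  rw [tmul, LinearIsometry.norm_map, TensorProduct.norm_tmul]

theorem tmul_smul_left (c : ℂ) (a : A) (b : B) : tmul (c • a) b = c • tmul a b :=
  (tmulRight (A := A) b).map_smul c a

theorem tmul_smul_right (c : ℂ) (a : A) (b : B) : tmul a (c • b) = c • tmul a b :=
  (tmulLeft (B := B) a).map_smul c b

/-- Continuous linear maps on `X ⊗ C` are determined by their values on `x ⊗ c` for `x` product
vectors. -/
theorem HTensor.ext_left {f g : HTensor (HTensor A B) C →L[ℂ] E}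
    (h : ∀ a b c, f (tmul (tmul a b) c) = g (tmul (tmul a b) c)) : f = g := by
  refine HTensor.ext fun x c => ?_
  have : f ∘L tmulRight (A := HTensor A B) c = g ∘L tmulRight c :=
    HTensor.ext fun a b => h a b c
  exact congrArg (fun k : HTensor A B →L[ℂ] E => k x) this

theorem HTensor.ext_right {f g : HTensor A (HTensor B C) →L[ℂ] E}
    (h : ∀ a b c, f (tmul a (tmul b c)) = g (tmul a (tmul b c))) : f = g := by
  refine HTensor.ext fun a x => ?_
  have : f ∘L tmulLeft (B := HTensor B C) a = g ∘L tmulLeft a :=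
    HTensor.ext fun b c => h a b c
  exact congrArg (fun k : HTensor B C →L[ℂ] E => k x) this

theorem HTensor.ext₄ {f g : HTensor (HTensor A B) (HTensor C D) →L[ℂ] E}
    (h : ∀ a b c d, f (tmul (tmul a b) (tmul c d)) = g (tmul (tmul a b) (tmul c d))) : f = g := by
  refine HTensor.ext_left fun a b x => ?_
  have : f ∘L tmulLeft (B := HTensor C D) (tmul a b) = g ∘L tmulLeft (tmul a b) :=
    HTensor.ext fun c d => h a b c d
  exact congrArg (fun k : HTensor C D →L[ℂ] E => k x) this

theorem HTensor.ext₆ {G : Type*} [NormedAddCommGroup G] [InnerProductSpace ℂ G] [CompleteSpace G]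
    {f g : HTensor (HTensor (HTensor A B) (HTensor C D)) (HTensor E F) →L[ℂ] G}
    (h : ∀ a b c d x y, f (tmul (tmul (tmul a b) (tmul c d)) (tmul x y)) =
      g (tmul (tmul (tmul a b) (tmul c d)) (tmul x y))) : f = g := by
  refine HTensor.ext fun v w => ?_
  have h1 : f ∘L tmulRight (A := HTensor (HTensor A B) (HTensor C D)) w = g ∘L tmulRight w := by
    refine HTensor.ext₄ fun a b c d => ?_
    have h2 : f ∘L tmulLeft (B := HTensor E F) (tmul (tmul a b) (tmul c d)) =
        g ∘L tmulLeft (tmul (tmul a b) (tmul c d)) := HTensor.ext fun x y => h a b c d x y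
    exact congrArg (fun k : HTensor E F →L[ℂ] G => k w) h2
  exact congrArg (fun k : HTensor (HTensor A B) (HTensor C D) →L[ℂ] G => k v) h1

theorem unitary_ext {H K : Type*} [NormedAddCommGroup H] [InnerProductSpace ℂ H]
    [NormedAddCommGroup K] [InnerProductSpace ℂ K] {U V : H ≃ₗᵢ[ℂ] K}
    (h : (U : H →L[ℂ] K) = (V : H →L[ℂ] K)) : U = V :=
  LinearIsometryEquiv.ext fun x => congrArg (fun f : H →L[ℂ] K => f x) h

variable (A B C) in
/-- The unitary `(a ⊗ b) ⊗ c ↦ a ⊗ (b ⊗ c)`. -/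
def assoc : HTensor (HTensor A B) C ≃ₗᵢ[ℂ] HTensor A (HTensor B C) :=
  (TensorProduct.assocIsometry ℂ A B C).toLinearEquiv.extendOfIsometry
    ((toHTensor (HTensor A B) C).comp
      (TensorProduct.mapIsometry (toHTensor A B) LinearIsometry.id)).toLinearMap
    ((toHTensor A (HTensor B C)).comp
      (TensorProduct.mapIsometry LinearIsometry.id (toHTensor B C))).toLinearMap
    ((denseRange_toHTensor _ _).comp
      (denseRange_mapIsometry (denseRange_toHTensor A B) denseRange_id) (toHTensor _ _).continuous)
    ((denseRange_toHTensor _ _).comp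
      (denseRange_mapIsometry denseRange_id (denseRange_toHTensor B C)) (toHTensor _ _).continuous)
    fun x => by
      change ‖((toHTensor A (HTensor B C)).comp
        (TensorProduct.mapIsometry LinearIsometry.id (toHTensor B C)))
          (TensorProduct.assocIsometry ℂ A B C x)‖ = ‖((toHTensor (HTensor A B) C).comp
            (TensorProduct.mapIsometry (toHTensor A B) LinearIsometry.id)) x‖
      rw [LinearIsometry.norm_map, LinearIsometry.norm_map, LinearIsometryEquiv.norm_map]

theorem assoc_tmul (a : A) (b : B) (c : C) :
    assoc A B C (tmul (tmul a b) c) = tmul a (tmul b c) :=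
  LinearEquiv.extendOfIsometry_eq (TensorProduct.assocIsometry ℂ A B C).toLinearEquiv
    ((toHTensor (HTensor A B) C).comp
      (TensorProduct.mapIsometry (toHTensor A B) LinearIsometry.id)).toLinearMap
    ((toHTensor A (HTensor B C)).comp
      (TensorProduct.mapIsometry LinearIsometry.id (toHTensor B C))).toLinearMap _ _ _
    ((a ⊗ₜ[ℂ] b) ⊗ₜ[ℂ] c)

/-- The unitary `U ⊗ V`. -/
def tensorU (U : A ≃ₗᵢ[ℂ] C) (V : B ≃ₗᵢ[ℂ] D) : HTensor A B ≃ₗᵢ[ℂ] HTensor C D :=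
  (TensorProduct.congrIsometry U V).toLinearEquiv.extendOfIsometry
    (toHTensor A B).toLinearMap (toHTensor C D).toLinearMap (denseRange_toHTensor A B)
    (denseRange_toHTensor C D) fun x => by
      change ‖toHTensor C D (TensorProduct.congrIsometry U V x)‖ = ‖toHTensor A B x‖
      rw [LinearIsometry.norm_map, LinearIsometry.norm_map, LinearIsometryEquiv.norm_map]

theorem tensorU_tmul (U : A ≃ₗᵢ[ℂ] C) (V : B ≃ₗᵢ[ℂ] D) (a : A) (b : B) :
    tensorU U V (tmul a b) = tmul (U a) (V b) :=
  LinearEquiv.extendOfIsometry_eq (TensorProduct.congrIsometry U V).toLinearEquiv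
    (toHTensor A B).toLinearMap (toHTensor C D).toLinearMap _ _ _ (a ⊗ₜ[ℂ] b)

variable (A B C D) in
/-- The exchange of the two middle factors as a unitary. -/
def shuffleU : HTensor (HTensor A B) (HTensor C D) ≃ₗᵢ[ℂ] HTensor (HTensor A C) (HTensor B D) :=
  (algShuffle A B C D).toLinearEquiv.extendOfIsometry
    (inclusion₄ A B C D).toLinearMap (inclusion₄ A C B D).toLinearMap denseRange_inclusion₄
    denseRange_inclusion₄ fun x => by
      change ‖inclusion₄ A C B D (algShuffle A B C D x)‖ = ‖inclusion₄ A B C D x‖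
      rw [LinearIsometry.norm_map, LinearIsometry.norm_map, LinearIsometryEquiv.norm_map]

theorem coe_shuffleU : (shuffleU A B C D : _ →L[ℂ] _) = shuffle A B C D := rfl

theorem shuffleU_tmul (a : A) (b : B) (c : C) (d : D) :
    shuffleU A B C D (tmul (tmul a b) (tmul c d)) = tmul (tmul a c) (tmul b d) :=
  shuffle_tmul a b c d

/-- Tensoring with a unit vector that spans the first factor is a unitary. -/
theorem exists_leftUnitor (e : E) (he : ‖e‖ = 1) (hspan : ∀ x : E, ∃ c : ℂ, x = c • e) (A : Type*)
    [NormedAddCommGroup A] [InnerProductSpace ℂ A] [CompleteSpace A] :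
    ∃ U : HTensor E A ≃ₗᵢ[ℂ] A, ∀ a, U (tmul e a) = a := by
  let f : A →ₗᵢ[ℂ] HTensor E A := ⟨(tmulLeft (B := A) e).toLinearMap, fun a => by
    change ‖tmul e a‖ = ‖a‖
    rw [norm_tmul, he, one_mul]⟩
  have hf : Function.Surjective f := by
    have hcl : IsClosed (Set.range f) := f.isometry.isClosedEmbedding.isClosed_range
    have hd : DenseRange f := by
      refine (denseRange_toHTensor E A).mono ?_ |>.mono subset_rfl
      rintro _ ⟨z, rfl⟩
      induction z using TensorProduct.induction_on with
      | zero => exact ⟨0, by simp⟩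
      | tmul x a =>
        obtain ⟨c, rfl⟩ := hspan x
        refine ⟨c • a, ?_⟩
        change tmul e (c • a) = tmul (c • e) a
        rw [tmul_smul_left, tmul_smul_right]
      | add x y hx hy =>
        obtain ⟨a, ha⟩ := hx
        obtain ⟨b, hb⟩ := hy
        exact ⟨a + b, by rw [map_add, map_add, ha, hb]⟩
    intro x
    have := hd x
    rwa [hcl.closure_eq] at this
  refine ⟨(LinearIsometryEquiv.ofSurjective f hf).symm, fun a => ?_⟩
  rw [LinearIsometryEquiv.symm_apply_eq]
  rfl

end TensorUnitaries

/-! ### Tensor products of bipartite states -/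

section TensorStates

variable {A B C D E F A' B' : Type*}
  [NormedAddCommGroup A] [InnerProductSpace ℂ A] [CompleteSpace A]
  [NormedAddCommGroup B] [InnerProductSpace ℂ B] [CompleteSpace B]
  [NormedAddCommGroup C] [InnerProductSpace ℂ C] [CompleteSpace C]
  [NormedAddCommGroup D] [InnerProductSpace ℂ D] [CompleteSpace D]
  [NormedAddCommGroup E] [InnerProductSpace ℂ E] [CompleteSpace E]
  [NormedAddCommGroup F] [InnerProductSpace ℂ F] [CompleteSpace F]
  [NormedAddCommGroup A'] [InnerProductSpace ℂ A'] [CompleteSpace A']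
  [NormedAddCommGroup B'] [InnerProductSpace ℂ B'] [CompleteSpace B']

theorem conj_tensorU (U : A ≃ₗᵢ[ℂ] C) (V : B ≃ₗᵢ[ℂ] D) (S : A →L[ℂ] A) (T : B →L[ℂ] B) :
    conj (tensorU U V) (opTensor S T) = opTensor (conj U S) (conj V T) := by
  refine HTensor.ext fun c d => ?_
  have h : (tensorU U V).symm (tmul c d) = tmul (U.symm c) (V.symm d) := by
    rw [LinearIsometryEquiv.symm_apply_eq, tensorU_tmul, U.apply_symm_apply, V.apply_symm_apply]
  rw [conj_apply, h, opTensor_tmul, opTensor_tmul, tensorU_tmul]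
  rfl

theorem conj_refl (T : A →L[ℂ] A) : conj (LinearIsometryEquiv.refl ℂ A) T = T := rfl

theorem conj_assoc (S : A →L[ℂ] A) (T : B →L[ℂ] B) (R : C →L[ℂ] C) :
    conj (assoc A B C) (opTensor (opTensor S T) R) = opTensor S (opTensor T R) := by
  refine HTensor.ext_right fun a b c => ?_
  have h : (assoc A B C).symm (tmul a (tmul b c)) = tmul (tmul a b) c := by
    rw [LinearIsometryEquiv.symm_apply_eq, assoc_tmul]
  rw [conj_apply, h, opTensor_tmul, opTensor_tmul, opTensor_tmul, opTensor_tmul, assoc_tmul]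

/-- The state `ρ ⊗ σ` of the bipartite system `AC : BD`. -/
def tensorState (ρ : HTensor A B →L[ℂ] HTensor A B) (σ : HTensor C D →L[ℂ] HTensor C D) :
    HTensor (HTensor A C) (HTensor B D) →L[ℂ] HTensor (HTensor A C) (HTensor B D) :=
  conj (shuffleU A B C D) (opTensor ρ σ)

theorem tensorState_eq (ρ : HTensor A B →L[ℂ] HTensor A B) (σ : HTensor C D →L[ℂ] HTensor C D) :
    shuffle A B C D ∘L opTensor ρ σ ∘L (shuffle A B C D).adjoint = tensorState ρ σ := by
  rw [tensorState, conj_eq, coe_shuffleU]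

theorem isState_opTensor {ρ : A →L[ℂ] A} {σ : B →L[ℂ] B} (hρ : IsState ρ) (hσ : IsState σ) :
    IsState (opTensor ρ σ) :=
  ⟨opTensor_nonneg hρ.nonneg hσ.nonneg, by
    rw [posTrace_opTensor hρ.nonneg hσ.nonneg, hρ.posTrace_eq_one, hσ.posTrace_eq_one, one_mul]⟩

theorem isState_tensorState {ρ : HTensor A B →L[ℂ] HTensor A B}
    {σ : HTensor C D →L[ℂ] HTensor C D} (hρ : IsState ρ) (hσ : IsState σ) :
    IsState (tensorState ρ σ) :=
  isState_conj _ (isState_opTensor hρ hσ)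

/-- The associativity of tensor products of bipartite states, up to local unitaries. -/
theorem tensorState_assoc (U : HTensor A C ≃ₗᵢ[ℂ] A') (V : HTensor B D ≃ₗᵢ[ℂ] B')
    (ρ : HTensor E F →L[ℂ] HTensor E F) (σ : HTensor A B →L[ℂ] HTensor A B)
    (τ : HTensor C D →L[ℂ] HTensor C D) :
    conj (tensorU ((assoc E A C).trans (tensorU (LinearIsometryEquiv.refl ℂ E) U))
      ((assoc F B D).trans (tensorU (LinearIsometryEquiv.refl ℂ F) V)))
        (tensorState (tensorState ρ σ) τ) =
    tensorState ρ (conj (tensorU U V) (tensorState σ τ)) := by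
  have h1 : opTensor (conj (shuffleU E F A B) (opTensor ρ σ)) τ =
      conj (tensorU (shuffleU E F A B) (LinearIsometryEquiv.refl ℂ (HTensor C D)))
        (opTensor (opTensor ρ σ) τ) := by
    rw [conj_tensorU, conj_refl]
  have h2 : opTensor ρ (conj (tensorU U V) (tensorState σ τ)) =
      conj (tensorU (LinearIsometryEquiv.refl ℂ (HTensor E F))
        ((shuffleU A B C D).trans (tensorU U V))) (opTensor ρ (opTensor σ τ)) := by
    rw [conj_tensorU, conj_refl, tensorState, conj_conj]
  rw [tensorState, tensorState, tensorState, h1, h2, ← conj_assoc, conj_conj, conj_conj, conj_conj,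
    conj_conj]
  congr 1
  refine unitary_ext ?_
  refine HTensor.ext₆ fun e f a b c d => ?_
  simp only [LinearIsometryEquiv.coe_coe'', LinearIsometryEquiv.trans_apply, tensorU_tmul,
    shuffleU_tmul, assoc_tmul, LinearIsometryEquiv.coe_refl, id_eq]

theorem norm_opTensor_le (S : A →L[ℂ] A) (T : B →L[ℂ] B) : ‖opTensor S T‖ ≤ ‖S‖ * ‖T‖ := by
  refine le_trans ?_ (TensorProduct.norm_mapL_le S T)
  refine ContinuousLinearMap.opNorm_le_bound _ (TensorProduct.mapL S T).opNorm_nonneg fun x => ?_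
  refine (denseRange_toHTensor A B).induction_on
    (p := fun x => ‖opTensor S T x‖ ≤ ‖TensorProduct.mapL S T‖ * ‖x‖) x ?_ fun z => ?_
  · exact isClosed_le (by fun_prop) (by fun_prop)
  · have h : opTensor S T (toHTensor A B z) = toHTensor A B (TensorProduct.mapL S T z) :=
      ContinuousLinearMap.completion_apply_coe (TensorProduct.mapL S T) z
    rw [h, LinearIsometry.norm_map, LinearIsometry.norm_map]
    exact ContinuousLinearMap.le_opNorm _ _

theorem opTensor_add_left (S S' : A →L[ℂ] A) (T : B →L[ℂ] B) :
    opTensor (S + S') T = opTensor S T + opTensor S' T :=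
  HTensor.ext fun a b => by
    simp only [opTensor_tmul, add_apply]
    exact (tmulRight (A := A) (T b)).map_add _ _

theorem opTensor_add_right (S : A →L[ℂ] A) (T T' : B →L[ℂ] B) :
    opTensor S (T + T') = opTensor S T + opTensor S T' :=
  HTensor.ext fun a b => by
    simp only [opTensor_tmul, add_apply]
    exact (tmulLeft (B := B) (S a)).map_add _ _

theorem opTensor_smul_left (c : ℂ) (S : A →L[ℂ] A) (T : B →L[ℂ] B) :
    opTensor (c • S) T = c • opTensor S T :=
  HTensor.ext fun a b => by simp only [opTensor_tmul, smul_apply, tmul_smul_left]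

theorem opTensor_smul_right (c : ℂ) (S : A →L[ℂ] A) (T : B →L[ℂ] B) :
    opTensor S (c • T) = c • opTensor S T :=
  HTensor.ext fun a b => by simp only [opTensor_tmul, smul_apply, tmul_smul_right]

theorem hasSum_opTensor_left {ι : Type*} {S : ι → A →L[ℂ] A} {R : A →L[ℂ] A} (h : HasSum S R)
    (T : B →L[ℂ] B) : HasSum (fun i => opTensor (S i) T) (opTensor R T) :=
  h.mapL (LinearMap.mkContinuous (E := A →L[ℂ] A) (F := HTensor A B →L[ℂ] HTensor A B)
    ({ toFun := fun S => opTensor S T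
       map_add' := fun S S' => opTensor_add_left S S' T
       map_smul' := fun c S => opTensor_smul_left c S T } :
        (A →L[ℂ] A) →ₗ[ℂ] (HTensor A B →L[ℂ] HTensor A B)) ‖T‖ fun S => by
        rw [mul_comm]; exact norm_opTensor_le S T)

theorem hasSum_opTensor_right {ι : Type*} {T : ι → B →L[ℂ] B} {R : B →L[ℂ] B} (h : HasSum T R)
    (S : A →L[ℂ] A) : HasSum (fun i => opTensor S (T i)) (opTensor S R) :=
  h.mapL (LinearMap.mkContinuous (E := B →L[ℂ] B) (F := HTensor A B →L[ℂ] HTensor A B)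
    ({ toFun := fun T => opTensor S T
       map_add' := fun T T' => opTensor_add_right S T T'
       map_smul' := fun c T => opTensor_smul_right c S T } :
        (B →L[ℂ] B) →ₗ[ℂ] (HTensor A B →L[ℂ] HTensor A B)) ‖S‖ fun T => norm_opTensor_le S T)

theorem hasSum_tensorState_left {ι : Type*} {T : ι → HTensor A B →L[ℂ] HTensor A B}
    {ρ : HTensor A B →L[ℂ] HTensor A B} (h : HasSum T ρ) (σ : HTensor C D →L[ℂ] HTensor C D) :
    HasSum (fun i => tensorState (T i) σ) (tensorState ρ σ) :=
  hasSum_conj _ (hasSum_opTensor_left h σ)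

theorem hasSum_tensorState_right {ι : Type*} {T : ι → HTensor C D →L[ℂ] HTensor C D}
    {σ : HTensor C D →L[ℂ] HTensor C D} (h : HasSum T σ) (ρ : HTensor A B →L[ℂ] HTensor A B) :
    HasSum (fun i => tensorState ρ (T i)) (tensorState ρ σ) :=
  hasSum_conj _ (hasSum_opTensor_right h ρ)

theorem tensorState_smul_smul (c d : ℂ) (ρ : HTensor A B →L[ℂ] HTensor A B)
    (σ : HTensor C D →L[ℂ] HTensor C D) :
    tensorState (c • ρ) (d • σ) = (c * d) • tensorState ρ σ := by
  rw [tensorState, opTensor_smul_left, opTensor_smul_right, smul_smul, conj_smul, tensorState]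

theorem opTensor_ketbra (ψ : A) (φ : B) :
    opTensor (ketbra ψ) (ketbra φ) = ketbra (tmul ψ φ) := by
  refine HTensor.ext fun a b => ?_
  rw [opTensor_tmul, ketbra_apply, ketbra_apply, ketbra_apply, inner_tmul_tmul, tmul_smul_left,
    tmul_smul_right, smul_smul]

theorem tensorState_ketbra (ψ : HTensor A B) (φ : HTensor C D) :
    tensorState (ketbra ψ) (ketbra φ) = ketbra (shuffleU A B C D (tmul ψ φ)) := by
  rw [tensorState, opTensor_ketbra, conj_ketbra]

/-- Convex decompositions of two states give one of their tensor product. -/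
theorem hasSum_tensorState {ι κ : Type*} {p : ι → ℝ} {q : κ → ℝ} (hp0 : ∀ x, 0 ≤ p x)
    (hq0 : ∀ y, 0 ≤ q y) (hp : Summable p) (hq : Summable q) {ψ : ι → HTensor A B}
    {φ : κ → HTensor C D} (hψ : ∀ x, ‖ψ x‖ = 1) (hφ : ∀ y, ‖φ y‖ = 1)
    {ρ : HTensor A B →L[ℂ] HTensor A B} {σ : HTensor C D →L[ℂ] HTensor C D}
    (hρ : HasSum (fun x => (p x : ℂ) • ketbra (ψ x)) ρ)
    (hσ : HasSum (fun y => (q y : ℂ) • ketbra (φ y)) σ) :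
    HasSum (fun z : ι × κ => ((p z.1 * q z.2 : ℝ) : ℂ) •
      ketbra (shuffleU A B C D (tmul (ψ z.1) (φ z.2)))) (tensorState ρ σ) := by
  have hs : Summable fun z : ι × κ => ((p z.1 * q z.2 : ℝ) : ℂ) •
      ketbra (shuffleU A B C D (tmul (ψ z.1) (φ z.2))) := by
    refine Summable.of_norm ?_
    refine (hp.mul_of_nonneg hq hp0 hq0).congr fun z => ?_
    rw [norm_smul, norm_ketbra, LinearIsometryEquiv.norm_map, norm_tmul, hψ, hφ, Complex.norm_real,
      Real.norm_of_nonneg (mul_nonneg (hp0 _) (hq0 _))]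
    simp
  obtain ⟨R, hR⟩ := hs
  have h1 : ∀ x, HasSum (fun y => ((p x * q y : ℝ) : ℂ) •
      ketbra (shuffleU A B C D (tmul (ψ x) (φ y)))) (tensorState ((p x : ℂ) • ketbra (ψ x)) σ) := by
    intro x
    refine hasSum_of_eq (hasSum_tensorState_right hσ _) fun y => ?_
    rw [tensorState_smul_smul, tensorState_ketbra, Complex.ofReal_mul]
  have h2 := hR.prod_fiberwise h1
  rwa [h2.unique (hasSum_tensorState_left hρ σ)] at hR

theorem coef_shuffle (a : A) (c : C) (ψ : HTensor A B) (φ : HTensor C D) :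
    coef (tmul a c) (shuffleU A B C D (tmul ψ φ)) = tmul (coef a ψ) (coef c φ) := by
  symm
  refine HTensor.ext_inner fun b d => ?_
  rw [inner_tmul_tmul, ← inner_conj_symm _ (tmul b d), inner_coef, ← shuffleU_tmul,
    LinearIsometryEquiv.inner_map_map, inner_tmul_tmul, map_mul, inner_conj_symm, inner_conj_symm,
    ← inner_conj_symm _ b, inner_coef, inner_conj_symm, ← inner_conj_symm _ d, inner_coef,
    inner_conj_symm]

theorem coef_tensorU (U : A ≃ₗᵢ[ℂ] C) (V : B ≃ₗᵢ[ℂ] D) (a : A) (ψ : HTensor A B) :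
    coef (U a) (tensorU U V ψ) = V (coef a ψ) := by
  refine ext_inner_left ℂ fun d => ?_
  obtain ⟨b, rfl⟩ := V.surjective d
  rw [inner_coef, ← tensorU_tmul, LinearIsometryEquiv.inner_map_map,
    LinearIsometryEquiv.inner_map_map, inner_coef]

end TensorStates

/-! ### Tensor powers of a state -/

section Powers

/-- The tensor product with a state of one-dimensional systems changes nothing. -/
theorem conj_tensorState_one {A B E F : Type*}
    [NormedAddCommGroup A] [InnerProductSpace ℂ A] [CompleteSpace A]
    [NormedAddCommGroup B] [InnerProductSpace ℂ B] [CompleteSpace B]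
    [NormedAddCommGroup E] [InnerProductSpace ℂ E] [CompleteSpace E]
    [NormedAddCommGroup F] [InnerProductSpace ℂ F] [CompleteSpace F]
    {e : E} {f : F} {U : HTensor E A ≃ₗᵢ[ℂ] A} {V : HTensor F B ≃ₗᵢ[ℂ] B}
    (hU : ∀ a, U (tmul e a) = a) (hV : ∀ b, V (tmul f b) = b)
    (σ : HTensor A B →L[ℂ] HTensor A B) :
    conj (tensorU U V) (tensorState (1 : HTensor E F →L[ℂ] HTensor E F) σ) = σ := by
  set W := (shuffleU E F A B).trans (tensorU U V) with hW
  have h1 : ∀ x, W (tmul (tmul e f) x) = x := by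
    have : (W : _ →L[ℂ] HTensor A B) ∘L tmulLeft (B := HTensor A B) (tmul e f) =
        ContinuousLinearMap.id ℂ _ := by
      refine HTensor.ext fun a b => ?_
      change W (tmul (tmul e f) (tmul a b)) = tmul a b
      rw [hW, LinearIsometryEquiv.trans_apply, shuffleU_tmul, tensorU_tmul, hU, hV]
    exact fun x => congrArg (fun k : HTensor A B →L[ℂ] HTensor A B => k x) this
  rw [tensorState, conj_conj, ← hW]
  ext x
  have h2 : W.symm x = tmul (tmul e f) x := by rw [LinearIsometryEquiv.symm_apply_eq, h1]
  rw [conj_apply, h2, opTensor_tmul, one_apply_eq_self, h1]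

/-- The unit vector of the empty tensor power. -/
def vacuum : EuclideanSpace ℂ PUnit.{u + 1} := EuclideanSpace.single PUnit.unit 1

theorem norm_vacuum : ‖vacuum.{u}‖ = 1 := by simp [vacuum]

theorem eq_smul_vacuum (x : EuclideanSpace ℂ PUnit.{u + 1}) : ∃ c : ℂ, x = c • vacuum := by
  refine ⟨x PUnit.unit, ?_⟩
  ext i
  simp [vacuum]

/-- The unitary `A^a ⊗ A^b → A^(b + a)`. -/
def powAdd (A : HilbertSpace.{u}) : (a b : ℕ) → HTensor (A.pow a) (A.pow b) ≃ₗᵢ[ℂ] A.pow (b + a)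
  | 0, b => (exists_leftUnitor vacuum.{u} norm_vacuum eq_smul_vacuum (A.pow b)).choose
  | a + 1, b => (assoc A (A.pow a) (A.pow b)).trans
      (tensorU (LinearIsometryEquiv.refl ℂ A) (powAdd A a b))

/-- The powers of `ρ` are multiplicative up to local unitaries. -/
theorem opPow_add {A B : HilbertSpace.{u}} (ρ : HTensor A B →L[ℂ] HTensor A B) (a b : ℕ) :
    opPow ρ (b + a) =
      conj (tensorU (powAdd A a b) (powAdd B a b)) (tensorState (opPow ρ a) (opPow ρ b)) := by
  induction a with
  | zero =>
    exact (conj_tensorState_one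
      (exists_leftUnitor vacuum.{u} norm_vacuum eq_smul_vacuum (A.pow b)).choose_spec
      (exists_leftUnitor vacuum.{u} norm_vacuum eq_smul_vacuum (B.pow b)).choose_spec
      (opPow ρ b)).symm
  | succ a ih =>
    have h1 : opPow ρ (b + (a + 1)) = tensorState ρ (opPow ρ (b + a)) := tensorState_eq _ _
    have h2 : opPow ρ (a + 1) = tensorState ρ (opPow ρ a) := tensorState_eq _ _
    rw [h1, h2, ih]
    exact (tensorState_assoc (powAdd A a b) (powAdd B a b) ρ (opPow ρ a) (opPow ρ b)).symm

end Powers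

/-! ### Schmidt ensembles -/

section Ensembles

/-- A countable convex decomposition of `ρ` into pure states `ψₓ`, together with a Schmidt basis of
each `ψₓ`: an orthonormal basis `(aⱼ)` of `A` for which the vectors `(⟨aⱼ| ⊗ 1) ψₓ` are pairwise
orthogonal. -/
structure SchmidtEnsemble {A B : Type u} [NormedAddCommGroup A] [InnerProductSpace ℂ A]
    [CompleteSpace A] [NormedAddCommGroup B] [InnerProductSpace ℂ B] [CompleteSpace B]
    (ρ : HTensor A B →L[ℂ] HTensor A B) where
  I : Type
  countable : Countable I
  J : I → Type u
  p : I → ℝ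
  p_nonneg : ∀ x, 0 ≤ p x
  hasSum_p : HasSum p 1
  ψ : I → HTensor A B
  norm_ψ : ∀ x, ‖ψ x‖ = 1
  hasSum : HasSum (fun x => (p x : ℂ) • ketbra (ψ x)) ρ
  a : ∀ x, HilbertBasis (J x) ℂ A
  orth : ∀ x, Pairwise fun i j => ⟪coef (a x i) (ψ x), coef (a x j) (ψ x)⟫_ℂ = 0

namespace SchmidtEnsemble

variable {A B C D : Type u}
  [NormedAddCommGroup A] [InnerProductSpace ℂ A] [CompleteSpace A]
  [NormedAddCommGroup B] [InnerProductSpace ℂ B] [CompleteSpace B]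
  [NormedAddCommGroup C] [InnerProductSpace ℂ C] [CompleteSpace C]
  [NormedAddCommGroup D] [InnerProductSpace ℂ D] [CompleteSpace D]
  {ρ : HTensor A B →L[ℂ] HTensor A B} {σ : HTensor C D →L[ℂ] HTensor C D}

/-- The pairs of a label of the ensemble and an index of the Schmidt basis. -/
abbrev Idx (E : SchmidtEnsemble ρ) : Type u := Σ x : E.I, E.J x

/-- The squared Schmidt coefficients. -/
def lam (E : SchmidtEnsemble ρ) (z : E.Idx) : ℝ := ‖coef (E.a z.1 z.2) (E.ψ z.1)‖ ^ 2

/-- The joint distribution of the label and the Schmidt index. -/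
def w (E : SchmidtEnsemble ρ) (z : E.Idx) : ℝ := E.p z.1 * E.lam z

/-- The average entropy of the Schmidt coefficients. -/
def mean (E : SchmidtEnsemble ρ) : ℝ≥0∞ := ∑' z : E.Idx, ENNReal.ofReal (E.p z.1 * eta (E.lam z))

theorem lam_nonneg (E : SchmidtEnsemble ρ) (z : E.Idx) : 0 ≤ E.lam z := sq_nonneg _

theorem w_nonneg (E : SchmidtEnsemble ρ) (z : E.Idx) : 0 ≤ E.w z :=
  mul_nonneg (E.p_nonneg _) (E.lam_nonneg z)

theorem hasSum_lam (E : SchmidtEnsemble ρ) (x : E.I) : HasSum (fun j => E.lam ⟨x, j⟩) 1 := by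
  have h := tsum_enorm_coef_sq (E.a x) (E.ψ x)
  simp_rw [enorm_sq_eq_ofReal, E.norm_ψ] at h
  have h1 : ∑' j, ENNReal.ofReal (E.lam ⟨x, j⟩) = 1 := h.trans (by simp)
  have h2 : Summable fun j => E.lam ⟨x, j⟩ := by
    refine (ENNReal.summable_toReal (f := fun j => ENNReal.ofReal (E.lam ⟨x, j⟩))
      (by rw [h1]; simp)).congr fun j => ?_
    rw [ENNReal.toReal_ofReal (E.lam_nonneg _)]
  rw [← ENNReal.ofReal_tsum_of_nonneg (fun j => E.lam_nonneg _) h2] at h1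
  have h3 := h2.hasSum
  rwa [ENNReal.ofReal_eq_one.1 h1] at h3

theorem lam_le_one (E : SchmidtEnsemble ρ) (z : E.Idx) : E.lam z ≤ 1 :=
  le_hasSum (E.hasSum_lam z.1) z.2 fun _ _ => E.lam_nonneg _

theorem hasSum_w (E : SchmidtEnsemble ρ) : HasSum E.w 1 := by
  have h1 : ∀ x, HasSum (fun j => E.w ⟨x, j⟩) (E.p x) := fun x => by
    simpa [w] using (E.hasSum_lam x).mul_left (E.p x)
  have h2 : Summable E.w := by
    refine (summable_sigma_of_nonneg fun z => E.w_nonneg z).2 ⟨fun x => (h1 x).summable, ?_⟩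
    exact E.hasSum_p.summable.congr fun x => (h1 x).tsum_eq.symm
  have h3 := h2.hasSum.sigma h1
  rw [← h3.unique E.hasSum_p]
  exact h2.hasSum

/-- Any Schmidt ensemble bounds the entanglement of formation, since the entropies of its Schmidt
coefficients bound those of the reduced states. -/
theorem entanglementOfFormation_le_mean (E : SchmidtEnsemble ρ) :
    entanglementOfFormation ρ ≤ E.mean := by
  have := E.countable
  have hp : HasSum (fun x => (E.p x).toNNReal) 1 := by
    rw [← NNReal.hasSum_coe]
    exact hasSum_of_eq E.hasSum_p fun x => (Real.coe_toNNReal _ (E.p_nonneg x)).symm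
  refine (entanglementOfFormation_le_tsum E.norm_ψ hp (hasSum_of_eq E.hasSum fun x => by
    rw [Real.coe_toNNReal _ (E.p_nonneg x)])).trans ?_
  rw [mean, ENNReal.tsum_sigma']
  refine ENNReal.tsum_le_tsum fun x => ?_
  simp_rw [ENNReal.ofReal_mul (E.p_nonneg x)]
  rw [ENNReal.tsum_mul_left]
  exact mul_le_mul_right (entropy_ketbra_le_tsum (E.a x) (E.norm_ψ x)) _

theorem exists_mean_lt {c : ℝ≥0∞} (h : entanglementOfFormation ρ < c) :
    ∃ E : SchmidtEnsemble ρ, E.mean < c := by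
  simp only [entanglementOfFormation, iInf_lt_iff] at h
  obtain ⟨p, ψ, hdec, hlt⟩ := h
  choose J b horth hS using fun x => exists_schmidt_basis (hdec.norm_eq_one x)
  refine ⟨⟨ℕ, inferInstance, J, fun x => p x, fun x => (p x).coe_nonneg, ?_, ψ, hdec.norm_eq_one,
    hdec.hasSum, b, horth⟩, ?_⟩
  · rw [← NNReal.coe_one]
    exact NNReal.hasSum_coe.2 hdec.hasSum_one
  · refine lt_of_eq_of_lt ?_ hlt
    rw [mean, ENNReal.tsum_sigma']
    refine tsum_congr fun x => ?_
    rw [hS, ← ENNReal.tsum_mul_left]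
    refine tsum_congr fun j => ?_
    exact (ENNReal.ofReal_mul (p x).coe_nonneg).trans
      (congrArg (· * _) ENNReal.ofReal_coe_nnreal)

/-- The image of an ensemble under a local unitary. -/
def map (E : SchmidtEnsemble ρ) (U : A ≃ₗᵢ[ℂ] C) (V : B ≃ₗᵢ[ℂ] D) :
    SchmidtEnsemble (conj (tensorU U V) ρ) where
  I := E.I
  countable := E.countable
  J := E.J
  p := E.p
  p_nonneg := E.p_nonneg
  hasSum_p := E.hasSum_p
  ψ x := tensorU U V (E.ψ x)
  norm_ψ x := by rw [LinearIsometryEquiv.norm_map, E.norm_ψ]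
  hasSum := hasSum_of_eq (hasSum_conj _ E.hasSum) fun x => by rw [conj_smul, conj_ketbra]
  a x := mapBasis (E.a x) U
  orth x i j hij := by
    beta_reduce
    rw [mapBasis_apply, mapBasis_apply, coef_tensorU, coef_tensorU,
      LinearIsometryEquiv.inner_map_map]
    exact E.orth x hij

theorem lam_map (E : SchmidtEnsemble ρ) (U : A ≃ₗᵢ[ℂ] C) (V : B ≃ₗᵢ[ℂ] D) (z : E.Idx) :
    (E.map U V).lam z = E.lam z := by
  change ‖coef (mapBasis (E.a z.1) U z.2) (tensorU U V (E.ψ z.1))‖ ^ 2 = _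
  rw [mapBasis_apply, coef_tensorU, LinearIsometryEquiv.norm_map, lam]

/-- The product of two ensembles. -/
def tensor (E : SchmidtEnsemble ρ) (E' : SchmidtEnsemble σ) :
    SchmidtEnsemble (tensorState ρ σ) where
  I := E.I × E'.I
  countable := by
    have := E.countable
    have := E'.countable
    infer_instance
  J x := E.J x.1 × E'.J x.2
  p x := E.p x.1 * E'.p x.2
  p_nonneg x := mul_nonneg (E.p_nonneg _) (E'.p_nonneg _)
  hasSum_p := by
    have := E.hasSum_p.mul E'.hasSum_p
      (E.hasSum_p.summable.mul_of_nonneg E'.hasSum_p.summable E.p_nonneg E'.p_nonneg)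
    rwa [one_mul] at this
  ψ x := shuffleU A B C D (tmul (E.ψ x.1) (E'.ψ x.2))
  norm_ψ x := by rw [LinearIsometryEquiv.norm_map, norm_tmul, E.norm_ψ, E'.norm_ψ, one_mul]
  hasSum := hasSum_tensorState E.p_nonneg E'.p_nonneg E.hasSum_p.summable E'.hasSum_p.summable
    E.norm_ψ E'.norm_ψ E.hasSum E'.hasSum
  a x := productBasis (E.a x.1) (E'.a x.2)
  orth x i j hij := by
    beta_reduce
    rw [productBasis_apply, productBasis_apply, coef_shuffle, coef_shuffle, inner_tmul_tmul,
      mul_eq_zero]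
    by_cases h : i.1 = j.1
    · exact Or.inr (E'.orth x.2 fun h' => hij (Prod.ext h h'))
    · exact Or.inl (E.orth x.1 h)

/-- The indices of a product ensemble are the pairs of indices. -/
def idxEquiv (E : SchmidtEnsemble ρ) (E' : SchmidtEnsemble σ) :
    (E.tensor E').Idx ≃ E.Idx × E'.Idx where
  toFun z := (⟨z.1.1, z.2.1⟩, ⟨z.1.2, z.2.2⟩)
  invFun z := ⟨(z.1.1, z.2.1), (z.1.2, z.2.2)⟩
  left_inv _ := rfl
  right_inv _ := rfl

theorem lam_tensor (E : SchmidtEnsemble ρ) (E' : SchmidtEnsemble σ) (z : (E.tensor E').Idx) :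
    (E.tensor E').lam z = E.lam (E.idxEquiv E' z).1 * E'.lam (E.idxEquiv E' z).2 := by
  have h : ∀ {ι κ : Type u} (b : HilbertBasis ι ℂ A) (c : HilbertBasis κ ℂ C) (k : ι × κ)
      (ψ : HTensor A B) (φ : HTensor C D),
      ‖coef (productBasis b c k) (shuffleU A B C D (tmul ψ φ))‖ ^ 2 =
        ‖coef (b k.1) ψ‖ ^ 2 * ‖coef (c k.2) φ‖ ^ 2 := by
    intro ι κ b c k ψ φ
    rw [productBasis_apply, coef_shuffle, norm_tmul, mul_pow]
  exact h (E.a z.1.1) (E'.a z.1.2) z.2 (E.ψ z.1.1) (E'.ψ z.1.2)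

theorem w_tensor (E : SchmidtEnsemble ρ) (E' : SchmidtEnsemble σ) (z : (E.tensor E').Idx) :
    (E.tensor E').w z = E.w (E.idxEquiv E' z).1 * E'.w (E.idxEquiv E' z).2 := by
  rw [w, lam_tensor, w, w]
  change E.p z.1.1 * E'.p z.1.2 * _ = E.p z.1.1 * _ * (E'.p z.1.2 * _)
  ring

theorem eta_mul (x y : ℝ) : eta (x * y) = y * eta x + x * eta y := by
  rw [eta, eta, eta]
  rcases eq_or_ne x 0 with rfl | hx
  · simp
  rcases eq_or_ne y 0 with rfl | hy
  · simp
  rw [Real.logb_mul hx hy]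
  ring

/-- Entropies are additive under tensor products. -/
theorem mean_tensor (E : SchmidtEnsemble ρ) (E' : SchmidtEnsemble σ) :
    (E.tensor E').mean = E.mean + E'.mean := by
  have hw : ∀ {A B : Type u} [NormedAddCommGroup A] [InnerProductSpace ℂ A]
      [CompleteSpace A] [NormedAddCommGroup B] [InnerProductSpace ℂ B] [CompleteSpace B]
      {ρ : HTensor A B →L[ℂ] HTensor A B} (E : SchmidtEnsemble ρ),
      ∑' z, ENNReal.ofReal (E.w z) = 1 := by
    intro A B _ _ _ _ _ _ ρ E
    rw [← ENNReal.ofReal_tsum_of_nonneg E.w_nonneg E.hasSum_w.summable, E.hasSum_w.tsum_eq,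
      ENNReal.ofReal_one]
  -- `f` is kept opaque so that the sum can be moved along `idxEquiv` without unfolding it
  obtain ⟨f, hf⟩ : ∃ f : E.Idx × E'.Idx → ℝ≥0∞, f = fun y =>
      ENNReal.ofReal (E.p y.1.1 * eta (E.lam y.1)) * ENNReal.ofReal (E'.w y.2) +
        ENNReal.ofReal (E.w y.1) * ENNReal.ofReal (E'.p y.2.1 * eta (E'.lam y.2)) := ⟨_, rfl⟩
  have h : ∀ z, ENNReal.ofReal ((E.tensor E').p z.1 * eta ((E.tensor E').lam z)) =
      f (E.idxEquiv E' z) := by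
    intro z
    have h1 := eta_nonneg (E.lam_nonneg (E.idxEquiv E' z).1) (E.lam_le_one _)
    have h2 := eta_nonneg (E'.lam_nonneg (E.idxEquiv E' z).2) (E'.lam_le_one _)
    have h3 := E.w_nonneg (E.idxEquiv E' z).1
    have h4 := E'.w_nonneg (E.idxEquiv E' z).2
    have h5 := E.p_nonneg (E.idxEquiv E' z).1.1
    have h6 := E'.p_nonneg (E.idxEquiv E' z).2.1
    rw [hf]
    dsimp only
    rw [← ENNReal.ofReal_mul (by positivity), ← ENNReal.ofReal_mul (by positivity),
      ← ENNReal.ofReal_add (by positivity) (by positivity), lam_tensor, eta_mul, w, w]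
    congr 1
    change E.p (E.idxEquiv E' z).1.1 * E'.p (E.idxEquiv E' z).2.1 * _ = _
    ring
  rw [mean, tsum_congr h, (E.idxEquiv E').tsum_eq f, hf, ENNReal.tsum_add, ENNReal.tsum_prod',
    ENNReal.tsum_prod']
  simp_rw [ENNReal.tsum_mul_left, hw, mul_one, ENNReal.tsum_mul_right, hw, one_mul]
  rfl

end SchmidtEnsemble

variable {A B C D : Type u}
  [NormedAddCommGroup A] [InnerProductSpace ℂ A] [CompleteSpace A]
  [NormedAddCommGroup B] [InnerProductSpace ℂ B] [CompleteSpace B]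
  [NormedAddCommGroup C] [InnerProductSpace ℂ C] [CompleteSpace C]
  [NormedAddCommGroup D] [InnerProductSpace ℂ D] [CompleteSpace D]

/-- Products of ensembles show that the entanglement of formation is subadditive. -/
theorem entanglementOfFormation_tensorState_le (ρ : HTensor A B →L[ℂ] HTensor A B)
    (σ : HTensor C D →L[ℂ] HTensor C D) :
    entanglementOfFormation (tensorState ρ σ) ≤
      entanglementOfFormation ρ + entanglementOfFormation σ := by
  refine ENNReal.le_of_forall_pos_le_add fun ε hε hfin => ?_
  have hε2 : (0 : ℝ≥0∞) < (ε / 2 : ℝ≥0) := by exact_mod_cast half_pos hε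
  obtain ⟨E, hE⟩ := SchmidtEnsemble.exists_mean_lt
    (ENNReal.lt_add_right (ENNReal.add_lt_top.1 hfin).1.ne hε2.ne')
  obtain ⟨E', hE'⟩ := SchmidtEnsemble.exists_mean_lt
    (ENNReal.lt_add_right (ENNReal.add_lt_top.1 hfin).2.ne hε2.ne')
  refine ((E.tensor E').entanglementOfFormation_le_mean).trans ?_
  rw [E.mean_tensor E']
  refine (add_le_add hE.le hE'.le).trans_eq ?_
  have : (ε : ℝ≥0∞) = (ε / 2 : ℝ≥0) + (ε / 2 : ℝ≥0) := by
    rw [← ENNReal.coe_add, add_halves]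
  rw [this]
  ring

theorem entanglementOfFormation_conj_le (U : A ≃ₗᵢ[ℂ] C) (V : B ≃ₗᵢ[ℂ] D)
    (ρ : HTensor A B →L[ℂ] HTensor A B) :
    entanglementOfFormation (conj (tensorU U V) ρ) ≤ entanglementOfFormation ρ := by
  refine le_of_forall_gt fun c hc => ?_
  obtain ⟨E, hE⟩ := SchmidtEnsemble.exists_mean_lt hc
  refine ((E.map U V).entanglementOfFormation_le_mean).trans_lt (lt_of_eq_of_lt ?_ hE)
  exact tsum_congr fun z : E.Idx =>
    congrArg (fun t => ENNReal.ofReal (E.p z.1 * eta t)) (E.lam_map U V z)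

end Ensembles

/-! ### Subadditivity and the regularized entanglement of formation -/

section Regularization

variable {A B : HilbertSpace.{u}}

theorem entanglementOfFormation_opPow_add_le (ρ : HTensor A B →L[ℂ] HTensor A B) (a b : ℕ) :
    entanglementOfFormation (opPow ρ (a + b)) ≤
      entanglementOfFormation (opPow ρ a) + entanglementOfFormation (opPow ρ b) := by
  rw [opPow_add ρ b a, add_comm (entanglementOfFormation (opPow ρ a))]
  exact (entanglementOfFormation_conj_le _ _ _).trans (entanglementOfFormation_tensorState_le _ _)

theorem ketbra_tmul_eq_one {E F : Type*} [NormedAddCommGroup E] [InnerProductSpace ℂ E]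
    [CompleteSpace E] [NormedAddCommGroup F] [InnerProductSpace ℂ F] [CompleteSpace F]
    {e : E} {f : F} (he : ‖e‖ = 1) (hf : ‖f‖ = 1) (he' : ∀ x : E, ∃ c : ℂ, x = c • e)
    (hf' : ∀ y : F, ∃ c : ℂ, y = c • f) : ketbra (tmul e f) = 1 := by
  refine HTensor.ext fun x y => ?_
  obtain ⟨c, rfl⟩ := he' x
  obtain ⟨d, rfl⟩ := hf' y
  rw [tmul_smul_left, tmul_smul_right, map_smul, map_smul, ketbra_apply, inner_tmul_tmul,
    inner_self_eq_norm_sq_to_K, inner_self_eq_norm_sq_to_K, he, hf]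
  simp

/-- The only state of the empty system is a product state. -/
def SchmidtEnsemble.empty (ρ : HTensor A B →L[ℂ] HTensor A B) : SchmidtEnsemble (opPow ρ 0) where
  I := Unit
  countable := inferInstance
  J _ := PUnit
  p _ := 1
  p_nonneg _ := zero_le_one
  hasSum_p := hasSum_unique _
  ψ _ := tmul vacuum vacuum
  norm_ψ _ := (norm_tmul vacuum vacuum).trans (by rw [norm_vacuum, one_mul])
  hasSum := by
    have h : ketbra (tmul vacuum.{u} vacuum.{u}) = 1 :=
      ketbra_tmul_eq_one norm_vacuum norm_vacuum eq_smul_vacuum eq_smul_vacuum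
    have h1 : HasSum (fun _ : Unit => ((1 : ℝ) : ℂ) • ketbra (tmul vacuum.{u} vacuum.{u})) 1 := by
      rw [h, Complex.ofReal_one, one_smul]
      exact hasSum_unique _
    exact h1
  a _ := (EuclideanSpace.basisFun PUnit.{u + 1} ℂ).toHilbertBasis
  orth _ i j h := (h (Subsingleton.elim i j)).elim

theorem entanglementOfFormation_opPow_lt_top {ρ : HTensor A B →L[ℂ] HTensor A B}
    (h : entanglementOfFormation ρ < ∞) (n : ℕ) : entanglementOfFormation (opPow ρ n) < ∞ := by
  induction n with
  | zero =>
    refine (SchmidtEnsemble.empty ρ).entanglementOfFormation_le_mean.trans_lt ?_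
    rw [SchmidtEnsemble.mean, ENNReal.tsum_sigma']
    have : Unique (SchmidtEnsemble.empty ρ).I := inferInstanceAs (Unique Unit)
    have : ∀ x, Unique ((SchmidtEnsemble.empty ρ).J x) := fun _ => inferInstanceAs (Unique PUnit)
    rw [tsum_fintype]
    simp_rw [tsum_fintype]
    simp
  | succ n ih =>
    have h1 : opPow ρ (n + 1) = tensorState ρ (opPow ρ n) := tensorState_eq _ _
    rw [h1]
    exact (entanglementOfFormation_tensorState_le _ _).trans_lt (ENNReal.add_lt_top.2 ⟨h, ih⟩)

/-- Fekete's lemma for the entanglement of formation. -/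
theorem tendsto_regularizedEoF {ρ : HTensor A B →L[ℂ] HTensor A B}
    (h : entanglementOfFormation ρ < ∞) :
    Tendsto (fun n : ℕ => entanglementOfFormation (opPow ρ n) / n) atTop
      (𝓝 (regularizedEoF ρ)) := by
  have hfin := entanglementOfFormation_opPow_lt_top h
  set e : ℕ → ℝ := fun n => (entanglementOfFormation (opPow ρ n)).toReal with he
  have hsub : Subadditive e := by
    intro m n
    rw [he, ← ENNReal.toReal_add (hfin m).ne (hfin n).ne]
    exact ENNReal.toReal_mono (ENNReal.add_ne_top.2 ⟨(hfin m).ne, (hfin n).ne⟩)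
      (entanglementOfFormation_opPow_add_le ρ m n)
  have hdiv : ∀ n : ℕ, 1 ≤ n → entanglementOfFormation (opPow ρ n) / n =
      ENNReal.ofReal (e n / n) := by
    intro n hn
    rw [ENNReal.ofReal_div_of_pos (by exact_mod_cast hn), ENNReal.ofReal_toReal (hfin n).ne,
      ENNReal.ofReal_natCast]
  refine tendsto_order.2 ⟨fun c hc => ?_, fun c hc => ?_⟩
  · filter_upwards [eventually_ge_atTop 1] with n hn
    exact hc.trans_le (iInf₂_le n hn)
  · simp only [regularizedEoF, iInf_lt_iff] at hc
    obtain ⟨m, hm, hlt⟩ := hc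
    obtain ⟨d, hd1, hd2⟩ := exists_between hlt
    rw [hdiv m hm, ENNReal.ofReal_lt_iff_lt_toReal (by positivity) (hd2.trans_le le_top).ne] at hd1
    filter_upwards [hsub.eventually_div_lt_of_div_lt (by omega) hd1, eventually_ge_atTop 1]
      with n hn hn1
    rw [hdiv n hn1]
    refine lt_of_le_of_lt ?_ hd2
    rw [← ENNReal.ofReal_toReal (hd2.trans_le le_top).ne]
    exact ENNReal.ofReal_le_ofReal hn.le

end Regularization

/-! ### Typical Schmidt coefficients -/

section Typicality

variable {A B C D : Type u}
  [NormedAddCommGroup A] [InnerProductSpace ℂ A] [CompleteSpace A]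
  [NormedAddCommGroup B] [InnerProductSpace ℂ B] [CompleteSpace B]
  [NormedAddCommGroup C] [InnerProductSpace ℂ C] [CompleteSpace C]
  [NormedAddCommGroup D] [InnerProductSpace ℂ D] [CompleteSpace D]
  {ρ : HTensor A B →L[ℂ] HTensor A B} {σ : HTensor C D →L[ℂ] HTensor C D}

/-- `ρ` has a Schmidt ensemble whose information content `-log₂ λ` is bounded by `μ + g + h`, where
`g` is centred with variance `V` and `h` is nonnegative with mean `η`. -/
def HasInfoBound (ρ : HTensor A B →L[ℂ] HTensor A B) (μ V η : ℝ) : Prop :=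
  ∃ (E : SchmidtEnsemble ρ) (g h : E.Idx → ℝ), (∀ z, 0 ≤ h z) ∧
    (∀ z, E.w z ≠ 0 → -Real.logb 2 (E.lam z) ≤ μ + g z + h z) ∧
    HasSum (fun z => E.w z * g z) 0 ∧ HasSum (fun z => E.w z * g z ^ 2) V ∧
    HasSum (fun z => E.w z * h z) η

theorem hasSum_mul_prod {ι κ : Type*} {f : ι → ℝ} {g : κ → ℝ} {s t : ℝ} (hf : HasSum f s)
    (hg : HasSum g t) : HasSum (fun z : ι × κ => f z.1 * g z.2) (s * t) :=
  hf.mul hg (summable_mul_of_summable_norm hf.summable.norm hg.summable.norm)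

/-- Information contents add up, and so do the variances, since the centred parts are
independent under the product distribution. -/
theorem HasInfoBound.tensor {μ V η μ' V' η' : ℝ} (h : HasInfoBound ρ μ V η)
    (h' : HasInfoBound σ μ' V' η') :
    HasInfoBound (tensorState ρ σ) (μ + μ') (V + V') (η + η') := by
  obtain ⟨E, g, k, hk, hb, h1, h2, h3⟩ := h
  obtain ⟨E', g', k', hk', hb', h1', h2', h3'⟩ := h'
  have hw := E.hasSum_w
  have hw' := E'.hasSum_w
  refine ⟨E.tensor E', fun z => g (E.idxEquiv E' z).1 + g' (E.idxEquiv E' z).2,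
    fun z => k (E.idxEquiv E' z).1 + k' (E.idxEquiv E' z).2, fun z => add_nonneg (hk _) (hk' _),
    fun z hz => ?_, ?_, ?_, ?_⟩
  · rw [E.w_tensor] at hz
    have hz1 := left_ne_zero_of_mul hz
    have hz2 := right_ne_zero_of_mul hz
    rw [E.lam_tensor, Real.logb_mul (right_ne_zero_of_mul hz1) (right_ne_zero_of_mul hz2)]
    have := hb _ hz1
    have := hb' _ hz2
    linarith
  · have := (hasSum_mul_prod h1 hw').add (hasSum_mul_prod hw h1')
    rw [zero_mul, mul_zero, add_zero] at this
    refine hasSum_of_eq ((E.idxEquiv E').hasSum_iff.2 this) fun z => ?_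
    rw [E.w_tensor]
    simp only [Function.comp_apply]
    ring
  · have := ((hasSum_mul_prod h2 hw').add (hasSum_mul_prod hw h2')).add
      ((hasSum_mul_prod h1 h1').mul_left 2)
    rw [one_mul, mul_one, mul_zero, mul_zero, add_zero] at this
    refine hasSum_of_eq ((E.idxEquiv E').hasSum_iff.2 this) fun z => ?_
    rw [E.w_tensor]
    simp only [Function.comp_apply]
    ring
  · have := (hasSum_mul_prod h3 hw').add (hasSum_mul_prod hw h3')
    rw [one_mul, mul_one] at this
    refine hasSum_of_eq ((E.idxEquiv E').hasSum_iff.2 this) fun z => ?_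
    rw [E.w_tensor]
    simp only [Function.comp_apply]
    ring

theorem HasInfoBound.conj {μ V η : ℝ} (h : HasInfoBound ρ μ V η) (U : A ≃ₗᵢ[ℂ] C)
    (V' : B ≃ₗᵢ[ℂ] D) : HasInfoBound (conj (tensorU U V') ρ) μ V η := by
  obtain ⟨E, g, k, hk, hb, h1, h2, h3⟩ := h
  have hw : (E.map U V').w = E.w := funext fun z : E.Idx =>
    congrArg (fun t => E.p z.1 * t) (E.lam_map U V' z)
  have hl : (E.map U V').lam = E.lam := funext fun z : E.Idx => E.lam_map U V' z
  refine ⟨E.map U V', g, k, hk, ?_, ?_, ?_, ?_⟩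
  · rw [hw, hl]; exact hb
  · rw [hw]; exact h1
  · rw [hw]; exact h2
  · rw [hw]; exact h3

/-- The mean entropy of the ensemble is the expectation of the information content. -/
theorem SchmidtEnsemble.hasSum_info (E : SchmidtEnsemble ρ) (h : E.mean < ∞) :
    HasSum (fun z => E.w z * -Real.logb 2 (E.lam z)) E.mean.toReal := by
  have h0 : ∀ z, 0 ≤ E.p z.1 * eta (E.lam z) := fun z =>
    mul_nonneg (E.p_nonneg _) (eta_nonneg (E.lam_nonneg z) (E.lam_le_one z))
  have h1 : HasSum (fun z : E.Idx => E.p z.1 * eta (E.lam z)) E.mean.toReal := by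
    have hs : Summable fun z : E.Idx => E.p z.1 * eta (E.lam z) :=
      (ENNReal.summable_toReal h.ne).congr fun z => ENNReal.toReal_ofReal (h0 z)
    rw [SchmidtEnsemble.mean, ← ENNReal.ofReal_tsum_of_nonneg h0 hs,
      ENNReal.toReal_ofReal (tsum_nonneg h0)]
    exact hs.hasSum
  refine hasSum_of_eq h1 fun z => ?_
  rw [SchmidtEnsemble.w, eta]
  ring

theorem SchmidtEnsemble.info_nonneg (E : SchmidtEnsemble ρ) (z : E.Idx) :
    0 ≤ -Real.logb 2 (E.lam z) :=
  neg_nonneg.2 (Real.logb_nonpos (by norm_num) (E.lam_nonneg z) (E.lam_le_one z))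

/-- The bound without a variance part. -/
theorem SchmidtEnsemble.hasInfoBound_mean (E : SchmidtEnsemble ρ) (h : E.mean < ∞) :
    HasInfoBound ρ 0 0 E.mean.toReal :=
  ⟨E, 0, fun z => -Real.logb 2 (E.lam z), E.info_nonneg, fun z _ => by simp, by simp [hasSum_zero],
    by simp [hasSum_zero], E.hasSum_info h⟩

/-- The information content can be split into a part of finite variance and a part of small mean,
by truncation to finitely many indices; the variance of the information content itself may be
infinite. -/
theorem SchmidtEnsemble.exists_hasInfoBound (E : SchmidtEnsemble ρ) (h : E.mean < ∞) {ε : ℝ}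
    (hε : 0 < ε) : ∃ μ V η : ℝ, μ ≤ E.mean.toReal ∧ η ≤ ε ∧ HasInfoBound ρ μ V η := by
  classical
  set m := E.mean.toReal
  set f : E.Idx → ℝ := fun z => -Real.logb 2 (E.lam z) with hf
  have hs : HasSum (fun z => E.w z * f z) m := E.hasSum_info h
  have h0 : ∀ z, 0 ≤ E.w z * f z := fun z => mul_nonneg (E.w_nonneg z) (E.info_nonneg z)
  obtain ⟨F, hF⟩ := ((tendsto_order.1 hs).1 (m - ε) (by linarith)).exists
  set μ := ∑ z ∈ F, E.w z * f z with hμ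
  let g₀ : E.Idx → ℝ := fun z => if z ∈ F then f z else 0
  have hfin : ∀ k : E.Idx → ℝ, (∀ z ∉ F, k z = 0) → HasSum k (∑ z ∈ F, k z) := fun k hk =>
    hasSum_sum_of_ne_finset_zero hk
  have hg1 : HasSum (fun z => E.w z * g₀ z) μ := by
    have := hfin (fun z => E.w z * g₀ z) fun z hz => by simp [g₀, hz]
    convert! this using 1
    exact Finset.sum_congr rfl fun z hz => by simp [g₀, hz]
  have hg2 := hfin (fun z => E.w z * g₀ z ^ 2) fun z hz => by simp [g₀, hz]
  refine ⟨μ, ∑ z ∈ F, E.w z * g₀ z ^ 2 - 2 * μ * μ + μ ^ 2 * 1, m - μ,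
    sum_le_hasSum F (fun z _ => h0 z) hs, by linarith, E, fun z => g₀ z - μ,
    fun z => f z - g₀ z, fun z => ?_, fun z _ => ?_, ?_, ?_, ?_⟩
  · by_cases hz : z ∈ F
    · simp [g₀, hz]
    · simpa [g₀, hz] using (show 0 ≤ f z from E.info_nonneg z)
  · exact le_of_eq (by ring)
  · have := hg1.sub (E.hasSum_w.mul_left μ)
    rw [mul_one, sub_self] at this
    exact hasSum_of_eq this fun z => by ring
  · have := (hg2.sub (hg1.mul_left (2 * μ))).add (E.hasSum_w.mul_left (μ ^ 2))
    exact hasSum_of_eq this fun z => by ring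
  · exact hasSum_of_eq (hs.sub hg1) fun z => by ring

/-- The inequality of Chebyshev for the centred part and of Markov for the nonnegative part: if
`g + h > 2 t`, then `g > t` or `h ≥ t`. -/
theorem HasInfoBound.exists_typical {μ V η : ℝ} (h : HasInfoBound ρ μ V η) {t N : ℝ} (ht : 0 < t)
    (hN : μ + 2 * t ≤ N) :
    ∃ E : SchmidtEnsemble ρ, ∀ s : Finset E.Idx, (∀ z ∈ s, E.lam z < 2 ^ (-N)) →
      ∑ z ∈ s, E.w z ≤ V / t ^ 2 + η / t := by
  obtain ⟨E, g, k, hk, hb, h1, h2, h3⟩ := h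
  refine ⟨E, fun s hs => ?_⟩
  have hsum := (h2.div_const (t ^ 2)).add (h3.div_const t)
  refine le_trans (Finset.sum_le_sum fun z hz => ?_) (sum_le_hasSum s (fun z _ => ?_) hsum)
  · by_cases hw : E.w z = 0
    · rw [hw]; simp
    have hw0 : 0 < E.w z := lt_of_le_of_ne (E.w_nonneg z) (Ne.symm hw)
    have hlam : 0 < E.lam z := lt_of_le_of_ne (E.lam_nonneg z)
      (Ne.symm (right_ne_zero_of_mul hw))
    have h4 : Real.logb 2 (E.lam z) < -N :=
      (Real.logb_lt_iff_lt_rpow (by norm_num) hlam).2 (hs z hz)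
    have h5 := hb z hw
    have h6 : 2 * t < g z + k z := by linarith
    have key : 1 ≤ g z ^ 2 / t ^ 2 + k z / t := by
      rw [div_add_div _ _ (by positivity) ht.ne', le_div_iff₀ (by positivity)]
      have hkz := hk z
      rcases le_total t (k z) with h7 | h7
      · have : 0 ≤ g z ^ 2 * t := by positivity
        nlinarith [mul_le_mul_of_nonneg_left h7 (sq_nonneg t)]
      · have h8 : t ≤ g z := by linarith
        have h9 : t ^ 2 ≤ g z ^ 2 := by gcongr
        have : 0 ≤ t ^ 2 * k z := by positivity
        nlinarith
    calc E.w z = E.w z * 1 := (mul_one _).symm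
      _ ≤ E.w z * (g z ^ 2 / t ^ 2 + k z / t) := by gcongr
      _ = _ := by ring
  · have := E.w_nonneg z
    have := hk z
    positivity

end Typicality

/-! ### Typicality for tensor powers -/

section TypicalPowers

variable {A B : HilbertSpace.{u}}

/-- Bounds for `k` blocks of `m` copies and a remainder of `s` copies. -/
theorem HasInfoBound.opPow_add {ρ : HTensor A B →L[ℂ] HTensor A B} {m s : ℕ} {μ V η μ' V' η' : ℝ}
    (hm : HasInfoBound (opPow ρ m) μ V η) (hs : HasInfoBound (opPow ρ s) μ' V' η') (k : ℕ) :
    HasInfoBound (opPow ρ (s + k * m)) (k * μ + μ') (k * V + V') (k * η + η') := by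
  induction k with
  | zero =>
    have e : s + 0 * m = s := by omega
    rw [e]
    simpa using hs
  | succ k ih =>
    have e : s + (k + 1) * m = (s + k * m) + m := by ring
    rw [e, EntanglementCost.opPow_add ρ m (s + k * m)]
    have := (hm.tensor ih).conj (powAdd A m (s + k * m)) (powAdd B m (s + k * m))
    convert this using 1 <;> (push_cast; ring)

/-- Typicality: for `r` above the entanglement of formation per copy, all but a vanishing part of
the Schmidt weight of suitable ensembles of `ρ^{⊗n}` lies on coefficients that are at least
`2^{-⌊rn⌋}`. -/
theorem eventually_exists_typical {ρ : HTensor A B →L[ℂ] HTensor A B}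
    (hfin : entanglementOfFormation ρ < ∞) {r : ℝ} (hr0 : 0 < r)
    (hr : regularizedEoF ρ < ENNReal.ofReal r) {δ : ℝ} (hδ : 0 < δ) :
    ∀ᶠ n : ℕ in atTop, ∃ E : SchmidtEnsemble (opPow ρ n), ∀ s : Finset E.Idx,
      (∀ z ∈ s, E.lam z < 2 ^ (-(⌊r * n⌋₊ : ℝ))) → ∑ z ∈ s, E.w z ≤ δ := by
  simp only [regularizedEoF, iInf_lt_iff] at hr
  obtain ⟨m, hm, hlt⟩ := hr
  have hm0 : (0 : ℝ) < m := by exact_mod_cast hm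
  have hlt' : entanglementOfFormation (opPow ρ m) < ENNReal.ofReal (m * r) := by
    rw [mul_comm, ENNReal.ofReal_mul hr0.le, ENNReal.ofReal_natCast]
    exact (ENNReal.div_lt_iff (Or.inl (by exact_mod_cast hm0.ne')) (Or.inl (by simp))).1 hlt
  obtain ⟨E, hE⟩ := SchmidtEnsemble.exists_mean_lt hlt'
  have hEfin : E.mean < ∞ := hE.trans_le le_top
  have hE' : E.mean.toReal < m * r := by
    rwa [ENNReal.lt_ofReal_iff_toReal_lt hEfin.ne] at hE
  -- per block of `m` copies, two of the four parts `c` of the gap between the rate and the mean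
  -- pay for the deviation from the mean and two for rounding `r * n` down
  set c := (m * r - E.mean.toReal) / 4 with hc
  have hc0 : 0 < c := by rw [hc]; linarith
  obtain ⟨μ, V, η, hμ, hη, hbound⟩ := E.exists_hasInfoBound hEfin (ε := δ * c / 4) (by positivity)
  -- the fewer than `m` copies left over after division into blocks
  have hrem : ∀ s, ∃ ηs : ℝ, HasInfoBound (opPow ρ s) 0 0 ηs := by
    intro s
    obtain ⟨E', hE'⟩ := SchmidtEnsemble.exists_mean_lt (entanglementOfFormation_opPow_lt_top hfin s)
    exact ⟨_, E'.hasInfoBound_mean hE'⟩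
  choose ηs hηs using hrem
  obtain ⟨M, hM⟩ : ∃ M : ℝ, ∀ s < m, ηs s ≤ M := by
    obtain ⟨M, hM⟩ := ((Finset.range m).image ηs).bddAbove
    exact ⟨M, fun s hs => hM (by simpa using ⟨s, hs, rfl⟩)⟩
  have hlim : ∀ᶠ k : ℕ in atTop, 1 ≤ k ∧ (1 : ℝ) ≤ 2 * c * k ∧
      V / (c ^ 2 * k) ≤ δ / 4 ∧ M / (c * k) ≤ δ / 4 := by
    have hk : Tendsto (fun k : ℕ => (k : ℝ)) atTop atTop := tendsto_natCast_atTop_atTop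
    have h1 : Tendsto (fun k : ℕ => V / (c ^ 2 * k)) atTop (𝓝 0) :=
      (hk.const_mul_atTop (by positivity)).const_div_atTop V
    have h2 : Tendsto (fun k : ℕ => M / (c * k)) atTop (𝓝 0) :=
      (hk.const_mul_atTop hc0).const_div_atTop M
    have h3 : Tendsto (fun k : ℕ => 2 * c * (k : ℝ)) atTop atTop :=
      hk.const_mul_atTop (by positivity)
    filter_upwards [eventually_ge_atTop 1, h3.eventually_ge_atTop 1,
      h1.eventually_le_const (show (0 : ℝ) < δ / 4 by positivity),
      h2.eventually_le_const (show (0 : ℝ) < δ / 4 by positivity)] with k a1 a2 a3 a4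
    exact ⟨a1, a2, a3, a4⟩
  have hdiv : Tendsto (fun n : ℕ => n / m) atTop atTop := Nat.tendsto_div_const_atTop (by omega)
  filter_upwards [hdiv.eventually hlim] with n hn
  set k := n / m with hk
  obtain ⟨hk1, hk2, hk3, hk4⟩ := hn
  have hn' : n % m + k * m = n := by rw [mul_comm]; exact Nat.mod_add_div n m
  have hb := hbound.opPow_add (hηs (n % m)) k
  rw [hn'] at hb
  have hk0 : (0 : ℝ) < k := by exact_mod_cast hk1
  have hnk : (k : ℝ) * m ≤ n := by
    have : k * m ≤ n := Nat.div_mul_le_self n m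
    exact_mod_cast this
  have hN : (k * μ + 0) + 2 * (c * k) ≤ (⌊r * n⌋₊ : ℝ) := by
    have h1 : r * n - 1 < ⌊r * n⌋₊ := by
      have := Nat.lt_floor_add_one (r * n)
      linarith
    have h2 : r * (k * m) ≤ r * n := by gcongr
    have h3 : (k : ℝ) * μ ≤ k * E.mean.toReal := by gcongr
    have h4 : (k : ℝ) * (4 * c) = r * (k * m) - k * E.mean.toReal := by rw [hc]; ring
    linarith
  obtain ⟨E', hE'⟩ := hb.exists_typical (t := c * k) (by positivity) hN
  refine ⟨E', fun s hs => (hE' s hs).trans ?_⟩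
  have hM' := hM (n % m) (Nat.mod_lt _ hm)
  have e1 : (k * V + 0) / (c * k) ^ 2 = V / (c ^ 2 * k) := by
    field_simp
    ring
  have e2 : (k * η + ηs (n % m)) / (c * k) ≤ δ / 4 + M / (c * k) := by
    rw [add_div]
    have h5 : k * η / (c * k) ≤ δ / 4 := by
      rw [div_le_iff₀ (by positivity)]
      have : k * η ≤ k * (δ * c / 4) := by gcongr
      linarith
    have h6 : ηs (n % m) / (c * k) ≤ M / (c * k) := by gcongr
    linarith
  rw [e1]
  linarith

end TypicalPowers

/-! ### Maps with finitely many Kraus operators -/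

section Kraus

variable {H K : Type*} [NormedAddCommGroup H] [InnerProductSpace ℂ H] [CompleteSpace H]
  [NormedAddCommGroup K] [InnerProductSpace ℂ K] [CompleteSpace K]

theorem sum_comp_comp_adjoint_mem {ι : Type*} [Fintype ι] (X : ι → H →L[ℂ] K) (T : TraceClass H) :
    ∑ i, X i ∘L T.1 ∘L (X i).adjoint ∈ TraceClass K :=
  Submodule.sum_mem _ fun _ _ => mem_traceClass.2 (traceNorm_conj_lt_top _ (mem_traceClass.1 T.2))

/-- The completely positive map `T ↦ ∑ᵢ Xᵢ T Xᵢ†` with finitely many Kraus operators `Xᵢ`. -/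
def krausMap {ι : Type*} [Fintype ι] (X : ι → H →L[ℂ] K) : SuperOp H K where
  toFun T := ⟨∑ i, X i ∘L T.1 ∘L (X i).adjoint, sum_comp_comp_adjoint_mem X T⟩
  map_add' S T := by
    ext v
    simp [Finset.sum_add_distrib]
  map_smul' c T := by
    ext v
    simp [Finset.smul_sum]

variable {ι : Type*} [Fintype ι]

theorem krausMap_coe (X : ι → H →L[ℂ] K) (T : TraceClass H) :
    (krausMap X T).1 = ∑ i, X i ∘L T.1 ∘L (X i).adjoint := rfl

theorem krausMap_ketbraTC (X : ι → H →L[ℂ] K) (ψ : H) :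
    (krausMap X (ketbraTC ψ)).1 = ∑ i, ketbra (X i ψ) :=
  Finset.sum_congr rfl fun i _ => comp_ketbra_adjoint (X i) ψ

theorem isCP_krausMap (X : ι → H →L[ℂ] K) : IsCP (krausMap X) := by
  intro k T hT v
  have e : ∑ i, ∑ j, ⟪v i, (krausMap X (T i j)).1 (v j)⟫_ℂ =
      ∑ x, ∑ i, ∑ j, ⟪(X x).adjoint (v i), (T i j).1 ((X x).adjoint (v j))⟫_ℂ := by
    simp only [krausMap_coe, sum_apply, inner_sum, ContinuousLinearMap.comp_apply,
      ContinuousLinearMap.adjoint_inner_left]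
    rw [Finset.sum_comm (s := (Finset.univ : Finset ι))]
    exact Finset.sum_congr rfl fun i _ => Finset.sum_comm
  rw [e]
  exact Finset.sum_nonneg fun x _ => hT fun i => (X x).adjoint (v i)

/-- The trace of `X T X†`, evaluated in a finite orthonormal basis of the domain. -/
theorem hasSum_inner_comp_comp_adjoint {μ κ : Type*} [Fintype μ] (e : HilbertBasis μ ℂ H)
    (c : HilbertBasis κ ℂ K) (X : H →L[ℂ] K) (T : H →L[ℂ] H) :
    HasSum (fun i => ⟪c i, (X ∘L T ∘L X.adjoint) (c i)⟫_ℂ)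
      (∑ m, ⟪T.adjoint (e m), (X.adjoint ∘L X) (e m)⟫_ℂ) := by
  have h : ∀ m, HasSum (fun i => ⟪X (T.adjoint (e m)), c i⟫_ℂ * ⟪c i, X (e m)⟫_ℂ)
      ⟪T.adjoint (e m), (X.adjoint ∘L X) (e m)⟫_ℂ := fun m => by
    rw [ContinuousLinearMap.comp_apply, ContinuousLinearMap.adjoint_inner_right]
    exact c.hasSum_inner_mul_inner _ _
  refine hasSum_of_eq (hasSum_sum fun m _ => h m) fun i => ?_
  have h2 := (e.hasSum_inner_mul_inner (X.adjoint (c i)) (T (X.adjoint (c i)))).unique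
    (hasSum_fintype _)
  rw [ContinuousLinearMap.comp_apply, ContinuousLinearMap.comp_apply,
    ← ContinuousLinearMap.adjoint_inner_left, h2]
  refine Finset.sum_congr rfl fun m _ => ?_
  rw [ContinuousLinearMap.adjoint_inner_left, ← ContinuousLinearMap.adjoint_inner_left T,
    ContinuousLinearMap.adjoint_inner_right, mul_comm]

theorem isChannel_krausMap {μ : Type*} [Fintype μ] (e : HilbertBasis μ ℂ H) {X : ι → H →L[ℂ] K}
    (hX : ∑ i, (X i).adjoint ∘L X i = 1) : IsChannel (krausMap X) := by
  refine ⟨isCP_krausMap X, fun T => ?_⟩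
  have h1 := hasSum_sum fun i (_ : i ∈ Finset.univ) =>
    hasSum_inner_comp_comp_adjoint e (basis K) (X i) T.1
  have h2 := hasSum_inner_comp_comp_adjoint e (basis H) (ContinuousLinearMap.id ℂ H) T.1
  have e1 : trace (krausMap X T) =
      ∑ i, ∑ m, ⟪T.1.adjoint (e m), ((X i).adjoint ∘L X i) (e m)⟫_ℂ := by
    rw [← h1.tsum_eq]
    refine tsum_congr fun k => ?_
    rw [krausMap_coe, sum_apply, inner_sum]
  have e2 : trace T = ∑ m, ⟪T.1.adjoint (e m), e m⟫_ℂ := by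
    have h3 := h2.tsum_eq
    simp only [ContinuousLinearMap.adjoint_id, ContinuousLinearMap.comp_id,
      ContinuousLinearMap.id_comp, ContinuousLinearMap.id_apply] at h3
    exact h3
  rw [e1, e2, Finset.sum_comm]
  refine Finset.sum_congr rfl fun m _ => ?_
  rw [← inner_sum, ← sum_apply, hX, one_apply_eq_self]

/-- Completeness of Kraus operators, tested on an orthonormal basis. -/
theorem sum_adjoint_comp_eq_one {μ : Type*} [DecidableEq μ] (e : HilbertBasis μ ℂ H)
    {X : ι → H →L[ℂ] K}
    (hX : ∀ m m', ∑ i, ⟪X i (e m), X i (e m')⟫_ℂ = if m = m' then 1 else 0) :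
    ∑ i, (X i).adjoint ∘L X i = 1 := by
  refine ContinuousLinearMap.ext_on (s := Set.range e) ?_ ?_
  · have := e.dense_span
    rw [← SetLike.coe_set_eq, Submodule.topologicalClosure_coe, Submodule.top_coe] at this
    exact dense_iff_closure_eq.2 this
  · rintro _ ⟨m', rfl⟩
    refine e.repr.injective ?_
    ext m
    rw [e.repr_apply_apply, e.repr_apply_apply, sum_apply, inner_sum, one_apply_eq_self,
      orthonormal_iff_ite.1 e.orthonormal, ← hX]
    refine Finset.sum_congr rfl fun i _ => ?_
    rw [ContinuousLinearMap.comp_apply, ContinuousLinearMap.adjoint_inner_right]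

theorem isStrongSum_of_fintype {I : Type} [Fintype I] {F : I → SuperOp H K} {E : SuperOp H K}
    (h : ∀ T, ∑ i, (F i T).1 = (E T).1) : IsStrongSum F E := by
  intro T
  refine tendsto_const_nhds.congr' ?_
  filter_upwards [eventually_ge_atTop Finset.univ] with s hs
  rw [Finset.univ_subset_iff.1 hs, h, sub_self, traceNorm_zero]

theorem strongTendsto_const (E : SuperOp H K) : StrongTendsto (fun _ => E) E := fun T => by
  simp [traceNorm_zero]

theorem isCoarseGraining_unit {I : Type} [Fintype I] {F : I → SuperOp H K} {E : SuperOp H K}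
    (h : ∀ T, ∑ i, (F i T).1 = (E T).1) : IsCoarseGraining F fun _ : Unit => E := by
  classical
  refine ⟨fun _ => (), fun _ => isStrongSum_of_fintype fun T => ?_⟩
  rw [← h T]
  exact Fintype.sum_equiv (Equiv.subtypeUnivEquiv fun _ => rfl) _ _ fun _ => rfl

theorem krausMap_prod {κ : Type*} [Fintype κ] (X : ι × κ → H →L[ℂ] K) (T : TraceClass H) :
    ∑ i, (krausMap (fun k => X (i, k)) T).1 = (krausMap X T).1 := by
  simp only [krausMap_coe]
  rw [Fintype.sum_prod_type]

end Kraus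

/-! ### One-way protocols in the classes of operations -/

section Classes

theorem opTensor_zero_left {A B C D : Type*} [NormedAddCommGroup A] [InnerProductSpace ℂ A]
    [NormedAddCommGroup B] [InnerProductSpace ℂ B] [NormedAddCommGroup C] [InnerProductSpace ℂ C]
    [NormedAddCommGroup D] [InnerProductSpace ℂ D] (L : B →L[ℂ] D) :
    opTensor (0 : A →L[ℂ] C) L = 0 := by
  refine HTensor.ext fun a b => ?_
  rw [opTensor_tmul, zero_apply, zero_apply, ← tmulRight_apply, map_zero]

variable {A B A' B' : HilbertSpace.{u}}

theorem isTensorMap_krausMap {ι κ : Type*} [Fintype ι] [Fintype κ] (M : ι → A →L[ℂ] A')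
    (L : κ → B →L[ℂ] B') :
    IsTensorMap (krausMap M) (krausMap L)
      (krausMap fun p : ι × κ => opTensor (M p.1) (L p.2)) := by
  intro S T
  apply Subtype.ext
  change ∑ p : ι × κ, opTensor (M p.1) (L p.2) ∘L opTensor S.1 T.1 ∘L
      (opTensor (M p.1) (L p.2)).adjoint =
    opTensor (∑ i, M i ∘L S.1 ∘L (M i).adjoint) (∑ j, L j ∘L T.1 ∘L (L j).adjoint)
  refine HTensor.ext fun a b => ?_
  simp only [adjoint_opTensor, opTensor_comp_opTensor, sum_apply, opTensor_tmul]
  rw [← tmulLeft_apply, map_sum, Fintype.sum_prod_type_right]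
  refine Finset.sum_congr rfl fun j _ => ?_
  rw [tmulLeft_apply, ← tmulRight_apply, map_sum]
  rfl

/-- A one-way protocol with finitely many Kraus operators: the party applies one of the Kraus
operators and communicates its label `i`, the other party applies a channel depending on `i`. -/
theorem isOneWayLOCC_krausMap (P : Party) {ι κ ν μ : Type} [Fintype ι] [Fintype κ] [Fintype ν]
    [Fintype μ] (e : HilbertBasis μ ℂ A) (f : HilbertBasis μ ℂ B)
    {M : ι → κ → A →L[ℂ] A'} {L : ι → ν → B →L[ℂ] B'}
    (hP : match P with
      | .alice => ∀ i, ∑ l, (L i l).adjoint ∘L L i l = 1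
      | .bob => ∀ i, ∑ k, (M i k).adjoint ∘L M i k = 1)
    (h : ∑ z : ι × κ × ν, (opTensor (M z.1 z.2.1) (L z.1 z.2.2)).adjoint ∘L
      opTensor (M z.1 z.2.1) (L z.1 z.2.2) = 1) :
    IsOneWayLOCC P fun _ : Unit =>
      krausMap fun z : ι × κ × ν => opTensor (M z.1 z.2.1) (L z.1 z.2.2) := by
  set X : ι × κ × ν → HTensor A B →L[ℂ] HTensor A' B' :=
    fun z => opTensor (M z.1 z.2.1) (L z.1 z.2.2)
  have hsum : ∀ T, ∑ i, (krausMap (fun p => X (i, p)) T).1 = (krausMap X T).1 :=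
    fun T => krausMap_prod X T
  refine ⟨inferInstance, ι, fun i => krausMap fun p => X (i, p),
    ⟨⟨inferInstance, fun i => isCP_krausMap _,
      krausMap X, isChannel_krausMap (productBasis e f) h, isStrongSum_of_fintype hsum⟩,
      fun i => ⟨krausMap (M i), krausMap (L i), isTensorMap_krausMap _ _, ?_⟩⟩,
    isCoarseGraining_unit hsum⟩
  cases P with
  | alice => exact ⟨isCP_krausMap _, isChannel_krausMap f (hP i)⟩
  | bob => exact ⟨isChannel_krausMap e (hP i), isCP_krausMap _⟩

theorem isOneWayLocal_id (P : Party) :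
    IsOneWayLocal P fun _ : Unit => (LinearMap.id : SuperOp (HTensor A B) (HTensor A B)) := by
  have hid : ∀ {H : Type u} [NormedAddCommGroup H] [InnerProductSpace ℂ H] [CompleteSpace H],
      IsChannel (LinearMap.id : SuperOp H H) := ⟨fun _ _ h => h, fun _ => rfl⟩
  refine ⟨⟨inferInstance, fun _ => hid.cp, LinearMap.id, hid,
    isStrongSum_of_fintype fun T => by simp⟩,
    fun _ => ⟨LinearMap.id, LinearMap.id, fun S T => rfl, ?_⟩⟩
  cases P with
  | alice => exact ⟨hid.cp, hid⟩
  | bob => exact ⟨hid, hid.cp⟩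

/-- Appending the identity is a further round. -/
theorem isLinked_self (E : SuperOp (HTensor A B) (HTensor A' B')) :
    IsLinked (fun _ : Unit => E) fun _ : Unit => E :=
  ⟨inferInstance, fun _ => Unit, fun _ _ => LinearMap.id,
    fun _ => ⟨Party.alice, isOneWayLocal_id _⟩, isCoarseGraining_unit fun T => by simp⟩

/-- The finite family of product Kraus operators is extended by zero to a sequence. -/
theorem isCountablySeparable_krausMap {Z : Type} [Fintype Z] {M : Z → A →L[ℂ] A'}
    {L : Z → B →L[ℂ] B'} (h : IsChannel (krausMap fun z => opTensor (M z) (L z))) :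
    IsCountablySeparable (krausMap fun z => opTensor (M z) (L z)) := by
  classical
  obtain ⟨g, hg⟩ := exists_injective_nat Z
  refine ⟨h, Function.extend g M 0, Function.extend g L 0, fun T => ?_⟩
  refine tendsto_const_nhds.congr' ?_
  filter_upwards [eventually_ge_atTop (Finset.univ.image g)] with s hs
  rw [← Finset.sum_subset hs, Finset.sum_image fun x _ y _ hxy => hg hxy]
  · simp only [hg.extend_apply]
    rw [krausMap_coe, sub_self, traceNorm_zero]
  · intro n _ hn
    have hn' : ¬∃ z, g z = n := by simpa using hn
    rw [Function.extend_apply' _ _ _ hn', Pi.zero_apply, opTensor_zero_left]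
    simp

/-- A one-way protocol with finitely many product Kraus operators belongs to all the classes, except
possibly to the one-way class for the other direction. -/
theorem krausMap_mem_channels {P : Party} {Z μ : Type} [Fintype Z] [Fintype μ]
    (e : HilbertBasis μ ℂ A) (f : HilbertBasis μ ℂ B)
    {M : Z → A →L[ℂ] A'} {L : Z → B →L[ℂ] B'}
    (h1 : ∑ z, (opTensor (M z) (L z)).adjoint ∘L opTensor (M z) (L z) = 1)
    (h : IsOneWayLOCC P fun _ : Unit => krausMap fun z => opTensor (M z) (L z))
    (O : OperationClass)
    (hO : match O with
      | .oneWayAliceToBob => P = .alice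
      | .oneWayBobToAlice => P = .bob
      | _ => True) :
    krausMap (fun z => opTensor (M z) (L z)) ∈ O.channels A B A' B' := by
  have hfin : IsFiniteLOCC fun _ : Unit => krausMap fun z => opTensor (M z) (L z) := ⟨0, P, h⟩
  have hsep := isCountablySeparable_krausMap (isChannel_krausMap (productBasis e f) h1)
  cases O with
  | oneWayAliceToBob => subst hO; exact h
  | oneWayBobToAlice => subst hO; exact h
  | finiteLOCC => exact hfin
  | LOCC =>
    exact ⟨fun _ => Unit, fun _ _ => krausMap fun z => opTensor (M z) (L z),
      fun _ => krausMap fun z => opTensor (M z) (L z), fun _ => hfin, fun _ => isLinked_self _,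
      fun _ => isCoarseGraining_unit fun T => by simp, strongTendsto_const _⟩
  | closureLOCC => exact ⟨fun _ => _, fun _ => hfin, strongTendsto_const _⟩
  | countablySeparable => exact hsep
  | separable => exact ⟨fun _ => _, fun _ => hsep, strongTendsto_const _⟩

end Classes

/-! ### Ebits as a maximally entangled vector -/

section Ebits

/-- `N` ebits form a maximally entangled vector of local dimension `2 ^ N`. The basis is indexed by
an abelian group, as the dilution protocol uses shifts of the index. -/
theorem exists_basis_vecPow_ebit (N : ℕ) :
    ∃ (G : Type) (_ : AddCommGroup G) (_ : Fintype G) (e : HilbertBasis G ℂ (qubit.{u}.pow N))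
      (γ : ℝ), Fintype.card G = 2 ^ N ∧ γ ^ 2 * Fintype.card G = 1 ∧
        vecPow ebit.{u} N = (γ : ℂ) • ∑ g, tmul (e g) (e g) := by
  induction N with
  | zero =>
    let e : HilbertBasis Unit ℂ (EuclideanSpace ℂ PUnit.{u + 1}) :=
      ((EuclideanSpace.basisFun PUnit.{u + 1} ℂ).reindex Equiv.punitEquivPUnit).toHilbertBasis
    refine ⟨Unit, inferInstance, inferInstance, e, 1, by simp, by simp, ?_⟩
    have he : e () = EuclideanSpace.single PUnit.unit 1 := by
      simp [e]
    simp only [Finset.univ_unique, Finset.sum_singleton, Complex.ofReal_one, one_smul]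
    change vecPow ebit 0 = tmul (e ()) (e ())
    rw [he]
    rfl
  | succ N ih =>
    obtain ⟨G, _, _, e, γ, hG, hγ, h⟩ := ih
    let q₀ : HilbertBasis (Fin 2) ℂ (EuclideanSpace ℂ (ULift.{u} (Fin 2))) :=
      ((EuclideanSpace.basisFun (ULift.{u} (Fin 2)) ℂ).reindex Equiv.ulift).toHilbertBasis
    have hq₀ : ∀ i, q₀ i = EuclideanSpace.single (ULift.up i) 1 := fun i => by simp [q₀]
    let q : HilbertBasis (Fin 2) ℂ qubit.{u} := q₀
    have hq : ∀ i, q i = ket i := hq₀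
    have hs : ((√2 : ℝ)⁻¹) ^ 2 * 2 = 1 := by
      rw [inv_pow, Real.sq_sqrt (by norm_num)]
      norm_num
    refine ⟨Fin 2 × G, inferInstance, inferInstance, productBasis q e, (√2)⁻¹ * γ, ?_, ?_, ?_⟩
    · rw [Fintype.card_prod, hG, Fintype.card_fin, pow_succ, mul_comm]
    · rw [Fintype.card_prod, Fintype.card_fin]
      push_cast
      calc ((√2)⁻¹ * γ) ^ 2 * (2 * (Fintype.card G : ℝ))
          = ((√2 : ℝ)⁻¹ ^ 2 * 2) * (γ ^ 2 * Fintype.card G) := by ring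
        _ = 1 := by rw [hs, hγ, one_mul]
    · have hstep : vecPow ebit.{u} (N + 1) =
          shuffle qubit qubit (qubit.pow N) (qubit.pow N) (tmul ebit (vecPow ebit N)) := rfl
      have hebit : ebit.{u} = ((√2 : ℝ) : ℂ)⁻¹ • ∑ i, tmul (q i) (q i) := by
        rw [ebit, Fin.sum_univ_two, hq, hq]
      have hx : tmul ebit.{u} (vecPow ebit N) = (((√2)⁻¹ * γ : ℝ) : ℂ) •
          ∑ p : Fin 2 × G, tmul (tmul (q p.1) (q p.1)) (tmul (e p.2) (e p.2)) := by
        rw [h, hebit, tmul_smul_left, tmul_smul_right, smul_smul]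
        push_cast
        congr 1
        rw [← tmulLeft_apply, map_sum, Fintype.sum_prod_type_right]
        refine Finset.sum_congr rfl fun g _ => ?_
        rw [tmulLeft_apply, ← tmulRight_apply, map_sum]
        rfl
      rw [hstep]
      refine (congrArg (shuffle qubit qubit (qubit.pow N) (qubit.pow N)) hx).trans ?_
      rw [map_smul, map_sum]
      refine congrArg _ (Finset.sum_congr rfl fun p _ => ?_)
      rw [shuffle_tmul]
      exact (congrArg₂ tmul (productBasis_apply q e p) (productBasis_apply q e p)).symm

end Ebits

/-! ### The Kraus operators of the dilution protocol -/

section BasisMap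

variable {H K : Type*} [NormedAddCommGroup H] [InnerProductSpace ℂ H] [CompleteSpace H]
  [NormedAddCommGroup K] [InnerProductSpace ℂ K] [CompleteSpace K]

/-- The operator that maps the vectors of a finite orthonormal basis to given vectors. -/
def basisMap {G : Type*} [Fintype G] (e : HilbertBasis G ℂ H) (v : G → K) : H →L[ℂ] K :=
  ∑ g, InnerProductSpace.rankOne ℂ (v g) (e g)

theorem basisMap_apply {G : Type*} [Fintype G] (e : HilbertBasis G ℂ H) (v : G → K) (g : G) :
    basisMap e v (e g) = v g := by
  classical
  rw [basisMap, sum_apply]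
  simp only [InnerProductSpace.rankOne_apply, orthonormal_iff_ite.1 e.orthonormal]
  simp

variable {G : Type*} [Fintype G]

/-- The vectors `a k` are orthonormal where the weight `c` does not vanish, and zero elsewhere. -/
def IsOrthonormalOn (c : G → ℝ) (a : G → K) : Prop :=
  (∀ k k', k ≠ k' → ⟪a k, a k'⟫_ℂ = 0) ∧ (∀ k, c k ≠ 0 → ‖a k‖ = 1) ∧ ∀ k, c k = 0 → a k = 0

variable [AddCommGroup G]

/-- The Kraus operators `|e_m⟩ ↦ √q(x) c_x(m + j) |a_x(m + j)⟩` of the party who prepares the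
Schmidt coefficients of a random state `x`. -/
def weightOp {ι : Type*} (e : HilbertBasis G ℂ H) (q : ι → ℝ) (c : ι → G → ℝ) (a : ι → G → K)
    (i : ι × G) : H →L[ℂ] K :=
  basisMap e fun m => ((√(q i.1) * c i.1 (m + i.2) : ℝ) : ℂ) • a i.1 (m + i.2)

open Classical in
/-- The Kraus operators of the party who applies the correction: the partial isometry
`|e_m⟩ ↦ |b(m + j)⟩`, and operators that map the complement of its initial space to `u`. -/
def shiftOp (e : HilbertBasis G ℂ H) (c : G → ℝ) (b : G → K) (u : K) (j : G) :
    Option G → H →L[ℂ] K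
  | none => basisMap e fun m => b (m + j)
  | some k => basisMap e fun m => if m + j = k ∧ c k = 0 then u else 0

theorem sum_weightOp {ι : Type*} [Fintype ι] (e : HilbertBasis G ℂ H) {q : ι → ℝ}
    (hq : ∀ x, 0 ≤ q x) (hq1 : ∑ x, q x = 1) {c : ι → G → ℝ} {a : ι → G → K}
    (hc : ∀ x, ∑ k, c x k ^ 2 = 1) (ha : ∀ x, IsOrthonormalOn (c x) (a x)) :
    ∑ i, (weightOp e q c a i).adjoint ∘L weightOp e q c a i = 1 := by
  classical
  refine sum_adjoint_comp_eq_one e fun m m' => ?_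
  simp only [weightOp, basisMap_apply, inner_smul_left, inner_smul_right, Complex.conj_ofReal]
  split_ifs with h
  · subst h
    have h1 : ∀ i : ι × G, ((√(q i.1) * c i.1 (m + i.2) : ℝ) : ℂ) *
        (((√(q i.1) * c i.1 (m + i.2) : ℝ) : ℂ) * ⟪a i.1 (m + i.2), a i.1 (m + i.2)⟫_ℂ) =
        ((q i.1 * c i.1 (m + i.2) ^ 2 : ℝ) : ℂ) := by
      intro i
      rw [inner_self_eq_norm_sq_to_K]
      by_cases hci : c i.1 (m + i.2) = 0
      · simp [hci]
      · rw [(ha i.1).2.1 _ hci]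
        have h2 := Real.mul_self_sqrt (hq i.1)
        have h3 : (√(q i.1) * c i.1 (m + i.2)) * (√(q i.1) * c i.1 (m + i.2)) =
            q i.1 * c i.1 (m + i.2) ^ 2 := by rw [← h2]; ring_nf; simp [hq]
        rw [← h3]
        push_cast
        ring
    rw [Finset.sum_congr rfl fun i _ => h1 i, ← Complex.ofReal_sum, Fintype.sum_prod_type]
    have h4 : ∀ x, ∑ j, q x * c x (m + j) ^ 2 = q x := fun x => by
      rw [← Finset.mul_sum, Fintype.sum_equiv (Equiv.addLeft m) (fun j => c x (m + j) ^ 2)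
        (fun k => c x k ^ 2) fun _ => rfl, hc, mul_one]
    simp only [h4, hq1, Complex.ofReal_one]
  · refine Finset.sum_eq_zero fun i _ => ?_
    rw [(ha i.1).1 _ _ fun h' => h (add_right_cancel h')]
    simp

theorem sum_shiftOp (e : HilbertBasis G ℂ H) {c : G → ℝ} {b : G → K}
    (hb : IsOrthonormalOn c b) {u : K} (hu : ‖u‖ = 1) (j : G) :
    ∑ l, (shiftOp e c b u j l).adjoint ∘L shiftOp e c b u j l = 1 := by
  classical
  refine sum_adjoint_comp_eq_one e fun m m' => ?_
  rw [Fintype.sum_option]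
  simp only [shiftOp, basisMap_apply]
  by_cases h : m = m'
  · subst h
    rw [if_pos rfl, Finset.sum_eq_single (m + j), inner_self_eq_norm_sq_to_K,
      inner_self_eq_norm_sq_to_K]
    · by_cases hc : c (m + j) = 0
      · simp [hc, hb.2.2 _ hc, hu]
      · simp [hc, hb.2.1 _ hc]
    · intro k _ hk
      simp [Ne.symm hk]
    · simp
  · rw [if_neg h, hb.1 _ _ fun h' => h (add_right_cancel h'), zero_add]
    refine Finset.sum_eq_zero fun k _ => ?_
    by_cases h1 : m + j = k
    · have h2 : m' + j ≠ k := fun h2 => h (add_right_cancel (h1.trans h2.symm))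
      simp [h2]
    · simp [h1]

end BasisMap

/-! ### Dilution to a mixture of vectors of bounded Schmidt rank -/

section Dilution

/-- A Schmidt decomposition `φ = ∑ₖ c(k) a(k) ⊗ b(k)` of a unit vector. -/
structure IsSchmidtForm {A B G : Type*} [NormedAddCommGroup A] [InnerProductSpace ℂ A]
    [CompleteSpace A] [NormedAddCommGroup B] [InnerProductSpace ℂ B] [CompleteSpace B] [Fintype G]
    (φ : HTensor A B) (c : G → ℝ) (a : G → A) (b : G → B) : Prop where
  sum_sq : ∑ k, c k ^ 2 = 1
  left : IsOrthonormalOn c a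
  right : IsOrthonormalOn c b
  eq_sum : φ = ∑ k, (c k : ℂ) • tmul (a k) (b k)

variable {A B A' B' : HilbertSpace.{u}}

theorem sum_opTensor_eq_one_left {ι ν : Type*} [Fintype ι] [Fintype ν] {M : ι → A →L[ℂ] A'}
    {L : ι → ν → B →L[ℂ] B'} (hM : ∑ i, (M i).adjoint ∘L M i = 1)
    (hL : ∀ i, ∑ l, (L i l).adjoint ∘L L i l = 1) :
    ∑ i, ∑ l, (opTensor (M i) (L i l)).adjoint ∘L opTensor (M i) (L i l) = 1 := by
  refine HTensor.ext fun a b => ?_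
  simp only [adjoint_opTensor, opTensor_comp_opTensor, sum_apply, opTensor_tmul, one_apply_eq_self]
  have h1 : ∀ i, ∑ l, tmul (((M i).adjoint ∘L M i) a) (((L i l).adjoint ∘L L i l) b) =
      tmul (((M i).adjoint ∘L M i) a) b := fun i => by
    simp only [← tmulLeft_apply]
    rw [← map_sum, ← sum_apply, hL, one_apply_eq_self]
  rw [Finset.sum_congr rfl fun i _ => h1 i]
  simp only [← tmulRight_apply]
  rw [← map_sum, ← sum_apply, hM, one_apply_eq_self]

theorem sum_opTensor_eq_one_right {ι ν : Type*} [Fintype ι] [Fintype ν] {M : ι → ν → A →L[ℂ] A'}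
    {L : ι → B →L[ℂ] B'} (hM : ∀ i, ∑ l, (M i l).adjoint ∘L M i l = 1)
    (hL : ∑ i, (L i).adjoint ∘L L i = 1) :
    ∑ i, ∑ l, (opTensor (M i l) (L i)).adjoint ∘L opTensor (M i l) (L i) = 1 := by
  refine HTensor.ext fun a b => ?_
  simp only [adjoint_opTensor, opTensor_comp_opTensor, sum_apply, opTensor_tmul, one_apply_eq_self]
  have h1 : ∀ i, ∑ l, tmul (((M i l).adjoint ∘L M i l) a) (((L i).adjoint ∘L L i) b) =
      tmul a (((L i).adjoint ∘L L i) b) := fun i => by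
    simp only [← tmulRight_apply]
    rw [← map_sum, ← sum_apply, hM, one_apply_eq_self]
  rw [Finset.sum_congr rfl fun i _ => h1 i]
  simp only [← tmulLeft_apply]
  rw [← map_sum, ← sum_apply, hL, one_apply_eq_self]

variable {ι G : Type} [Fintype ι] [Fintype G] [AddCommGroup G]

/-- The branches of the protocol, once the two product operators of each branch act in the right
way on the maximally entangled vector, add up to the target mixture. -/
theorem sum_ketbra_branches {H K : Type*} [NormedAddCommGroup H] [InnerProductSpace ℂ H]
    [CompleteSpace H] [NormedAddCommGroup K] [InnerProductSpace ℂ K] [CompleteSpace K]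
    {γ : ℝ} (hγ : γ ^ 2 * Fintype.card G = 1) {q : ι → ℝ} (hq : ∀ x, 0 ≤ q x) {φ : ι → K}
    {Φ : H} {X : ι × G → Option G → H →L[ℂ] K}
    (h1 : ∀ i, X i none Φ = ((γ * √(q i.1) : ℝ) : ℂ) • φ i.1) (h2 : ∀ i k, X i (some k) Φ = 0) :
    ∑ i, ∑ l, ketbra (X i l Φ) = ∑ x, (q x : ℂ) • ketbra (φ x) := by
  have h3 : ∀ i, ∑ l, ketbra (X i l Φ) = ((γ ^ 2 * q i.1 : ℝ) : ℂ) • ketbra (φ i.1) := by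
    intro i
    have h0 : ketbra (0 : K) = 0 := by ext v; simp [ketbra_apply]
    rw [Fintype.sum_option, h1, ketbra_smul, Complex.norm_real, Real.norm_eq_abs, sq_abs, mul_pow,
      Real.sq_sqrt (hq _)]
    simp [h2, h0]
  simp only [h3]
  rw [Fintype.sum_prod_type]
  refine Finset.sum_congr rfl fun x _ => ?_
  change ∑ _y : G, ((γ ^ 2 * q x : ℝ) : ℂ) • ketbra (φ x) = _
  rw [Finset.sum_const, ← Nat.cast_smul_eq_nsmul ℂ, smul_smul, Finset.card_univ]
  congr 1
  have : (Fintype.card G : ℝ) * (γ ^ 2 * q x) = q x := by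
    rw [← mul_assoc, mul_comm _ (γ ^ 2), hγ, one_mul]
  exact_mod_cast this

/-- In the main branch of each outcome the maximally entangled vector becomes the target vector. -/
theorem weightOp_shiftOp_none {φ : ι → HTensor A' B'} {c : ι → G → ℝ} {a : ι → G → A'}
    {b : ι → G → B'} (h : ∀ x, IsSchmidtForm (φ x) (c x) (a x) (b x)) (γ : ℝ) (q : ι → ℝ)
    (i : ι × G) :
    ∑ g, (γ : ℂ) • tmul (((√(q i.1) * c i.1 (g + i.2) : ℝ) : ℂ) • a i.1 (g + i.2))
      (b i.1 (g + i.2)) = ((γ * √(q i.1) : ℝ) : ℂ) • φ i.1 := by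
  rw [(h i.1).eq_sum, Finset.smul_sum]
  refine Fintype.sum_equiv (Equiv.addRight i.2) _ _ fun g => ?_
  rw [tmul_smul_left, smul_smul, smul_smul]
  push_cast
  simp [mul_assoc]

/-- Entanglement dilution with one-way communication in either direction: a maximally entangled
vector can be mapped to a mixture of vectors whose Schmidt rank is at most its local dimension. One
party draws the label `x`, applies one of the operators `weightOp`, which put the Schmidt
coefficients of `φ x` on a randomly shifted index, and reports the label and the shift; the other
party then applies the partial isometry of `shiftOp` for the same shift. -/
theorem exists_dilution (O : OperationClass) (e : HilbertBasis G ℂ A) (f : HilbertBasis G ℂ B)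
    {γ : ℝ} (hγ : γ ^ 2 * Fintype.card G = 1) {q : ι → ℝ} (hq : ∀ x, 0 ≤ q x)
    (hq1 : ∑ x, q x = 1) {φ : ι → HTensor A' B'} {c : ι → G → ℝ} {a : ι → G → A'}
    {b : ι → G → B'} (h : ∀ x, IsSchmidtForm (φ x) (c x) (a x) (b x)) :
    ∃ E ∈ O.channels A B A' B',
      (E (ketbraTC ((γ : ℂ) • ∑ g, tmul (e g) (f g)))).1 = ∑ x, (q x : ℂ) • ketbra (φ x) := by
  classical
  have hne : Nonempty ι := by
    by_contra hn
    rw [not_nonempty_iff] at hn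
    simp at hq1
  obtain ⟨x₀⟩ := hne
  obtain ⟨k₀, hk₀⟩ : ∃ k, c x₀ k ≠ 0 := by
    by_contra! hn
    have := (h x₀).sum_sq
    simp [hn] at this
  set Φ := (γ : ℂ) • ∑ g, tmul (e g) (f g) with hΦ
  have happ : ∀ (S : A →L[ℂ] A') (T : B →L[ℂ] B'),
      opTensor S T Φ = ∑ g, (γ : ℂ) • tmul (S (e g)) (T (f g)) := fun S T => by
    rw [hΦ, map_smul, map_sum, Finset.smul_sum]
    simp only [opTensor_tmul]
  by_cases hO : O = .oneWayBobToAlice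
  -- Bob measures and Alice corrects
  · set u := a x₀ k₀
    have hu : ‖u‖ = 1 := (h x₀).left.2.1 _ hk₀
    let L := weightOp f q c b
    let M : ι × G → Option G → A →L[ℂ] A' := fun i => shiftOp e (c i.1) (a i.1) u i.2
    have hL : ∑ i, (L i).adjoint ∘L L i = 1 :=
      sum_weightOp f hq hq1 (fun x => (h x).sum_sq) fun x => (h x).right
    have hM : ∀ i, ∑ l, (M i l).adjoint ∘L M i l = 1 := fun i =>
      sum_shiftOp e (h i.1).left hu i.2
    have hone : ∑ z : (ι × G) × Option G × Unit,
        (opTensor (M z.1 z.2.1) (L z.1)).adjoint ∘L opTensor (M z.1 z.2.1) (L z.1) = 1 := by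
      rw [← sum_opTensor_eq_one_right hM hL, Fintype.sum_prod_type]
      refine Finset.sum_congr rfl fun i _ => ?_
      rw [Fintype.sum_prod_type]
      simp
    have hway := isOneWayLOCC_krausMap .bob e f (M := M) (L := fun i (_ : Unit) => L i) hM hone
    refine ⟨_, krausMap_mem_channels e f hone hway O (by subst hO; rfl), ?_⟩
    rw [krausMap_ketbraTC, Fintype.sum_prod_type]
    refine (Finset.sum_congr rfl fun i _ => ?_).trans (sum_ketbra_branches (Φ := Φ)
      (X := fun i l => opTensor (M i l) (L i)) hγ hq (fun i => ?_) fun i k => ?_)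
    · rw [Fintype.sum_prod_type]
      simp
    · rw [happ, ← weightOp_shiftOp_none h γ q i]
      refine Finset.sum_congr rfl fun g _ => ?_
      simp only [M, L, shiftOp, weightOp, basisMap_apply]
      rw [tmul_smul_left, tmul_smul_right]
    -- the remaining Kraus operators see only indices of vanishing Schmidt coefficient
    · rw [happ]
      refine Finset.sum_eq_zero fun g _ => ?_
      simp only [M, L, shiftOp, weightOp, basisMap_apply]
      split_ifs with hg
      · rw [hg.1, hg.2, mul_zero, Complex.ofReal_zero, zero_smul, ← tmulLeft_apply, map_zero,
          smul_zero]
      · rw [← tmulRight_apply, map_zero, smul_zero]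
  -- Alice measures and Bob corrects
  · set u := b x₀ k₀
    have hu : ‖u‖ = 1 := (h x₀).right.2.1 _ hk₀
    let M := weightOp e q c a
    let L : ι × G → Option G → B →L[ℂ] B' := fun i => shiftOp f (c i.1) (b i.1) u i.2
    have hM : ∑ i, (M i).adjoint ∘L M i = 1 :=
      sum_weightOp e hq hq1 (fun x => (h x).sum_sq) fun x => (h x).left
    have hL : ∀ i, ∑ l, (L i l).adjoint ∘L L i l = 1 := fun i =>
      sum_shiftOp f (h i.1).right hu i.2
    have hone : ∑ z : (ι × G) × Unit × Option G,
        (opTensor (M z.1) (L z.1 z.2.2)).adjoint ∘L opTensor (M z.1) (L z.1 z.2.2) = 1 := by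
      rw [← sum_opTensor_eq_one_left hM hL, Fintype.sum_prod_type]
      refine Finset.sum_congr rfl fun i _ => ?_
      rw [Fintype.sum_prod_type]
      simp
    have hway := isOneWayLOCC_krausMap .alice e f (M := fun i (_ : Unit) => M i) (L := L) hL hone
    refine ⟨_, krausMap_mem_channels e f hone hway O ?_, ?_⟩
    · cases O <;> first | rfl | trivial
    rw [krausMap_ketbraTC, Fintype.sum_prod_type]
    refine (Finset.sum_congr rfl fun i _ => ?_).trans (sum_ketbra_branches (Φ := Φ)
      (X := fun i l => opTensor (M i) (L i l)) hγ hq (fun i => ?_) fun i k => ?_)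
    · rw [Fintype.sum_prod_type]
      simp
    · rw [happ, ← weightOp_shiftOp_none h γ q i]
      refine Finset.sum_congr rfl fun g _ => ?_
      simp only [M, L, shiftOp, weightOp, basisMap_apply]
    -- the remaining Kraus operators see only indices of vanishing Schmidt coefficient
    · rw [happ]
      refine Finset.sum_eq_zero fun g _ => ?_
      simp only [M, L, shiftOp, weightOp, basisMap_apply]
      split_ifs with hg
      · rw [hg.1, hg.2, mul_zero, Complex.ofReal_zero, zero_smul, ← tmulRight_apply, map_zero,
          smul_zero]
      · rw [← tmulLeft_apply, map_zero, smul_zero]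

end Dilution

/-! ### Truncation of Schmidt decompositions -/

section Truncation

theorem isOrthonormalOn_extend {K : Type*} [NormedAddCommGroup K] [InnerProductSpace ℂ K]
    [CompleteSpace K] {S G : Type*} [Fintype G] {g : S → G} (hg : Function.Injective g)
    {c : S → ℝ} (hc : ∀ j, c j ≠ 0) {v : S → K} (hv : Orthonormal ℂ v) :
    IsOrthonormalOn (Function.extend g c 0) (Function.extend g v 0) := by
  classical
  refine ⟨fun k k' hk => ?_, fun k hk => ?_, fun k hk => ?_⟩
  · by_cases h : ∃ j, g j = k
    · obtain ⟨j, rfl⟩ := h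
      by_cases h' : ∃ j, g j = k'
      · obtain ⟨j', rfl⟩ := h'
        rw [hg.extend_apply, hg.extend_apply]
        exact hv.2 fun e => hk (congrArg g e)
      · rw [Function.extend_apply' _ _ _ h', Pi.zero_apply, inner_zero_right]
    · rw [Function.extend_apply' _ _ _ h, Pi.zero_apply, inner_zero_left]
  · by_cases h : ∃ j, g j = k
    · obtain ⟨j, rfl⟩ := h
      rw [hg.extend_apply]
      exact hv.1 j
    · exact (hk (Function.extend_apply' _ _ _ h)).elim
  · by_cases h : ∃ j, g j = k
    · obtain ⟨j, rfl⟩ := h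
      rw [hg.extend_apply] at hk
      exact (hc j hk).elim
    · exact Function.extend_apply' _ _ _ h

variable {A B : Type*} [NormedAddCommGroup A] [InnerProductSpace ℂ A] [CompleteSpace A]
  [NormedAddCommGroup B] [InnerProductSpace ℂ B] [CompleteSpace B]

/-- Keeping finitely many Schmidt coefficients of a unit vector, of total squared weight `W`, and
normalizing gives a unit vector whose inner product with the original one is `√W`. -/
theorem exists_isSchmidtForm {J G : Type*} [Fintype G] {ψ : HTensor A B} (hψ : ‖ψ‖ = 1)
    (a : HilbertBasis J ℂ A)
    (horth : Pairwise fun i j => ⟪coef (a i) ψ, coef (a j) ψ⟫_ℂ = 0) (T : Finset J)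
    (hcard : T.card ≤ Fintype.card G) (hT : ∀ j ∈ T, coef (a j) ψ ≠ 0) {W : ℝ} (hW : 0 < W)
    (hWT : ∑ j ∈ T, ‖coef (a j) ψ‖ ^ 2 = W) (hW1 : W ≤ 1) :
    ∃ (φ : HTensor A B) (c : G → ℝ) (a' : G → A) (b' : G → B), IsSchmidtForm φ c a' b' ∧
      ‖φ‖ = 1 ∧ ‖φ - ψ‖ ^ 2 ≤ 2 * (1 - W) := by
  classical
  obtain ⟨⟨g, hg⟩⟩ : Nonempty (T ↪ G) :=
    Function.Embedding.nonempty_of_card_le (by simpa using hcard)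
  set β : J → B := fun j => coef (a j) ψ with hβ
  have hβ0 : ∀ j : T, ‖β j‖ ≠ 0 := fun j => norm_ne_zero_iff.2 (hT j j.2)
  set s := √W with hs
  have hs0 : 0 < s := Real.sqrt_pos.2 hW
  have hss : s * s = W := Real.mul_self_sqrt hW.le
  let c : T → ℝ := fun j => ‖β j‖ / s
  let b : T → B := fun j => ((‖β j‖⁻¹ : ℝ) : ℂ) • β j
  have hc : ∀ j, c j ≠ 0 := fun j => div_ne_zero (hβ0 j) hs0.ne'
  have hao : Orthonormal ℂ fun j : T => a j :=
    a.orthonormal.comp _ Subtype.val_injective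
  have hbo : Orthonormal ℂ b := by
    refine ⟨fun j => ?_, fun j k hjk => ?_⟩
    · simp only [b, norm_smul, Complex.norm_real, norm_inv, norm_norm]
      exact inv_mul_cancel₀ (hβ0 j)
    · simp only [b, inner_smul_left, inner_smul_right]
      rw [horth fun e => hjk (Subtype.ext e)]
      simp
  have hW' : ∑ j : T, ‖β j‖ ^ 2 = W :=
    (Finset.sum_coe_sort T fun j => ‖β j‖ ^ 2).trans hWT
  set φ : HTensor A B := ∑ j : T, (c j : ℂ) • tmul (a j) (b j) with hφ
  have hco : Orthonormal ℂ fun j : T => tmul (a j) (b j) := by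
    rw [orthonormal_iff_ite]
    intro j k
    rw [inner_tmul_tmul, orthonormal_iff_ite.1 hao, orthonormal_iff_ite.1 hbo]
    split_ifs <;> simp
  have hcc : ∑ j, c j ^ 2 = 1 := by
    simp only [c, div_pow]
    rw [← Finset.sum_div, hW', sq, hss, div_self hW.ne']
  have hφ1 : ‖φ‖ = 1 := by
    have h1 : ⟪φ, φ⟫_ℂ = 1 := by
      rw [hφ, hco.inner_sum]
      have : ∀ j, (starRingEnd ℂ) (c j : ℂ) * (c j : ℂ) = ((c j ^ 2 : ℝ) : ℂ) := fun j => by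
        rw [Complex.conj_ofReal]; push_cast; ring
      rw [Finset.sum_congr rfl fun j _ => this j, ← Complex.ofReal_sum, hcc, Complex.ofReal_one]
    have h2 : ‖φ‖ ^ 2 = 1 := by rw [@norm_sq_eq_re_inner ℂ, h1, RCLike.one_re]
    exact (pow_eq_one_iff_of_nonneg (norm_nonneg _) two_ne_zero).1 h2
  have hin : ⟪φ, ψ⟫_ℂ = (s : ℂ) := by
    rw [hφ, sum_inner]
    have h1 : ∀ j : T, ⟪(c j : ℂ) • tmul (a j) (b j), ψ⟫_ℂ = ((‖β j‖ ^ 2 / s : ℝ) : ℂ) := by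
      intro j
      rw [inner_smul_left, ← inner_coef, inner_smul_left, Complex.conj_ofReal, Complex.conj_ofReal]
      change (c j : ℂ) * (((‖β j‖⁻¹ : ℝ) : ℂ) * ⟪β j, β j⟫_ℂ) = _
      rw [inner_self_eq_norm_sq_to_K]
      have h2 : c j * (‖β j‖⁻¹ * ‖β j‖ ^ 2) = ‖β j‖ ^ 2 / s := by
        have := hβ0 j
        simp only [c]
        field_simp
      rw [← h2]
      push_cast
      rfl
    rw [Finset.sum_congr rfl fun j _ => h1 j, ← Complex.ofReal_sum, ← Finset.sum_div, hW', ← hss,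
      mul_div_cancel_right₀ _ hs0.ne']
  refine ⟨φ, Function.extend g c 0, Function.extend g (fun j => a j) 0, Function.extend g b 0,
    ⟨?_, isOrthonormalOn_extend hg hc hao, isOrthonormalOn_extend hg hc hbo, ?_⟩, hφ1, ?_⟩
  · rw [← hcc]
    refine (Fintype.sum_of_injective g hg _ _ (fun k hk => ?_) fun j => ?_).symm
    swap
    · rw [hg.extend_apply]
    rw [Function.extend_apply' _ _ _ hk]
    simp
  · refine Fintype.sum_of_injective g hg _ _ (fun k hk => ?_) fun j => ?_
    swap
    · rw [hg.extend_apply, hg.extend_apply, hg.extend_apply]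
    · rw [Function.extend_apply' _ _ _ hk]
      simp
  · rw [@norm_sub_sq ℂ, hφ1, hψ, hin]
    have h1 : s ≤ 1 := by
      rw [hs]; exact Real.sqrt_le_one.2 hW1
    have h2 : RCLike.re (s : ℂ) = s := Complex.ofReal_re s
    rw [h2]
    nlinarith

/-- At most `K` squared Schmidt coefficients of a unit vector are at least `1 / K`. -/
theorem SchmidtEnsemble.exists_finset {A B : Type u} [NormedAddCommGroup A]
    [InnerProductSpace ℂ A] [CompleteSpace A] [NormedAddCommGroup B] [InnerProductSpace ℂ B]
    [CompleteSpace B] {ρ : HTensor A B →L[ℂ] HTensor A B} (E : SchmidtEnsemble ρ) {K : ℕ}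
    (hK : 0 < K) (x : E.I) :
    ∃ T : Finset (E.J x), T.card ≤ K ∧ ∀ j, j ∈ T ↔ (K : ℝ)⁻¹ ≤ E.lam ⟨x, j⟩ := by
  classical
  have hK' : (0 : ℝ) < (K : ℝ)⁻¹ := by positivity
  have hle : ∀ T : Finset (E.J x), (∀ j ∈ T, (K : ℝ)⁻¹ ≤ E.lam ⟨x, j⟩) → T.card ≤ K := by
    intro T hT
    have h1 : ∑ j ∈ T, E.lam ⟨x, j⟩ ≤ 1 :=
      sum_le_hasSum T (fun _ _ => E.lam_nonneg _) (E.hasSum_lam x)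
    have h2 := Finset.card_nsmul_le_sum T _ _ hT
    rw [nsmul_eq_mul] at h2
    have h3 : (T.card : ℝ) * (K : ℝ)⁻¹ ≤ 1 := h2.trans h1
    rw [← div_eq_mul_inv, div_le_one (by positivity)] at h3
    exact_mod_cast h3
  have hfin : {j | (K : ℝ)⁻¹ ≤ E.lam ⟨x, j⟩}.Finite := by
    have := (E.hasSum_lam x).summable.tendsto_cofinite_zero
    have h4 := this.eventually (gt_mem_nhds hK')
    refine (Filter.eventually_cofinite.1 h4).subset fun j hj => ?_
    exact not_lt.2 hj
  refine ⟨hfin.toFinset, hle _ fun j hj => by simpa using hj, fun j => by simp⟩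

end Truncation

/-! ### Error estimates -/

section Error

variable {H : Type*} [NormedAddCommGroup H] [InnerProductSpace ℂ H] [CompleteSpace H]

/-- The trace distance between a state and a finite mixture that approximates the main part of a
pure-state decomposition. -/
theorem traceNorm_mixture_sub_le {I : Type*} {σ : H →L[ℂ] H} (hσ : IsState σ) {p : I → ℝ}
    (hp : ∀ x, 0 ≤ p x) {ψ : I → H} (hψ : ∀ x, ‖ψ x‖ = 1)
    (h : HasSum (fun x => (p x : ℂ) • ketbra (ψ x)) σ) (X : Finset I) {P : ℝ} (hP : 0 < P)
    (hPX : ∑ x ∈ X, p x = P) {φ : I → H} (hφ : ∀ x ∈ X, ‖φ x‖ = 1) {ε : ℝ}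
    (hε : ∀ x ∈ X, ‖φ x - ψ x‖ ≤ ε) :
    traceNorm (∑ x ∈ X, ((p x / P : ℝ) : ℂ) • ketbra (φ x) - σ) ≤
      ENNReal.ofReal (2 * ε + 2 * (1 - P)) := by
  have hnn : ∀ x, 0 ≤ (p x : ℂ) • ketbra (ψ x) := fun x =>
    smul_nonneg (by exact_mod_cast hp x) (ketbra_nonneg _)
  set S := ∑ x ∈ X, (p x : ℂ) • ketbra (ψ x) with hS
  have hR : 0 ≤ σ - S := sub_nonneg.2 (sum_le_hasSum X (fun x _ => hnn x) h)
  have hS0 : 0 ≤ S := Finset.sum_nonneg fun x _ => hnn x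
  have htr : posTrace S = ENNReal.ofReal P := by
    rw [hS, posTrace_sum X _ hnn, ← hPX, ENNReal.ofReal_sum_of_nonneg fun x _ => hp x]
    refine Finset.sum_congr rfl fun x _ => ?_
    rw [posTrace_smul (hp x), posTrace_ketbra, enorm_sq_eq_ofReal, hψ]
    simp
  have htot : ENNReal.ofReal P + posTrace (σ - S) = 1 := by
    rw [← htr, ← posTrace_add hS0 hR, add_sub_cancel, hσ.posTrace_eq_one]
  have hP1 : P ≤ 1 := by
    rw [← ENNReal.ofReal_le_one, ← htot]
    exact le_self_add
  have hRt : posTrace (σ - S) = ENNReal.ofReal (1 - P) := by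
    rw [ENNReal.ofReal_sub _ hP.le, ENNReal.ofReal_one, ← htot]
    exact (ENNReal.add_sub_cancel_left ENNReal.ofReal_ne_top).symm
  have hq : ∑ x ∈ X, p x / P = 1 := by rw [← Finset.sum_div, hPX, div_self hP.ne']
  have hq0 : ∀ x, 0 ≤ p x / P := fun x => div_nonneg (hp x) hP.le
  have hε0 : 0 ≤ ε := by
    obtain ⟨x, hx⟩ : X.Nonempty := by
      by_contra hX
      rw [Finset.not_nonempty_iff_eq_empty] at hX
      simp [hX] at hq
    exact (norm_nonneg _).trans (hε x hx)
  -- the errors from the vectors, from the renormalization and from the omitted labels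
  have e : ∑ x ∈ X, ((p x / P : ℝ) : ℂ) • ketbra (φ x) - σ =
      ∑ x ∈ X, ((p x / P : ℝ) : ℂ) • (ketbra (φ x) - ketbra (ψ x)) +
        (∑ x ∈ X, ((p x / P - p x : ℝ) : ℂ) • ketbra (ψ x) + -(σ - S)) := by
    simp only [smul_sub, Complex.ofReal_sub, sub_smul, Finset.sum_sub_distrib, hS]
    abel
  have hqp : ∀ x, 0 ≤ p x / P - p x := fun x =>
    sub_nonneg.2 ((le_div_iff₀ hP).2 (mul_le_of_le_one_right (hp x) hP1))
  have h1 : traceNorm (∑ x ∈ X, ((p x / P : ℝ) : ℂ) • (ketbra (φ x) - ketbra (ψ x))) ≤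
      ENNReal.ofReal (2 * ε) := by
    refine (traceNorm_sum_le X _).trans ?_
    have h2 : ∀ x ∈ X, traceNorm (((p x / P : ℝ) : ℂ) • (ketbra (φ x) - ketbra (ψ x))) ≤
        ENNReal.ofReal (p x / P * (2 * ε)) := fun x hx => by
      rw [traceNorm_smul, Complex.norm_real, Real.norm_of_nonneg (hq0 x),
        ENNReal.ofReal_mul (hq0 x)]
      gcongr
      refine (traceNorm_ketbra_sub_le (hφ x hx).le (hψ x).le).trans ?_
      gcongr
      exact hε x hx
    refine (Finset.sum_le_sum h2).trans ?_
    rw [← ENNReal.ofReal_sum_of_nonneg fun x _ => mul_nonneg (hq0 x) (by linarith),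
      ← Finset.sum_mul, hq, one_mul]
  have h3 : traceNorm (∑ x ∈ X, ((p x / P - p x : ℝ) : ℂ) • ketbra (ψ x)) ≤
      ENNReal.ofReal (1 - P) := by
    refine (traceNorm_sum_le X _).trans (le_of_eq ?_)
    have h4 : ∀ x, traceNorm (((p x / P - p x : ℝ) : ℂ) • ketbra (ψ x)) =
        ENNReal.ofReal (p x / P - p x) := fun x => by
      rw [traceNorm_smul, Complex.norm_real, Real.norm_of_nonneg (hqp x), traceNorm_ketbra,
        enorm_sq_eq_ofReal, hψ]
      simp
    rw [Finset.sum_congr rfl fun x _ => h4 x, ← ENNReal.ofReal_sum_of_nonneg fun x _ => hqp x,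
      Finset.sum_sub_distrib, hq, hPX]
  have h5 : traceNorm (-(σ - S)) = ENNReal.ofReal (1 - P) := by
    rw [traceNorm_neg, traceNorm_of_nonneg hR, hRt]
  rw [e]
  refine (traceNorm_add_le _ _).trans ((add_le_add h1 ((traceNorm_add_le _ _).trans
    (add_le_add h3 h5.le))).trans (le_of_eq ?_))
  rw [← ENNReal.ofReal_add (by linarith) (by linarith),
    ← ENNReal.ofReal_add (by linarith) (by linarith)]
  congr 1
  ring

/-- Markov's inequality: the labels for which a nonnegative variable of mean at most `ε ^ 2` is at
most `ε` have probability at least `1 - ε`, and finitely many of them at least `1 - 2 * ε`. -/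
theorem exists_finset_of_hasSum_le {I : Type*} {p h : I → ℝ} (hp : ∀ x, 0 ≤ p x)
    (hp1 : HasSum p 1) (hh : ∀ x, 0 ≤ h x) {d ε : ℝ} (hε : 0 < ε)
    (hd : HasSum (fun x => p x * h x) d) (hdε : d ≤ ε ^ 2) :
    ∃ X : Finset I, (∀ x ∈ X, h x ≤ ε) ∧ 1 - 2 * ε ≤ ∑ x ∈ X, p x := by
  classical
  have h1 := hp1.sub (hd.div_const ε)
  have h2 : 1 - 2 * ε < 1 - d / ε := by
    have : d / ε ≤ ε := by
      rw [div_le_iff₀ hε]; linarith [sq ε]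
    linarith
  obtain ⟨F, hF⟩ := ((tendsto_order.1 h1).1 _ h2).exists
  refine ⟨F.filter fun x => h x ≤ ε, fun x hx => (Finset.mem_filter.1 hx).2, hF.le.trans ?_⟩
  rw [Finset.sum_filter]
  refine Finset.sum_le_sum fun x _ => ?_
  have h3 : 0 ≤ p x * h x / ε := div_nonneg (mul_nonneg (hp x) (hh x)) hε.le
  split_ifs with hx
  · linarith
  · have : p x ≤ p x * h x / ε := by
      rw [le_div_iff₀ hε]
      exact mul_le_mul_of_nonneg_left (not_le.1 hx).le (hp x)
    linarith

end Error

/-! ### Achievable rates -/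

section Achievability

variable {A B : HilbertSpace.{u}}

theorem isState_opPow {ρ : HTensor A B →L[ℂ] HTensor A B} (hρ : IsState ρ) (n : ℕ) :
    IsState (opPow ρ n) := by
  induction n with
  | zero =>
    have h : ketbra (tmul vacuum.{u} vacuum.{u}) = 1 :=
      ketbra_tmul_eq_one norm_vacuum norm_vacuum eq_smul_vacuum eq_smul_vacuum
    have h1 : IsState (ketbra (tmul vacuum.{u} vacuum.{u})) :=
      isState_ketbra (by rw [norm_tmul, norm_vacuum, mul_one])
    rw [h] at h1
    exact h1
  | succ n ih =>
    have h : opPow ρ (n + 1) = tensorState ρ (opPow ρ n) := tensorState_eq _ _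
    rw [h]
    exact isState_tensorState hρ ih

/-- The weight of the Schmidt coefficients below `t`, summed over the basis for each label. -/
theorem SchmidtEnsemble.exists_hasSum_atypical {A B : Type u} [NormedAddCommGroup A]
    [InnerProductSpace ℂ A] [CompleteSpace A] [NormedAddCommGroup B] [InnerProductSpace ℂ B]
    [CompleteSpace B] {ρ : HTensor A B →L[ℂ] HTensor A B} (E : SchmidtEnsemble ρ) {t δ : ℝ}
    (hE : ∀ s : Finset E.Idx, (∀ z ∈ s, E.lam z < t) → ∑ z ∈ s, E.w z ≤ δ)
    (T : ∀ x, Finset (E.J x)) (hT : ∀ x j, j ∈ T x ↔ t ≤ E.lam ⟨x, j⟩) :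
    ∃ d ≤ δ, HasSum (fun x => E.p x * (1 - ∑ j ∈ T x, E.lam ⟨x, j⟩)) d := by
  classical
  set f : E.Idx → ℝ := fun z => if E.lam z < t then E.w z else 0 with hf
  have hf0 : ∀ z, 0 ≤ f z := fun z => by
    simp only [hf]
    split_ifs
    exacts [E.w_nonneg z, le_rfl]
  have hle : ∀ s : Finset E.Idx, ∑ z ∈ s, f z ≤ δ := fun s => by
    rw [hf, ← Finset.sum_filter]
    exact hE _ fun z hz => (Finset.mem_filter.1 hz).2
  have hs : Summable f := summable_of_sum_le hf0 hle
  refine ⟨∑' z, f z, hs.tsum_le_of_sum_le hle, hs.hasSum.sigma fun x => ?_⟩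
  have h1 : HasSum (fun j => if j ∈ T x then E.lam ⟨x, j⟩ else 0) (∑ j ∈ T x, E.lam ⟨x, j⟩) := by
    have : HasSum (fun j => if j ∈ T x then E.lam ⟨x, j⟩ else 0)
        (∑ j ∈ T x, if j ∈ T x then E.lam ⟨x, j⟩ else 0) :=
      hasSum_sum_of_ne_finset_zero fun j hj => by simp [hj]
    rwa [Finset.sum_congr rfl fun j hj => if_pos hj] at this
  refine hasSum_of_eq (((E.hasSum_lam x).sub h1).mul_left (E.p x)) fun j => ?_
  by_cases hj : j ∈ T x
  · have := not_lt.2 ((hT x j).1 hj)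
    simp [hf, hj, this]
  · have : E.lam ⟨x, j⟩ < t := not_le.1 fun h => hj ((hT x j).2 h)
    simp [hf, hj, this, SchmidtEnsemble.w]

/-- One-shot dilution: `N` ebits suffice to prepare a state up to a small error when most of the
Schmidt weight of an ensemble lies on coefficients that are at least `2 ^ (-N)`. -/
theorem exists_channel_traceNorm_le {σ : HTensor A B →L[ℂ] HTensor A B} (hσ : IsState σ)
    (O : OperationClass) (E : SchmidtEnsemble σ) (N : ℕ) {ε : ℝ} (hε : 0 < ε) (hε1 : ε < 1 / 2)
    (hE : ∀ s : Finset E.Idx, (∀ z ∈ s, E.lam z < 2 ^ (-(N : ℝ))) → ∑ z ∈ s, E.w z ≤ ε ^ 2) :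
    ∃ F ∈ O.channels (qubit.{u}.pow N) (qubit.{u}.pow N) A B,
      traceNorm ((F (ketbraTC (vecPow ebit N))).1 - σ) ≤
        ENNReal.ofReal (2 * √(2 * ε) + 4 * ε) := by
  classical
  obtain ⟨G, _, _, e, γ, hG, hγ, hebit⟩ := exists_basis_vecPow_ebit.{u} N
  have hK : 0 < Fintype.card G := by rw [hG]; positivity
  have ht : (2 : ℝ) ^ (-(N : ℝ)) = (Fintype.card G : ℝ)⁻¹ := by
    rw [hG, Real.rpow_neg (by norm_num), Real.rpow_natCast]
    push_cast
    rfl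
  rw [ht] at hE
  choose T hTcard hT using E.exists_finset hK
  obtain ⟨d, hd, hsum⟩ := E.exists_hasSum_atypical hE T hT
  have hW1 : ∀ x, ∑ j ∈ T x, E.lam ⟨x, j⟩ ≤ 1 := fun x =>
    sum_le_hasSum _ (fun _ _ => E.lam_nonneg _) (E.hasSum_lam x)
  obtain ⟨X, hX, hXp⟩ := exists_finset_of_hasSum_le E.p_nonneg E.hasSum_p
    (fun x => sub_nonneg.2 (hW1 x)) hε hsum hd
  have hP : 0 < ∑ x ∈ X, E.p x := by linarith
  have hform : ∀ x : X, ∃ (φ : HTensor A B) (c : G → ℝ) (a : G → A) (b : G → B),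
      IsSchmidtForm φ c a b ∧ ‖φ‖ = 1 ∧
        ‖φ - E.ψ x‖ ^ 2 ≤ 2 * (1 - ∑ j ∈ T x, E.lam ⟨x, j⟩) := fun x =>
    exists_isSchmidtForm (E.norm_ψ x) (E.a x) (E.orth x) (T x) (hTcard x)
      (fun j hj h0 => by
        have h1 := (hT x j).1 hj
        have h2 : E.lam ⟨x, j⟩ = 0 := by
          change ‖coef (E.a x j) (E.ψ x)‖ ^ 2 = 0
          rw [h0, norm_zero]
          norm_num
        rw [h2] at h1
        have : (0 : ℝ) < (Fintype.card G : ℝ)⁻¹ := by positivity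
        linarith)
      (by have := hX x x.2; linarith) rfl (hW1 x)
  choose φ c a b hS hφ1 hφψ using hform
  have hq1 : ∑ x : X, E.p x / ∑ x ∈ X, E.p x = 1 := by
    rw [← Finset.sum_div, Finset.sum_coe_sort X E.p, div_self hP.ne']
  obtain ⟨F, hF, hout⟩ := exists_dilution O e e hγ
    (q := fun x : X => E.p x / ∑ x ∈ X, E.p x)
    (fun x => div_nonneg (E.p_nonneg _) hP.le) hq1 hS
  refine ⟨F, hF, ?_⟩
  rw [hebit, hout]
  let φ' : E.I → HTensor A B := fun x => if hx : x ∈ X then φ ⟨x, hx⟩ else 0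
  have hφ' : ∀ x : X, φ' x = φ x := fun x => by simp [φ']
  have hmix := traceNorm_mixture_sub_le hσ E.p_nonneg E.norm_ψ E.hasSum X hP rfl (φ := φ')
    (ε := √(2 * ε)) (fun x hx => by rw [hφ' ⟨x, hx⟩]; exact hφ1 _) fun x hx => by
      rw [hφ' ⟨x, hx⟩]
      refine Real.le_sqrt_of_sq_le ((hφψ ⟨x, hx⟩).trans ?_)
      have := hX x hx
      linarith
  rw [← Finset.sum_coe_sort] at hmix
  simp only [hφ'] at hmix
  refine hmix.trans (ENNReal.ofReal_le_ofReal ?_)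
  linarith

/-- Every rate above the regularized entanglement of formation is achievable: the one-shot protocol
applies to `ρ^{⊗n}` by typicality, with an arbitrarily small error. -/
theorem isAchievableRate_of_regularizedEoF_lt {ρ : HTensor A B →L[ℂ] HTensor A B}
    (hρ : IsState ρ) (hfin : entanglementOfFormation ρ < ∞) (O : OperationClass) {r : ℝ}
    (hr0 : 0 < r) (hr : regularizedEoF ρ < ENNReal.ofReal r) : IsAchievableRate O ρ r := by
  refine ENNReal.tendsto_nhds_zero.2 fun η hη => ?_
  have hlim : Tendsto (fun ε : ℝ => ENNReal.ofReal (2 * √(2 * ε) + 4 * ε)) (𝓝[>] 0) (𝓝 0) := by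
    have h1 : Continuous fun ε : ℝ => ENNReal.ofReal (2 * √(2 * ε) + 4 * ε) :=
      ENNReal.continuous_ofReal.comp (by fun_prop)
    have h2 := h1.tendsto 0
    simp only [mul_zero, Real.sqrt_zero, add_zero, ENNReal.ofReal_zero] at h2
    exact h2.mono_left nhdsWithin_le_nhds
  obtain ⟨ε, hεη, hε, hε1⟩ := ((hlim.eventually (gt_mem_nhds hη)).and
    ((Ioo_mem_nhdsGT (show (0 : ℝ) < 1 / 2 by norm_num)))).exists
  filter_upwards [eventually_exists_typical hfin hr0 hr (δ := ε ^ 2) (by positivity)] with n hn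
  obtain ⟨E, hE⟩ := hn
  obtain ⟨F, hF, hFn⟩ := exists_channel_traceNorm_le (isState_opPow hρ n) O E ⌊r * n⌋₊ hε hε1 hE
  refine (iInf₂_le F hF).trans ?_
  calc 2⁻¹ * traceNorm ((F (ketbraTC (vecPow ebit ⌊r * n⌋₊))).1 - opPow ρ n)
      ≤ 1 * ENNReal.ofReal (2 * √(2 * ε) + 4 * ε) := by
        gcongr
        exact ENNReal.inv_le_one.2 (by norm_num)
    _ ≤ η := by rw [one_mul]; exact hεη.le

theorem entanglementCost_le_regularizedEoF {ρ : HTensor A B →L[ℂ] HTensor A B}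
    (hρ : IsState ρ) (hfin : entanglementOfFormation ρ < ∞) (O : OperationClass) :
    entanglementCost O ρ ≤ regularizedEoF ρ := by
  refine le_of_forall_gt fun s hs => ?_
  obtain ⟨r, hr1, hr2⟩ := ENNReal.lt_iff_exists_real_btwn.1 hs
  obtain ⟨hr1', hr3⟩ := hr2
  have hr0 : 0 < r := ENNReal.ofReal_pos.1 (bot_le.trans_lt hr1')
  exact (iInf₂_le_of_le r hr0 (iInf_le _
    (isAchievableRate_of_regularizedEoF_lt hρ hfin O hr0 hr1'))).trans_lt hr3

end Achievability

end EntanglementCost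
end

open EntanglementCost

theorem mainTheorem2 (A B : HilbertSpace.{u})
    (ρ : HTensor A B →L[ℂ] HTensor A B) (hρ : IsState ρ)
    (hS : min (entropy (reducedLeft ρ)) (entropy (reducedRight ρ)) < ∞) :
    Tendsto (fun n : ℕ => entanglementOfFormation (opPow ρ n) / n) atTop (𝓝 (regularizedEoF ρ)) ∧
      ∀ O : OperationClass, entanglementCost O ρ ≤ regularizedEoF ρ := by
  have hfin : entanglementOfFormation ρ < ∞ :=
    (entanglementOfFormation_le_min hρ).trans_lt hS
  exact ⟨tendsto_regularizedEoF hfin, entanglementCost_le_regularizedEoF hρ hfin⟩
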